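/- Fix $\delta>0$. For $f:\mathbb R\to\mathbb C$ let $$(Tf)(x)=\frac1{2\delta}\,\mathrm{p.v.}\!\int_{\mathbb R}\coth\Big(\frac{\pi}{2\delta}(x'-x)\Big)f(x')\,dx',\qquad (\tilde Tf)(x)=\frac1{2\delta}\int_{\mathbb R}\tanh\Big(\frac{\pi}{2\delta}(x'-x)\Big)f(x')\,dx'.$$ The non-chiral ILW equation for $u,v:\mathbb R_x\times\mathbb R_t\to\mathbb C$ is $$u_t+2uu_x+Tu_{xx}+\tilde Tv_{xx}=0,\qquad v_t-2vv_x-Tv_{xx}-\tilde Tu_{xx}=0, \tag{1}$$ where a solution is understood to be $C^2$ in $x$ and differentiable in $t$, with all transforms in (1) existing. For functions $F(z,t),G(z,t)$ of $z\in\mathbb C$, $t\in\mathbb R$ put $F^\pm(x,t)=F(x\pm i\delta/2,t)$, $G^\pm(x,t)=G(x\pm i\delta/2,t)$, and let $D_t^mD_x^n f\cdot g=(\partial_t-\partial_{t'})^m(\partial_x-\partial_{x'})^n f(x,t)g(x',t')|_{x'=x,\,t'=t}$. The bilinear system is $$(iD_t-D_x^2)F^-\cdot G^+=0,\qquad (iD_t-D_x^2)F^+\cdot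 G^-=0. \tag{2}$$ Say that $\log F,\log G$ have *matched linear asymptotics* on a strip if there are $f_1\in\mathbb C$ and differentiable $f_\pm,g_\pm:\mathbb R\to\mathbb C$, with $f_+(t)-g_+(t)$ independent of $t$, such that for each $t$, as $x=\mathrm{Re}\,z\to\pm\infty$ uniformly in $\mathrm{Im}\,z$, $$\log F(z,t)=f_\pm(t)\pm f_1z+O(x^{-1}),\qquad \log G(z,t)=g_\pm(t)\pm f_1z+O(x^{-1}). \tag{3}$$ Call $(F,G)$ *admissible* if $F$ and $G$ have logarithms, analytic in $z$ for $|\mathrm{Im}\,z|<\delta/2$ and continuous for $|\mathrm{Im}\,z|\le\delta/2$, with matched linear asymptotics on the closed strip, and such that for each of them ($L=\log F$ or $\log G$): the $z$-derivatives of $L$ up to order 3 extend continuously to the closed strip; on the closed strip $\partial_tL$ and $\partial_t\partial_zL$ exist, and $\partial_t\partial_zL$ is jointly continuous in $(z,t)$; and, for each $t$ and uniformly in $\mathrm{Im}\,z$ on the closed strip, the remainders in (3) have $z$-derivatives of orders $1,2,3$ that are $O(x^{-2})$ and a $t$-derivative that is $O(x^{-1})$. **(A)** Let $(F,G)$ be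 admissible. Then $F,G$ satisfy (2) if and only if $$u=i\partial_x\log\frac{F^-}{G^+},\qquad v=i\partial_x\log\frac{G^-}{F^+} \tag{4}$$ satisfy (1). **(B)** Let $(u,v)$ be a solution of (1) with $u,v\in C^4(\mathbb R^2)$, such that $\partial_x^ku,\partial_x^kv$ ($k\le4$) and $\partial_t\partial_x^ku,\partial_t\partial_x^kv$ ($k\le 3$) are $O((1+|x|)^{-3})$ locally uniformly in $t$, and such that $Tu,Tv,\tilde Tu,\tilde Tv$ exist. Put $u_\pm=\frac12u\mp\frac i2(Tu+\tilde Tv)$ and $v_\pm=\frac12v\pm\frac i2(Tv+\tilde Tu)$. Then there are functions $F,G$ on the strip $|\mathrm{Im}\,z|<\delta/2$ which have logarithms analytic in $z$ with matched linear asymptotics there, and which satisfy, with absolutely convergent integrals, $$i\partial_z\log F(z,t)=\frac1{2\delta i}\int_{\mathbb R}\tanh\Big(\frac{\pi(x'-z)}\delta\Big)\big(u_+(x',t)+v_+(x',t)\big)\,dx',$$ $$i\partial_z\log G(z,t)=\frac1{2\delta i}\int_{\mathbb R}\tanh\Big(\frac{\pi(x'-z)}\delta\Big)\big(u_-(x',t)+v_-(x',t)\big)\,dx'.$$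 They are unique up to $(F,G)\mapsto(a(t)F,\,b\,a(t)G)$ with $a(t)\ne0$ and a constant $b\neq0$. Every such pair extends continuously in $z$ to $|\mathrm{Im}\,z|\le\delta/2$; the extended pair is admissible, satisfies the bilinear system (2), and recovers $u,v$ through (4). -/

import Mathlib

noncomputable section

namespace NonchiralILW

/-! ### The integral operators and the non-chiral ILW equation -/

/-- The hyperbolic cotangent. -/
def coth (x : ℝ) : ℝ := Real.cosh x / Real.sinh x

/-- The truncated integral `(1/2δ) ∫_{|x'-x|>ε} coth(π(x'-x)/(2δ)) f(x') dx'`. -/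
def truncT (δ : ℝ) (f : ℝ → ℂ) (x ε : ℝ) : ℂ :=
  1 / (2 * (δ : ℂ)) *
    ∫ x' in {x' : ℝ | ε < |x' - x|}, (coth (Real.pi / (2 * δ) * (x' - x)) : ℂ) * f x'

/-- `(Tf)(x)`, a principal value integral: the limit of the truncated integrals as `ε ↓ 0`. -/
def opT (δ : ℝ) (f : ℝ → ℂ) (x : ℝ) : ℂ :=
  Filter.limUnder (nhdsWithin (0 : ℝ) (Set.Ioi 0)) (truncT δ f x)

/-- The transform `Tf` exists: at every point the truncated integrals converge absolutely and
have a limit as `ε ↓ 0`. -/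
def TExists (δ : ℝ) (f : ℝ → ℂ) : Prop :=
  ∀ x : ℝ,
    (∀ ε : ℝ, 0 < ε → MeasureTheory.IntegrableOn
      (fun x' : ℝ => (coth (Real.pi / (2 * δ) * (x' - x)) : ℂ) * f x')
      {x' : ℝ | ε < |x' - x|}) ∧
    ∃ a : ℂ, Filter.Tendsto (truncT δ f x) (nhdsWithin (0 : ℝ) (Set.Ioi 0)) (nhds a)

/-- `(T̃f)(x) = (1/2δ) ∫ tanh(π(x'-x)/(2δ)) f(x') dx'`. -/
def opTt (δ : ℝ) (f : ℝ → ℂ) (x : ℝ) : ℂ :=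
  1 / (2 * (δ : ℂ)) * ∫ x' : ℝ, (Real.tanh (Real.pi / (2 * δ) * (x' - x)) : ℂ) * f x'

/-- The transform `T̃f` exists. -/
def TtExists (δ : ℝ) (f : ℝ → ℂ) : Prop :=
  ∀ x : ℝ, MeasureTheory.Integrable
    (fun x' : ℝ => (Real.tanh (Real.pi / (2 * δ) * (x' - x)) : ℂ) * f x')

/-- `∂_x u` at `(x, t)`. -/
def dx (u : ℝ → ℝ → ℂ) (x t : ℝ) : ℂ := deriv (fun y : ℝ => u y t) x

/-- `∂_t u` at `(x, t)`. -/
def dt (u : ℝ → ℝ → ℂ) (x t : ℝ) : ℂ := deriv (fun s : ℝ => u x s) t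

/-- `∂_x² u` at time `t`, as a function of `x`. -/
def dxx (u : ℝ → ℝ → ℂ) (t x : ℝ) : ℂ := iteratedDeriv 2 (fun y : ℝ => u y t) x

/-- `(u, v)` is a (classical) solution of the non-chiral ILW equation
`u_t + 2 u u_x + T u_xx + T̃ v_xx = 0`, `v_t - 2 v v_x - T v_xx - T̃ u_xx = 0`;
all derivatives and all transforms in it are required to exist. -/
structure IsSolution (δ : ℝ) (u v : ℝ → ℝ → ℂ) : Prop where
  contDiff_u : ∀ t : ℝ, ContDiff ℝ 2 (fun x : ℝ => u x t)
  contDiff_v : ∀ t : ℝ, ContDiff ℝ 2 (fun x : ℝ => v x t)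
  diff_u : ∀ x : ℝ, Differentiable ℝ (fun t : ℝ => u x t)
  diff_v : ∀ x : ℝ, Differentiable ℝ (fun t : ℝ => v x t)
  T_u : ∀ t : ℝ, TExists δ (dxx u t)
  T_v : ∀ t : ℝ, TExists δ (dxx v t)
  Tt_u : ∀ t : ℝ, TtExists δ (dxx u t)
  Tt_v : ∀ t : ℝ, TtExists δ (dxx v t)
  eq_u : ∀ x t : ℝ,
    dt u x t + 2 * u x t * dx u x t + opT δ (dxx u t) x + opTt δ (dxx v t) x = 0
  eq_v : ∀ x t : ℝ,
    dt v x t - 2 * v x t * dx v x t - opT δ (dxx v t) x - opTt δ (dxx u t) x = 0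

/-! ### Hirota derivatives and the bilinear system -/

/-- The operator `∂_x - ∂_{x'}` on functions of `(x, x', t, t')`. -/
def antiDx (H : ℝ → ℝ → ℝ → ℝ → ℂ) : ℝ → ℝ → ℝ → ℝ → ℂ := fun x x' t t' =>
  deriv (fun y : ℝ => H y x' t t') x - deriv (fun y : ℝ => H x y t t') x'

/-- The operator `∂_t - ∂_{t'}` on functions of `(x, x', t, t')`. -/
def antiDt (H : ℝ → ℝ → ℝ → ℝ → ℂ) : ℝ → ℝ → ℝ → ℝ → ℂ := fun x x' t t' =>
  deriv (fun s : ℝ => H x x' s t') t - deriv (fun s : ℝ => H x x' t s) t'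

/-- The Hirota derivative `D_t^m D_x^n f·g` at `(x, t)`. -/
def hirotaD (m n : ℕ) (f g : ℝ → ℝ → ℂ) (x t : ℝ) : ℂ :=
  (antiDt^[m] (antiDx^[n] fun x x' t t' => f x t * g x' t')) x x t t

/-- `F^+(x,t) = F(x + iδ/2, t)`. -/
def shiftP (δ : ℝ) (F : ℂ → ℝ → ℂ) (x t : ℝ) : ℂ := F ((x : ℂ) + Complex.I * δ / 2) t

/-- `F^-(x,t) = F(x - iδ/2, t)`. -/
def shiftM (δ : ℝ) (F : ℂ → ℝ → ℂ) (x t : ℝ) : ℂ := F ((x : ℂ) - Complex.I * δ / 2) t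

/-- The bilinear system `(i D_t - D_x²) F^-·G^+ = 0`, `(i D_t - D_x²) F^+·G^- = 0`. -/
def Bilinear (δ : ℝ) (F G : ℂ → ℝ → ℂ) : Prop :=
  (∀ x t : ℝ, Complex.I * hirotaD 1 0 (shiftM δ F) (shiftP δ G) x t
      - hirotaD 0 2 (shiftM δ F) (shiftP δ G) x t = 0) ∧
  (∀ x t : ℝ, Complex.I * hirotaD 1 0 (shiftP δ F) (shiftM δ G) x t
      - hirotaD 0 2 (shiftP δ F) (shiftM δ G) x t = 0)

/-- `u = i ∂_x log (F^- / G^+)`. -/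
def uOf (δ : ℝ) (F G : ℂ → ℝ → ℂ) (x t : ℝ) : ℂ :=
  Complex.I * logDeriv (fun y : ℝ => shiftM δ F y t / shiftP δ G y t) x

/-- `v = i ∂_x log (G^- / F^+)`. -/
def vOf (δ : ℝ) (F G : ℂ → ℝ → ℂ) (x t : ℝ) : ℂ :=
  Complex.I * logDeriv (fun y : ℝ => shiftM δ G y t / shiftP δ F y t) x

/-! ### Logarithms with linear asymptotics -/

/-- The strip `|Im z| < δ/2`. -/
def strip (δ : ℝ) : Set ℂ := {z : ℂ | |z.im| < δ / 2}

/-- The closed strip `|Im z| ≤ δ/2`. -/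
def closedStrip (δ : ℝ) : Set ℂ := {z : ℂ | |z.im| ≤ δ / 2}

/-- `‖a z‖ = O(|x|^{-n})` at the right end `x = Re z → +∞` of `S`, uniformly in `Im z`. -/
def BigORight (S : Set ℂ) (n : ℕ) (a : ℂ → ℂ) : Prop :=
  ∃ C R : ℝ, 0 < R ∧ ∀ z ∈ S, R ≤ z.re → ‖a z‖ ≤ C / |z.re| ^ n

/-- `‖a z‖ = O(|x|^{-n})` at the left end `x = Re z → -∞` of `S`, uniformly in `Im z`. -/
def BigOLeft (S : Set ℂ) (n : ℕ) (a : ℂ → ℂ) : Prop :=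
  ∃ C R : ℝ, 0 < R ∧ ∀ z ∈ S, z.re ≤ -R → ‖a z‖ ≤ C / |z.re| ^ n

/-- `L(z,t) = f_±(t) ± f₁ z + O(1/x)` as `x = Re z → ±∞` in `S`, with `f_+ = fp` and `f_- = fm`
differentiable functions of `t`. -/
structure LinearAsymptotics (S : Set ℂ) (L : ℂ → ℝ → ℂ) (f₁ : ℂ) (fp fm : ℝ → ℂ) : Prop where
  diff_fp : Differentiable ℝ fp
  diff_fm : Differentiable ℝ fm
  right : ∀ t : ℝ, BigORight S 1 (fun z => L z t - (fp t + f₁ * z))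
  left : ∀ t : ℝ, BigOLeft S 1 (fun z => L z t - (fm t - f₁ * z))

/-- `L` is a logarithm of `F` on the open strip, analytic in `z`, with linear asymptotics. -/
structure IsLog (δ : ℝ) (F L : ℂ → ℝ → ℂ) (f₁ : ℂ) (fp fm : ℝ → ℂ) : Prop where
  exp_eq : ∀ z ∈ strip δ, ∀ t : ℝ, F z t = Complex.exp (L z t)
  analytic : ∀ t : ℝ, DifferentiableOn ℂ (fun z => L z t) (strip δ)
  asymp : LinearAsymptotics (strip δ) L f₁ fp fm

/-- `L` is a logarithm of `F` on the closed strip, analytic in the open strip and continuous on the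
closed strip, with linear asymptotics, and sufficiently regular: its `z`-derivatives `D 1, D 2, D 3`
extend continuously to the closed strip, the `t`-derivatives `Lt` of `L` and `D1t` of `D 1` exist,
`D1t` is continuous, and the asymptotics may be differentiated up to three times in `z`, or once
in `t`. -/
structure IsRegularLog (δ : ℝ) (F L : ℂ → ℝ → ℂ) (f₁ : ℂ) (fp fm : ℝ → ℂ) : Prop where
  exp_eq : ∀ z ∈ closedStrip δ, ∀ t : ℝ, F z t = Complex.exp (L z t)
  asymp : LinearAsymptotics (closedStrip δ) L f₁ fp fm
  regular : ∃ (D : ℕ → ℂ → ℝ → ℂ) (Lt D1t : ℂ → ℝ → ℂ),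
    D 0 = L ∧
    (∀ k < 3, ∀ t : ℝ, ∀ z ∈ strip δ, HasDerivAt (fun w => D k w t) (D (k + 1) z t) z) ∧
    (∀ k ≤ 3, ∀ t : ℝ, ContinuousOn (fun z => D k z t) (closedStrip δ)) ∧
    (∀ z ∈ closedStrip δ, ∀ t : ℝ, HasDerivAt (fun s => L z s) (Lt z t) t) ∧
    (∀ z ∈ closedStrip δ, ∀ t : ℝ, HasDerivAt (fun s => D 1 z s) (D1t z t) t) ∧
    ContinuousOn (Function.uncurry D1t) (closedStrip δ ×ˢ Set.univ) ∧
    (∀ t : ℝ,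
      BigORight (closedStrip δ) 2 (fun z => D 1 z t - f₁) ∧
      BigOLeft (closedStrip δ) 2 (fun z => D 1 z t + f₁) ∧
      BigORight (closedStrip δ) 2 (fun z => D 2 z t) ∧
      BigOLeft (closedStrip δ) 2 (fun z => D 2 z t) ∧
      BigORight (closedStrip δ) 2 (fun z => D 3 z t) ∧
      BigOLeft (closedStrip δ) 2 (fun z => D 3 z t) ∧
      BigORight (closedStrip δ) 1 (fun z => Lt z t - deriv fp t) ∧
      BigOLeft (closedStrip δ) 1 (fun z => Lt z t - deriv fm t))

/-- `F` and `G` have regular logarithms on the closed strip with linear asymptotics with the same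
`f₁`, and such that `f_+ - g_+` does not depend on `t`. -/
def Admissible (δ : ℝ) (F G : ℂ → ℝ → ℂ) : Prop :=
  ∃ (LF LG : ℂ → ℝ → ℂ) (f₁ c : ℂ) (fp fm gp gm : ℝ → ℂ),
    IsRegularLog δ F LF f₁ fp fm ∧ IsRegularLog δ G LG f₁ gp gm ∧ ∀ t : ℝ, fp t - gp t = c

/-! ### From solutions to Hirota variables -/

/-- `u_+ = u/2 - (i/2)(Tu + T̃v)`. -/
def uPlus (δ : ℝ) (u v : ℝ → ℝ → ℂ) (x t : ℝ) : ℂ :=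
  1 / 2 * u x t - Complex.I / 2 * (opT δ (fun y => u y t) x + opTt δ (fun y => v y t) x)

/-- `u_- = u/2 + (i/2)(Tu + T̃v)`. -/
def uMinus (δ : ℝ) (u v : ℝ → ℝ → ℂ) (x t : ℝ) : ℂ :=
  1 / 2 * u x t + Complex.I / 2 * (opT δ (fun y => u y t) x + opTt δ (fun y => v y t) x)

/-- `v_+ = v/2 + (i/2)(Tv + T̃u)`. -/
def vPlus (δ : ℝ) (u v : ℝ → ℝ → ℂ) (x t : ℝ) : ℂ :=
  1 / 2 * v x t + Complex.I / 2 * (opT δ (fun y => v y t) x + opTt δ (fun y => u y t) x)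

/-- `v_- = v/2 - (i/2)(Tv + T̃u)`. -/
def vMinus (δ : ℝ) (u v : ℝ → ℝ → ℂ) (x t : ℝ) : ℂ :=
  1 / 2 * v x t - Complex.I / 2 * (opT δ (fun y => v y t) x + opTt δ (fun y => u y t) x)

/-- `i ∂_z log F(z,t) = (1/(2δi)) ∫ tanh(π(x'-z)/δ) J(x',t) dx'` for `z` in the open strip, the
integral being absolutely convergent. -/
def TanhFormula (δ : ℝ) (F : ℂ → ℝ → ℂ) (J : ℝ → ℝ → ℂ) : Prop :=
  ∀ z ∈ strip δ, ∀ t : ℝ,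
    MeasureTheory.Integrable
      (fun x' : ℝ => Complex.tanh ((Real.pi : ℂ) * ((x' : ℂ) - z) / (δ : ℂ)) * J x' t) ∧
    Complex.I * logDeriv (fun w => F w t) z =
      1 / (2 * (δ : ℂ) * Complex.I) *
        ∫ x' : ℝ, Complex.tanh ((Real.pi : ℂ) * ((x' : ℂ) - z) / (δ : ℂ)) * J x' t

/-- `F` and `G` are given, on the open strip, by the explicit formulas in terms of `u` and `v`,
together with the normalization through the linear asymptotics. -/
structure IsPotentialPair (δ : ℝ) (u v : ℝ → ℝ → ℂ) (F G : ℂ → ℝ → ℂ) : Prop where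
  formula_F : TanhFormula δ F (fun x t => uPlus δ u v x t + vPlus δ u v x t)
  formula_G : TanhFormula δ G (fun x t => uMinus δ u v x t + vMinus δ u v x t)
  logs : ∃ (LF LG : ℂ → ℝ → ℂ) (f₁ c : ℂ) (fp fm gp gm : ℝ → ℂ),
    IsLog δ F LF f₁ fp fm ∧ IsLog δ G LG f₁ gp gm ∧ ∀ t : ℝ, fp t - gp t = c

/-- The regularity and decay required of a solution: `u` is of class `C⁴`, and `∂_x^k u`
(`k ≤ 4`) and `∂_t ∂_x^k u` (`k ≤ 3`) are `O((1 + |x|)^{-3})`, locally uniformly in `t`. -/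
structure RegularDecaying (u : ℝ → ℝ → ℂ) : Prop where
  contDiff : ContDiff ℝ 4 (Function.uncurry u)
  decay_x : ∀ T : ℝ, ∃ C : ℝ, ∀ k ≤ 4, ∀ x t : ℝ, |t| ≤ T →
    ‖iteratedDeriv k (fun y : ℝ => u y t) x‖ ≤ C / (1 + |x|) ^ 3
  decay_t : ∀ T : ℝ, ∃ C : ℝ, ∀ k ≤ 3, ∀ x t : ℝ, |t| ≤ T →
    ‖deriv (fun s : ℝ => iteratedDeriv k (fun y : ℝ => u y s) x) t‖ ≤ C / (1 + |x|) ^ 3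

end NonchiralILW

end

noncomputable section

namespace NonchiralILW

open Filter Topology MeasureTheory Set
open scoped Real

/-! ### The hyperbolic cotangent in the complex plane -/

/-- The complex hyperbolic cotangent. -/
def ccoth (w : ℂ) : ℂ := Complex.cosh w / Complex.sinh w

lemma ofReal_coth (x : ℝ) : ((coth x : ℝ) : ℂ) = ccoth x := by
  simp [coth, ccoth]

lemma ccoth_add_I_pi_div_two (w : ℂ) : ccoth (w + π / 2 * Complex.I) = Complex.tanh w := by
  have h1 : Complex.cosh (π / 2 * Complex.I) = 0 := by
    rw [Complex.cosh_mul_I]; exact_mod_cast congrArg Complex.ofReal Real.cos_pi_div_two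
  have h2 : Complex.sinh (π / 2 * Complex.I) = Complex.I := by
    rw [Complex.sinh_mul_I, Complex.sin_pi_div_two, one_mul]
  rw [ccoth, Complex.cosh_add, Complex.sinh_add, h1, h2, Complex.tanh_eq_sinh_div_cosh]
  rw [mul_zero, mul_zero, zero_add, zero_add, mul_div_mul_right _ _ Complex.I_ne_zero]

lemma sinh_re_im (w : ℂ) : Complex.sinh w =
    (Real.sinh w.re * Real.cos w.im : ℝ) + (Real.cosh w.re * Real.sin w.im : ℝ) * Complex.I := by
  conv_lhs => rw [← Complex.re_add_im w]
  rw [Complex.sinh_add, Complex.cosh_mul_I, Complex.sinh_mul_I]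
  push_cast; ring

lemma cosh_re_im (w : ℂ) : Complex.cosh w =
    (Real.cosh w.re * Real.cos w.im : ℝ) + (Real.sinh w.re * Real.sin w.im : ℝ) * Complex.I := by
  conv_lhs => rw [← Complex.re_add_im w]
  rw [Complex.cosh_add, Complex.cosh_mul_I, Complex.sinh_mul_I]
  push_cast; ring

lemma sinh_ne_zero_of_im {w : ℂ} (hw : w ≠ 0) (h0 : -π < w.im) (h1 : w.im < π) :
    Complex.sinh w ≠ 0 := by
  intro h
  rw [sinh_re_im] at h
  have hr := congrArg Complex.re h
  have hi := congrArg Complex.im h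
  rw [Complex.add_re, Complex.ofReal_re, Complex.re_ofReal_mul, Complex.I_re, mul_zero, add_zero,
    Complex.zero_re] at hr
  rw [Complex.add_im, Complex.ofReal_im, Complex.im_ofReal_mul, Complex.I_im, mul_one, zero_add,
    Complex.zero_im, mul_eq_zero] at hi
  have hs : w.im = 0 := by
    rcases hi with hi | hi
    · exact absurd hi (Real.cosh_pos _).ne'
    · exact (Real.sin_eq_zero_iff_of_lt_of_lt h0 h1).1 hi
  apply hw
  apply Complex.ext
  · simpa [hs] using hr
  · simpa using hs

lemma norm_cosh_le (w : ℂ) : ‖Complex.cosh w‖ ≤ Real.cosh w.re := by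
  rw [Complex.cosh, Real.cosh_eq, norm_div]
  have := norm_add_le (Complex.exp w) (Complex.exp (-w))
  rw [Complex.norm_exp, Complex.norm_exp, Complex.neg_re] at this
  simp only [Complex.norm_ofNat]
  linarith

lemma abs_sinh_re_le_norm (w : ℂ) : |Real.sinh w.re| ≤ ‖Complex.sinh w‖ := by
  rw [Complex.sinh, Real.sinh_eq, norm_div, abs_div]
  have := abs_norm_sub_norm_le (Complex.exp w) (Complex.exp (-w))
  rw [Complex.norm_exp, Complex.norm_exp, Complex.neg_re] at this
  simp only [Complex.norm_ofNat, abs_two]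
  linarith

lemma cosh_le_abs_sinh_add_one (x : ℝ) : Real.cosh x ≤ |Real.sinh x| + 1 := by
  have h := Real.cosh_sq x
  have h1 := Real.cosh_pos x
  have h2 := abs_nonneg (Real.sinh x)
  have h3 := sq_abs (Real.sinh x)
  nlinarith

lemma abs_le_abs_sinh (x : ℝ) : |x| ≤ |Real.sinh x| := by
  rw [Real.abs_sinh]
  exact Real.self_le_sinh_iff.2 (abs_nonneg x)

lemma norm_ccoth_le {w : ℂ} (hw : w.re ≠ 0) : ‖ccoth w‖ ≤ 1 + 1 / |w.re| := by
  have h0 : 0 < |w.re| := abs_pos.2 hw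
  have h1 := abs_le_abs_sinh w.re
  have h2 := abs_sinh_re_le_norm w
  have h3 := norm_cosh_le w
  have h4 := cosh_le_abs_sinh_add_one w.re
  rw [ccoth, norm_div, div_le_iff₀ (by linarith)]
  have h5 : 1 ≤ 1 / |w.re| * ‖Complex.sinh w‖ := by
    rw [one_div, ← div_eq_inv_mul, le_div_iff₀ h0]; linarith
  linarith

lemma continuousAt_ccoth {w : ℂ} (h : Complex.sinh w ≠ 0) : ContinuousAt ccoth w := by
  unfold ccoth
  exact (Complex.continuous_cosh.continuousAt).div (Complex.continuous_sinh.continuousAt) h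

lemma differentiableAt_ccoth {w : ℂ} (h : Complex.sinh w ≠ 0) : DifferentiableAt ℂ ccoth w := by
  unfold ccoth
  exact (Complex.differentiable_cosh _).div (Complex.differentiable_sinh _) h

lemma tendsto_mul_ccoth (c : ℂ) (hc : c ≠ 0) :
    Tendsto (fun z : ℂ => z * ccoth (c * z)) (𝓝[≠] 0) (𝓝 (1 / c)) := by
  have h1 : HasDerivAt (fun z : ℂ => Complex.sinh (c * z)) c 0 := by
    have := ((hasDerivAt_id (0 : ℂ)).const_mul c).csinh
    simpa using this
  have h2 := h1.tendsto_slope_zero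
  have h3 : Tendsto (fun z : ℂ => Complex.cosh (c * z)) (𝓝[≠] 0) (𝓝 1) := by
    have : ContinuousAt (fun z : ℂ => Complex.cosh (c * z)) 0 := by fun_prop
    have := this.tendsto.mono_left (nhdsWithin_le_nhds (s := {0}ᶜ))
    simpa using this
  have h4 := h3.div h2 hc
  refine h4.congr fun z => ?_
  simp only [ccoth, zero_add, mul_zero, Complex.sinh_zero, sub_zero, smul_eq_mul, Pi.div_apply]
  by_cases hz : z = 0
  · simp [hz]
  · by_cases hs : Complex.sinh (c * z) = 0
    · simp [hs]
    · field_simp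

/-! ### Cauchy's theorem on a strip -/

/-- The box path around the origin, from `-1` to `1` through the upper half plane. -/
lemma box_integral : (∫ s : ℝ in (-1 : ℝ)..1, 1 / ((s : ℂ) + Complex.I)) +
    Complex.I * (∫ s : ℝ in (0 : ℝ)..1, 1 / (-1 + s * Complex.I)) -
    Complex.I * (∫ s : ℝ in (0 : ℝ)..1, 1 / (1 + s * Complex.I)) = -(π * Complex.I) := by
  have hn (s : ℝ) : (1 + (s : ℂ) ^ 2) ≠ 0 := by
    have : (1 + s ^ 2 : ℝ) ≠ 0 := by positivity
    exact_mod_cast this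
  have e1 (s : ℝ) : 1 / ((s : ℂ) + Complex.I) =
      ((s * (1 + s ^ 2)⁻¹ : ℝ) : ℂ) + (((1 + s ^ 2)⁻¹ : ℝ) : ℂ) * (-Complex.I) := by
    have : (s : ℂ) + Complex.I ≠ 0 := by
      intro h; have := congrArg Complex.im h; simp at this
    push_cast
    field_simp [hn s]
    ring_nf; rw [Complex.I_sq]; ring
  have e2 (s : ℝ) : 1 / (-1 + s * Complex.I) =
      ((s * (1 + s ^ 2)⁻¹ : ℝ) : ℂ) * (-Complex.I) - (((1 + s ^ 2)⁻¹ : ℝ) : ℂ) := by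
    have : -1 + s * Complex.I ≠ 0 := by
      intro h; have := congrArg Complex.re h; simp at this
    push_cast
    field_simp [hn s]
    ring_nf; rw [Complex.I_sq]; ring
  have e3 (s : ℝ) : 1 / (1 + s * Complex.I) =
      (((1 + s ^ 2)⁻¹ : ℝ) : ℂ) + ((s * (1 + s ^ 2)⁻¹ : ℝ) : ℂ) * (-Complex.I) := by
    have : 1 + s * Complex.I ≠ 0 := by
      intro h; have := congrArg Complex.re h; simp at this
    push_cast
    field_simp [hn s]
    ring_nf; rw [Complex.I_sq]; ring
  have hc1 : Continuous fun s : ℝ => (1 + s ^ 2)⁻¹ :=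
    Continuous.inv₀ (by fun_prop) fun s => by positivity
  have hc2 : Continuous fun s : ℝ => s * (1 + s ^ 2)⁻¹ := continuous_id.mul hc1
  have hi1 (a b : ℝ) : IntervalIntegrable (fun s : ℝ => (((1 + s ^ 2)⁻¹ : ℝ) : ℂ)) volume a b :=
    (Complex.continuous_ofReal.comp hc1).intervalIntegrable _ _
  have hi2 (a b : ℝ) :
      IntervalIntegrable (fun s : ℝ => ((s * (1 + s ^ 2)⁻¹ : ℝ) : ℂ)) volume a b :=
    (Complex.continuous_ofReal.comp hc2).intervalIntegrable _ _
  have hodd : ∫ s : ℝ in (-1 : ℝ)..1, ((s * (1 + s ^ 2)⁻¹ : ℝ) : ℂ) = 0 := by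
    have h := intervalIntegral.integral_comp_neg (a := -1) (b := 1)
      (fun s : ℝ => ((s * (1 + s ^ 2)⁻¹ : ℝ) : ℂ))
    have h' : ∫ s : ℝ in (-1 : ℝ)..1, ((-s * (1 + (-s) ^ 2)⁻¹ : ℝ) : ℂ) =
        - ∫ s : ℝ in (-1 : ℝ)..1, ((s * (1 + s ^ 2)⁻¹ : ℝ) : ℂ) := by
      rw [← intervalIntegral.integral_neg]; congr 1; ext s; push_cast; ring
    rw [h'] at h
    simp only [neg_neg] at h
    linear_combination (-1 / 2 : ℂ) * h
  have ha1 : ∫ s : ℝ in (-1 : ℝ)..1, (((1 + s ^ 2)⁻¹ : ℝ) : ℂ) = (π / 2 : ℝ) := by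
    rw [intervalIntegral.integral_ofReal, integral_inv_one_add_sq, Real.arctan_neg,
      Real.arctan_one]; congr 1; ring
  have ha2 : ∫ s : ℝ in (0 : ℝ)..1, (((1 + s ^ 2)⁻¹ : ℝ) : ℂ) = (π / 4 : ℝ) := by
    rw [intervalIntegral.integral_ofReal, integral_inv_one_add_sq, Real.arctan_zero,
      Real.arctan_one]; congr 1; ring
  simp_rw [e1, e2, e3]
  rw [intervalIntegral.integral_add (hi2 _ _) ((hi1 _ _).mul_const _),
    intervalIntegral.integral_sub ((hi2 _ _).mul_const _) (hi1 _ _),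
    intervalIntegral.integral_add (hi1 _ _) ((hi2 _ _).mul_const _),
    intervalIntegral.integral_mul_const, intervalIntegral.integral_mul_const,
    hodd, ha1, ha2]
  push_cast; ring

lemma tendsto_box_side {ψ : ℂ → ℂ} {ψ₀ : ℂ} {S : Set ℂ} (hψ : Tendsto ψ (𝓝[S] 0) (𝓝 ψ₀))
    {γ : ℝ → ℂ} (hγ : Continuous γ) {a b : ℝ} (hn : ∀ s, 1 ≤ ‖γ s‖)
    (hS : ∀ᶠ ε : ℝ in 𝓝[>] 0, ∀ s ∈ uIcc a b, (ε : ℂ) * γ s ∈ S)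
    (hc : ∀ᶠ ε : ℝ in 𝓝[>] 0, ContinuousOn (fun s : ℝ => ψ (ε * γ s)) (uIcc a b)) :
    Tendsto (fun ε : ℝ => ∫ s in a..b, ψ (ε * γ s) / γ s) (𝓝[>] 0)
      (𝓝 (ψ₀ * ∫ s in a..b, 1 / γ s)) := by
  have hne : ∀ s, γ s ≠ 0 := fun s h => by have := hn s; rw [h, norm_zero] at this; linarith
  have hci : ContinuousOn (fun s => (γ s)⁻¹) (uIcc a b) := (hγ.inv₀ hne).continuousOn
  rw [← intervalIntegral.integral_const_mul]
  obtain ⟨δ, hδ, hball⟩ : ∃ δ > 0, ∀ z ∈ S, ‖z‖ < δ → ‖ψ z‖ < ‖ψ₀‖ + 1 := by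
    have := hψ.norm.eventually (gt_mem_nhds (lt_add_one ‖ψ₀‖))
    rw [eventually_nhdsWithin_iff, Metric.eventually_nhds_iff] at this
    obtain ⟨δ, hδ, h⟩ := this
    exact ⟨δ, hδ, fun z hz h' => h (by simpa using h') hz⟩
  obtain ⟨B, hB⟩ := (isCompact_uIcc (a := a) (b := b)).exists_bound_of_continuousOn hγ.continuousOn
  have hB0 : 0 < B := by
    have := hB a left_mem_uIcc; have := hn a; linarith
  refine intervalIntegral.tendsto_integral_filter_of_dominated_convergence
    (fun _ => ‖ψ₀‖ + 1) ?_ ?_ (by simp) ?_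
  · filter_upwards [hc] with ε hε
    have : ContinuousOn (fun s => ψ (ε * γ s) / γ s) (uIcc a b) := by
      simp only [div_eq_mul_inv]
      exact hε.mul hci
    exact (this.mono uIoc_subset_uIcc).aestronglyMeasurable measurableSet_uIoc
  · have h1 : ∀ᶠ ε : ℝ in 𝓝[>] 0, ε < δ / B :=
      (gt_mem_nhds (div_pos hδ hB0) : ∀ᶠ ε : ℝ in 𝓝 0, ε < δ / B).filter_mono nhdsWithin_le_nhds
    filter_upwards [hS, h1, self_mem_nhdsWithin] with ε hε h1 h2
    refine ae_of_all _ fun s hs => ?_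
    have hs := uIoc_subset_uIcc hs
    have hlt : ‖(ε : ℂ) * γ s‖ < δ := by
      rw [norm_mul, Complex.norm_real, Real.norm_of_nonneg (le_of_lt h2)]
      calc ε * ‖γ s‖ ≤ ε * B := by gcongr; exacts [le_of_lt h2, hB s hs]
        _ < δ := by rwa [lt_div_iff₀ hB0] at h1
    rw [norm_div]
    exact (div_le_self (norm_nonneg _) (hn s)).trans (hball _ (hε s hs) hlt).le
  · refine ae_of_all _ fun s hs => ?_
    have hs := uIoc_subset_uIcc hs
    rw [mul_one_div]
    refine Tendsto.div_const (hψ.comp ?_) _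
    refine tendsto_nhdsWithin_iff.2 ⟨?_, ?_⟩
    · have : Continuous fun ε : ℝ => (ε : ℂ) * γ s := by fun_prop
      have := (this.tendsto 0).mono_left (nhdsWithin_le_nhds (s := Ioi 0))
      simpa using this
    · filter_upwards [hS] with ε hε using hε s hs

lemma isOpen_strip (δ : ℝ) : IsOpen (strip δ) :=
  isOpen_lt (by fun_prop) continuous_const

lemma strip_subset_closedStrip (δ : ℝ) : strip δ ⊆ closedStrip δ := fun _ hz => by
  simp only [strip, closedStrip, mem_ofPred_eq] at hz ⊢
  exact hz.le

lemma lower_mem_closedStrip {δ : ℝ} (hδ : 0 < δ) (x : ℝ) :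
    (x : ℂ) - Complex.I * δ / 2 ∈ closedStrip δ := by
  have : ((x : ℂ) - Complex.I * δ / 2).im = -(δ / 2) := by simp
  simp only [closedStrip, mem_ofPred_eq, this, abs_neg, abs_of_pos (half_pos hδ), le_refl]

lemma upper_mem_closedStrip {δ : ℝ} (hδ : 0 < δ) (x : ℝ) :
    (x : ℂ) + Complex.I * δ / 2 ∈ closedStrip δ := by
  have : ((x : ℂ) + Complex.I * δ / 2).im = δ / 2 := by simp
  simp only [closedStrip, mem_ofPred_eq, this, abs_of_pos (half_pos hδ), le_refl]

/-- A continuous function on the closed strip that is `O(x⁻²)` at both ends is globally bounded by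
`C / (1 + x²)`. -/
lemma exists_bound_of_bigO {δ : ℝ} {h : ℂ → ℂ} (hc : ContinuousOn h (closedStrip δ))
    (hr : BigORight (closedStrip δ) 2 h) (hl : BigOLeft (closedStrip δ) 2 h) :
    ∃ C : ℝ, 0 ≤ C ∧ ∀ z ∈ closedStrip δ, ‖h z‖ ≤ C / (1 + z.re ^ 2) := by
  obtain ⟨C₁, R₁, hR₁, h₁⟩ := hr
  obtain ⟨C₂, R₂, hR₂, h₂⟩ := hl
  set R := max R₁ R₂
  have hR : 0 < R := lt_max_of_lt_left hR₁
  have hK : IsCompact (Icc (-R) R ×ℂ Icc (-(δ / 2)) (δ / 2)) := isCompact_Icc.reProdIm isCompact_Icc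
  obtain ⟨B, hB⟩ := hK.exists_bound_of_continuousOn (f := h) (hc.mono fun z hz => by
    rw [Complex.mem_reProdIm] at hz
    exact abs_le.2 hz.2)
  have key (C : ℝ) (z : ℂ) (hC : ‖h z‖ ≤ C / |z.re| ^ 2) (hz : R ≤ |z.re|) :
      ‖h z‖ ≤ |C| * (1 + 1 / R ^ 2) / (1 + z.re ^ 2) := by
    have hz0 : 0 < |z.re| := hR.trans_le hz
    refine (hC.trans (div_le_div_of_nonneg_right (le_abs_self C) (by positivity))).trans ?_
    rw [sq_abs, div_le_div_iff₀ (by rw [← sq_abs]; positivity) (by positivity), mul_assoc]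
    refine mul_le_mul_of_nonneg_left ?_ (abs_nonneg _)
    have : 1 ≤ 1 / R ^ 2 * z.re ^ 2 := by
      rw [one_div, ← div_eq_inv_mul, le_div_iff₀ (by positivity), one_mul, ← sq_abs z.re]
      gcongr
    linarith
  refine ⟨|B| * (1 + R ^ 2) + |C₁| * (1 + 1 / R ^ 2) + |C₂| * (1 + 1 / R ^ 2), by positivity,
    fun z hz => ?_⟩
  have m1 : 0 ≤ |B| * (1 + R ^ 2) := by positivity
  have m2 : 0 ≤ |C₁| * (1 + 1 / R ^ 2) := by positivity
  have m3 : 0 ≤ |C₂| * (1 + 1 / R ^ 2) := by positivity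
  rcases le_total R |z.re| with hRz | hRz
  · rcases le_total 0 z.re with h0 | h0
    · have := key C₁ z (h₁ z hz (by rw [abs_of_nonneg h0] at hRz; exact (le_max_left _ _).trans hRz))
        hRz
      refine this.trans ?_
      gcongr; linarith
    · have := key C₂ z (h₂ z hz (by
        rw [abs_of_nonpos h0] at hRz; have := (le_max_right R₁ R₂).trans hRz; linarith)) hRz
      refine this.trans ?_
      gcongr; linarith
  · have h3 := hB z (by
      rw [Complex.mem_reProdIm]
      exact ⟨abs_le.1 hRz, abs_le.1 hz⟩)
    rw [le_div_iff₀ (by positivity)]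
    have h4 : z.re ^ 2 ≤ R ^ 2 := by rw [← sq_abs]; gcongr
    have h5 : ‖h z‖ ≤ |B| := h3.trans (le_abs_self _)
    have : ‖h z‖ * (1 + z.re ^ 2) ≤ |B| * (1 + R ^ 2) := by gcongr
    linarith

lemma integrable_of_bound {g : ℝ → ℂ} (hg : Continuous g) {C : ℝ}
    (h : ∀ x, ‖g x‖ ≤ C / (1 + x ^ 2)) : Integrable g := by
  refine (integrable_inv_one_add_sq.const_mul C).mono' hg.aestronglyMeasurable (ae_of_all _ ?_)
  simpa [div_eq_mul_inv] using h

lemma sinh_mul_ne_zero {δ : ℝ} (hδ : 0 < δ) {z : ℂ} (hz : z ≠ 0) (h0 : 0 ≤ z.im) (h1 : z.im ≤ δ) :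
    Complex.sinh ((π / (2 * δ) : ℝ) * z) ≠ 0 := by
  have hc : 0 < π / (2 * δ) := by positivity
  apply sinh_ne_zero_of_im
  · exact mul_ne_zero (by exact_mod_cast hc.ne') hz
  · rw [Complex.im_ofReal_mul]
    have : 0 ≤ π / (2 * δ) * z.im := by positivity
    linarith [Real.pi_pos]
  · rw [Complex.im_ofReal_mul]
    have : π / (2 * δ) * z.im ≤ π / (2 * δ) * δ := by gcongr
    have h2 : π / (2 * δ) * δ = π / 2 := by field_simp
    linarith [Real.pi_pos]

/-- Cauchy's theorem for `coth(πz/2δ) H(z)` on the strip `0 ≤ Im z ≤ δ`, cut off at `Re z = ±R`,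
with the pole at the origin removed by a box of size `ε`. -/
lemma strip_contour {δ ε R : ℝ} (hε : 0 < ε) (hεδ : ε < δ) (hεR : ε < R)
    {φ : ℂ → ℂ} (hc : ContinuousOn φ ({z | 0 ≤ z.im ∧ z.im ≤ δ} \ {0}))
    (hd : DifferentiableOn ℂ φ {z | 0 < z.im ∧ z.im < δ}) :
    (∫ y : ℝ in (-R)..(-ε), φ y) + (∫ y : ℝ in ε..R, φ y)
      - (∫ y : ℝ in (-R)..R, φ (y + δ * Complex.I))
      + ((∫ y : ℝ in (-ε)..ε, φ (y + ε * Complex.I))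
        + Complex.I * (∫ y : ℝ in (0 : ℝ)..ε, φ (-ε + y * Complex.I))
        - Complex.I * (∫ y : ℝ in (0 : ℝ)..ε, φ (ε + y * Complex.I)))
      + Complex.I * (∫ y : ℝ in (0 : ℝ)..δ, φ (R + y * Complex.I))
      - Complex.I * (∫ y : ℝ in (0 : ℝ)..δ, φ (-R + y * Complex.I)) = 0 := by
  have hδ : 0 < δ := hε.trans hεδ
  have rect (a b p q : ℝ) (hab : a ≤ b) (hp : 0 ≤ p) (hpq : p ≤ q) (hq : q ≤ δ)
      (h0 : 0 < p ∨ 0 < a ∨ b < 0) :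
      (∫ x : ℝ in a..b, φ (x + p * Complex.I)) - (∫ x : ℝ in a..b, φ (x + q * Complex.I))
        + Complex.I * (∫ y : ℝ in p..q, φ (b + y * Complex.I))
        - Complex.I * (∫ y : ℝ in p..q, φ (a + y * Complex.I)) = 0 := by
    have := Complex.integral_boundary_rect_eq_zero_of_continuousOn_of_differentiableOn φ
      (⟨a, p⟩ : ℂ) (⟨b, q⟩ : ℂ) (hc.mono ?_) (hd.mono ?_)
    · simpa only [smul_eq_mul] using this
    · intro z hz
      rw [Complex.mem_reProdIm] at hz
      simp only [uIcc_of_le hab, uIcc_of_le hpq] at hz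
      refine ⟨⟨hp.trans hz.2.1, hz.2.2.trans hq⟩, ?_⟩
      rintro rfl
      simp only [Complex.zero_re, Complex.zero_im, mem_Icc] at hz
      rcases h0 with h | h | h <;> linarith [hz.1.1, hz.1.2, hz.2.1, hz.2.2]
    · intro z hz
      rw [Complex.mem_reProdIm] at hz
      simp only [min_eq_left hab, max_eq_right hab, min_eq_left hpq, max_eq_right hpq] at hz
      exact ⟨hp.trans_lt hz.2.1, hz.2.2.trans_le hq⟩
  have hL := rect (-R) (-ε) 0 δ (by linarith) le_rfl hδ.le le_rfl (by right; right; linarith)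
  have hRt := rect ε R 0 δ hεR.le le_rfl hδ.le le_rfl (by right; left; exact hε)
  have hM := rect (-ε) ε ε δ (by linarith) hε.le hεδ.le le_rfl (by left; exact hε)
  have htop (a b : ℝ) : IntervalIntegrable (fun y : ℝ => φ (y + δ * Complex.I)) volume a b := by
    apply ContinuousOn.intervalIntegrable
    refine hc.comp (by fun_prop) fun y _ => ?_
    refine ⟨by simp [hδ.le], ?_⟩
    intro h
    have := congrArg Complex.im h
    simp at this; linarith
  have hver (a p q : ℝ) (ha : a ≠ 0) (hp : 0 ≤ p) (hpq : p ≤ q) (hq : q ≤ δ) :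
      IntervalIntegrable (fun y : ℝ => φ (a + y * Complex.I)) volume p q := by
    apply ContinuousOn.intervalIntegrable
    refine hc.comp (by fun_prop) fun y hy => ?_
    rw [uIcc_of_le hpq] at hy
    refine ⟨by simpa using ⟨hp.trans hy.1, hy.2.trans hq⟩, ?_⟩
    intro h
    have := congrArg Complex.re h
    simp at this; exact ha this
  have t1 := intervalIntegral.integral_add_adjacent_intervals (htop (-R) (-ε)) (htop (-ε) ε)
  have t2 := intervalIntegral.integral_add_adjacent_intervals (htop (-R) ε) (htop ε R)
  have v1 := intervalIntegral.integral_add_adjacent_intervals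
    (hver ε 0 ε hε.ne' le_rfl hε.le hεδ.le) (hver ε ε δ hε.ne' hε.le hεδ.le le_rfl)
  have v2 := intervalIntegral.integral_add_adjacent_intervals
    (hver (-ε) 0 ε (by linarith) le_rfl hε.le hεδ.le)
    (hver (-ε) ε δ (by linarith) hε.le hεδ.le le_rfl)
  simp only [Complex.ofReal_zero, zero_mul, add_zero, Complex.ofReal_neg] at hL hRt hM v1 v2 t1 t2
  linear_combination hL + hRt + hM + t1 + t2 - Complex.I * v1 + Complex.I * v2

lemma measurableSet_lt_abs_sub (x ε : ℝ) : MeasurableSet {x' : ℝ | ε < |x' - x|} :=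
  measurableSet_lt measurable_const (by fun_prop)

lemma setIntegral_lt_abs_sub (f : ℝ → ℂ) (x ε : ℝ) :
    ∫ x' in {x' : ℝ | ε < |x' - x|}, f x' = ∫ y in {y : ℝ | ε < |y|}, f (x + y) := by
  have h0 : MeasurableSet {y : ℝ | ε < |y|} := by simpa using measurableSet_lt_abs_sub 0 ε
  rw [← integral_indicator (measurableSet_lt_abs_sub x ε), ← integral_indicator h0,
    ← integral_add_left_eq_self _ x]
  congr 1; ext y
  simp [indicator]

lemma lt_abs_eq_union (ε : ℝ) : {y : ℝ | ε < |y|} = Iio (-ε) ∪ Ioi ε := by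
  ext y
  simp only [mem_ofPred_eq, lt_abs, mem_union, mem_Iio, mem_Ioi]
  constructor
  · rintro (h | h)
    · exact Or.inr h
    · left; linarith
  · rintro (h | h)
    · right; linarith
    · exact Or.inl h

lemma integral_lt_abs {f : ℝ → ℂ} {ε : ℝ} (hε : 0 < ε) (hf : IntegrableOn f {y : ℝ | ε < |y|}) :
    ∫ y in {y : ℝ | ε < |y|}, f y = (∫ y in Iic (-ε), f y) + ∫ y in Ioi ε, f y := by
  rw [lt_abs_eq_union] at hf ⊢
  rw [setIntegral_union _ measurableSet_Ioi (hf.mono_set subset_union_left)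
    (hf.mono_set subset_union_right), integral_Iic_eq_integral_Iio]
  rw [Set.disjoint_left]
  intro y h1 h2
  simp only [mem_Iio, mem_Ioi] at h1 h2
  linarith

lemma integrableOn_coth_mul {δ : ℝ} (hδ : 0 < δ) {g : ℝ → ℂ} (hg : Integrable g) (x : ℝ)
    {ε : ℝ} (hε : 0 < ε) :
    IntegrableOn (fun x' : ℝ => (coth (π / (2 * δ) * (x' - x)) : ℂ) * g x')
      {x' : ℝ | ε < |x' - x|} := by
  have hc : 0 < π / (2 * δ) := by positivity
  refine Integrable.bdd_mul (c := 1 + 1 / (π / (2 * δ) * ε)) hg.integrableOn ?_ ?_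
  · have : Measurable fun x' : ℝ => (coth (π / (2 * δ) * (x' - x)) : ℂ) := by
      unfold coth
      refine Complex.measurable_ofReal.comp (Measurable.div ?_ ?_)
      · exact Real.measurable_cosh.comp (by fun_prop)
      · exact Real.measurable_sinh.comp (by fun_prop)
    exact this.aestronglyMeasurable
  · refine (ae_restrict_iff' (measurableSet_lt_abs_sub x ε)).2 (ae_of_all _ fun x' hx' => ?_)
    simp only [mem_ofPred_eq] at hx'
    have hp : 0 < |x' - x| := hε.trans hx'
    rw [ofReal_coth]
    refine (norm_ccoth_le ?_).trans ?_
    · rw [Complex.ofReal_re]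
      exact mul_ne_zero hc.ne' (abs_pos.1 hp)
    · rw [Complex.ofReal_re, abs_mul, abs_of_pos hc]
      gcongr

lemma abs_tanh_le_one (x : ℝ) : |Real.tanh x| ≤ 1 := by
  rw [Real.tanh_eq_sinh_div_cosh, abs_div, abs_of_pos (Real.cosh_pos x),
    div_le_one (Real.cosh_pos x), Real.abs_sinh, ← Real.cosh_abs x]
  exact (Real.sinh_lt_cosh _).le

lemma integrable_tanh_mul {g : ℝ → ℂ} (hg : Integrable g) (c x : ℝ) :
    Integrable (fun x' : ℝ => (Real.tanh (c * (x' - x)) : ℂ) * g x') := by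
  refine Integrable.bdd_mul (c := 1) hg ?_ ?_
  · have : Continuous fun x' : ℝ => (Real.tanh (c * (x' - x)) : ℂ) := by
      simp_rw [Real.tanh_eq_sinh_div_cosh]
      refine Complex.continuous_ofReal.comp (Continuous.div ?_ ?_ fun y => (Real.cosh_pos _).ne')
      · exact Real.continuous_sinh.comp (by fun_prop)
      · exact Real.continuous_cosh.comp (by fun_prop)
    exact this.aestronglyMeasurable
  · refine ae_of_all _ fun x' => ?_
    rw [Complex.norm_real]; exact abs_tanh_le_one _

/-- The vertical sides of the contour vanish in the limit. -/
lemma tendsto_vertical {δ C : ℝ} (hδ : 0 < δ) {φ : ℂ → ℂ} (σ : ℝ) (hσ : |σ| = 1)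
    (h : ∀ z : ℂ, 1 ≤ |z.re| → 0 ≤ z.im → z.im ≤ δ → ‖φ z‖ ≤ C / z.re ^ 2) :
    Tendsto (fun R : ℝ => ∫ y : ℝ in (0 : ℝ)..δ, φ ((σ * R : ℝ) + y * Complex.I)) atTop (𝓝 0) := by
  have hlim : Tendsto (fun R : ℝ => C / R ^ 2 * |δ - 0|) atTop (𝓝 0) := by
    have : Tendsto (fun R : ℝ => C / R ^ 2) atTop (𝓝 0) :=
      tendsto_const_nhds.div_atTop (tendsto_pow_atTop two_ne_zero)
    simpa using this.mul_const |δ - 0|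
  refine squeeze_zero_norm' ?_ hlim
  filter_upwards [eventually_ge_atTop 1] with R hR
  refine intervalIntegral.norm_integral_le_of_norm_le_const fun y hy => ?_
  rw [uIoc_of_le hδ.le] at hy
  have hre : (((σ * R : ℝ) : ℂ) + y * Complex.I).re = σ * R := by simp
  have him : (((σ * R : ℝ) : ℂ) + y * Complex.I).im = y := by simp
  have h2 : (σ * R) ^ 2 = R ^ 2 := by rw [mul_pow, ← sq_abs σ, hσ]; ring
  have := h (((σ * R : ℝ) : ℂ) + y * Complex.I)
    (by rw [hre, abs_mul, hσ, one_mul]; exact hR.trans (le_abs_self R))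
    (by rw [him]; exact hy.1.le) (by rw [him]; exact hy.2)
  rwa [hre, h2] at this

/-- Boundary Cauchy formula on the lower edge of the strip `0 ≤ Im z ≤ δ`. -/
theorem tendsto_integral_ccoth {δ C : ℝ} (hδ : 0 < δ) {H : ℂ → ℂ}
    (hc : ContinuousOn H {z | 0 ≤ z.im ∧ z.im ≤ δ})
    (hd : DifferentiableOn ℂ H {z | 0 < z.im ∧ z.im < δ})
    (hC : ∀ z : ℂ, 0 ≤ z.im → z.im ≤ δ → ‖H z‖ ≤ C / (1 + z.re ^ 2)) :
    Tendsto (fun ε : ℝ => ∫ y in {y : ℝ | ε < |y|}, (coth (π / (2 * δ) * y) : ℂ) * H y)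
      (𝓝[>] 0) (𝓝 ((∫ y : ℝ, (Real.tanh (π / (2 * δ) * y) : ℂ) * H (y + δ * Complex.I))
        + 2 * δ * Complex.I * H 0)) := by
  set c : ℝ := π / (2 * δ) with hcdef
  have hc0 : 0 < c := by positivity
  have hcδ : c * δ = π / 2 := by rw [hcdef]; field_simp
  set φ : ℂ → ℂ := fun z => ccoth (c * z) * H z with hφ
  have hC0 : 0 ≤ C := by
    have := (norm_nonneg _).trans (hC 0 (by simp) (by simpa using hδ.le))
    simpa using this
  have hφc : ContinuousOn φ ({z | 0 ≤ z.im ∧ z.im ≤ δ} \ {0}) := by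
    refine ContinuousOn.mul (fun z hz => ?_) (hc.mono sdiff_subset)
    have := continuousAt_ccoth (sinh_mul_ne_zero hδ hz.2 hz.1.1 hz.1.2)
    exact (ContinuousAt.comp (f := fun z : ℂ => (c : ℂ) * z) this (by fun_prop)).continuousWithinAt
  have hφd : DifferentiableOn ℂ φ {z | 0 < z.im ∧ z.im < δ} := by
    refine DifferentiableOn.mul (fun z hz => ?_) hd
    have hz0 : z ≠ 0 := by rintro rfl; simp at hz
    have := differentiableAt_ccoth (sinh_mul_ne_zero hδ hz0 hz.1.le hz.2.le)
    exact (DifferentiableAt.comp (f := fun z : ℂ => (c : ℂ) * z) z this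
      (by fun_prop)).differentiableWithinAt
  have hbot : Continuous fun y : ℝ => H y := by
    rw [← continuousOn_univ]
    exact hc.comp (by fun_prop) fun y _ => by simp [hδ.le]
  have htop : Continuous fun y : ℝ => H (y + δ * Complex.I) := by
    rw [← continuousOn_univ]
    exact hc.comp (by fun_prop) fun y _ => by simp [hδ.le]
  have hbi : Integrable fun y : ℝ => H y := integrable_of_bound hbot (C := C) fun y => by
    simpa using hC y (by simp) (by simpa using hδ.le)
  have hti : Integrable fun y : ℝ => H (y + δ * Complex.I) :=
    integrable_of_bound htop (C := C) fun y => by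
      simpa using hC (y + δ * Complex.I) (by simpa using hδ.le) (by simp)
  have hφbot (y : ℝ) : φ y = (coth (c * y) : ℂ) * H y := by
    simp only [hφ]; rw [ofReal_coth]; push_cast; rfl
  have hφtop (y : ℝ) :
      φ (y + δ * Complex.I) = (Real.tanh (c * y) : ℂ) * H (y + δ * Complex.I) := by
    simp only [hφ]
    rw [mul_add, ← mul_assoc (c : ℂ) (δ : ℂ), ← Complex.ofReal_mul c δ, hcδ]
    push_cast
    rw [ccoth_add_I_pi_div_two]
  have hφti : Integrable fun y : ℝ => φ (y + δ * Complex.I) := by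
    simp_rw [hφtop]
    simpa using integrable_tanh_mul hti c 0
  have hφbi {ε : ℝ} (hε : 0 < ε) : IntegrableOn (fun y : ℝ => φ y) {y : ℝ | ε < |y|} := by
    simp_rw [hφbot]
    simpa using integrableOn_coth_mul hδ hbi 0 hε
  have hver (z : ℂ) (h1 : 1 ≤ |z.re|) (h2 : 0 ≤ z.im) (h3 : z.im ≤ δ) :
      ‖φ z‖ ≤ ((1 + 1 / c) * C) / z.re ^ 2 := by
    have hz : 0 < |z.re| := by linarith
    have hz2 : 0 < z.re ^ 2 := by rw [← sq_abs]; positivity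
    have e1 : ‖ccoth (c * z)‖ ≤ 1 + 1 / c := by
      refine (norm_ccoth_le ?_).trans ?_
      · rw [Complex.re_ofReal_mul]; exact mul_ne_zero hc0.ne' (abs_pos.1 hz)
      · rw [Complex.re_ofReal_mul, abs_mul, abs_of_pos hc0]
        gcongr
        nlinarith
    have e2 : ‖H z‖ ≤ C / z.re ^ 2 := (hC z h2 h3).trans (by gcongr; linarith)
    rw [hφ, mul_div_assoc]
    simp only [norm_mul]
    exact mul_le_mul e1 e2 (norm_nonneg _) (by positivity)
  set Box : ℝ → ℂ := fun ε => (∫ y : ℝ in (-ε)..ε, φ (y + ε * Complex.I))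
        + Complex.I * (∫ y : ℝ in (0 : ℝ)..ε, φ (-ε + y * Complex.I))
        - Complex.I * (∫ y : ℝ in (0 : ℝ)..ε, φ (ε + y * Complex.I)) with hBox
  -- the identity on the infinite strip
  have hid {ε : ℝ} (hε : 0 < ε) (hεδ : ε < δ) : ∫ y in {y : ℝ | ε < |y|}, φ y =
      (∫ y : ℝ, φ (y + δ * Complex.I)) - Box ε := by
    have hi := hφbi hε
    have hi' := hi
    rw [lt_abs_eq_union] at hi'
    rw [integral_lt_abs hε hi]
    have l1 : Tendsto (fun R : ℝ => ∫ y : ℝ in (-R)..(-ε), φ y) atTop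
        (𝓝 (∫ y in Iic (-ε), φ y)) :=
      intervalIntegral_tendsto_integral_Iic _
        ((integrableOn_Iic_iff_integrableOn_Iio).2 (hi'.mono_set subset_union_left))
        tendsto_neg_atTop_atBot
    have l2 : Tendsto (fun R : ℝ => ∫ y : ℝ in ε..R, φ y) atTop (𝓝 (∫ y in Ioi ε, φ y)) :=
      intervalIntegral_tendsto_integral_Ioi _ (hi'.mono_set subset_union_right) tendsto_id
    have l3 : Tendsto (fun R : ℝ => ∫ y : ℝ in (-R)..R, φ (y + δ * Complex.I)) atTop
        (𝓝 (∫ y : ℝ, φ (y + δ * Complex.I))) :=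
      intervalIntegral_tendsto_integral hφti tendsto_neg_atTop_atBot tendsto_id
    have l4 := tendsto_vertical hδ 1 (by simp) hver
    have l5 := tendsto_vertical hδ (-1) (by simp) hver
    have l6 := ((((l1.add l2).sub l3).add_const (Box ε)).add (l4.const_mul Complex.I)).sub
      (l5.const_mul Complex.I)
    have l7 := tendsto_nhds_unique (l6.congr' (f₂ := fun _ => (0 : ℂ)) (by
      filter_upwards [eventually_gt_atTop ε] with R hR
      rw [← strip_contour hε hεδ hR hφc hφd]
      simp only [hBox]
      push_cast
      simp only [one_mul, neg_mul])) tendsto_const_nhds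
    linear_combination l7
  -- the box
  have hψ : Tendsto (fun z => z * φ z) (𝓝[{z | 0 ≤ z.im ∧ z.im ≤ δ} \ {0}] 0)
      (𝓝 (1 / c * H 0)) := by
    have h1 := (tendsto_mul_ccoth c (by exact_mod_cast hc0.ne')).mono_left
      (nhdsWithin_mono 0 (show ({z | 0 ≤ z.im ∧ z.im ≤ δ} \ {0} : Set ℂ) ⊆ {0}ᶜ from
        fun z hz => hz.2))
    have h2 : Tendsto H (𝓝[{z | 0 ≤ z.im ∧ z.im ≤ δ} \ {0}] 0) (𝓝 (H 0)) :=
      (hc 0 (by simpa using hδ.le)).mono_left (nhdsWithin_mono 0 sdiff_subset)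
    refine (h1.mul h2).congr fun z => ?_
    simp only [hφ]; ring
  have side (γ : ℝ → ℂ) (hγ : Continuous γ) (a b : ℝ) (hn : ∀ s, 1 ≤ ‖γ s‖)
      (him : ∀ s ∈ uIcc a b, 0 ≤ (γ s).im ∧ (γ s).im ≤ 1) :
      Tendsto (fun ε : ℝ => ∫ s in a..b, (ε * γ s) * φ (ε * γ s) / γ s) (𝓝[>] 0)
      (𝓝 ((1 / c * H 0) * ∫ s in a..b, 1 / γ s)) := by
    have hS : ∀ᶠ ε : ℝ in 𝓝[>] 0, ∀ s ∈ uIcc a b,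
        (ε : ℂ) * γ s ∈ ({z | 0 ≤ z.im ∧ z.im ≤ δ} \ {0} : Set ℂ) := by
      filter_upwards [Ioo_mem_nhdsGT hδ] with ε hε s hs
      obtain ⟨i1, i2⟩ := him s hs
      refine ⟨⟨?_, ?_⟩, ?_⟩
      · rw [Complex.im_ofReal_mul]; exact mul_nonneg hε.1.le i1
      · rw [Complex.im_ofReal_mul]; nlinarith [hε.1, hε.2]
      · intro h
        have hγ0 : γ s ≠ 0 := fun h => by have := hn s; rw [h, norm_zero] at this; linarith
        exact mul_ne_zero (by exact_mod_cast hε.1.ne') hγ0 h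
    refine tendsto_box_side hψ hγ hn hS ?_
    filter_upwards [hS] with ε hε
    have : ContinuousOn (fun z => z * φ z) ({z | 0 ≤ z.im ∧ z.im ≤ δ} \ {0}) :=
      continuousOn_id.mul hφc
    exact this.comp (by fun_prop) hε
  have hBoxlim : Tendsto Box (𝓝[>] 0) (𝓝 (-(2 * δ * Complex.I * H 0))) := by
    have s1 := side (fun s => s + Complex.I) (by fun_prop) (-1) 1
      (fun s => by simpa using Complex.abs_im_le_norm ((s : ℂ) + Complex.I)) (by simp)
    have s2 := side (fun s => -1 + s * Complex.I) (by fun_prop) 0 1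
      (fun s => by simpa using Complex.abs_re_le_norm (-1 + (s : ℂ) * Complex.I)) (by simp)
    have s3 := side (fun s => 1 + s * Complex.I) (by fun_prop) 0 1
      (fun s => by simpa using Complex.abs_re_le_norm (1 + (s : ℂ) * Complex.I)) (by simp)
    have s4 := (s1.add (s2.const_mul Complex.I)).sub (s3.const_mul Complex.I)
    have e : 1 / c * H 0 * (∫ s : ℝ in (-1 : ℝ)..1, 1 / ((s : ℂ) + Complex.I)) +
        Complex.I * (1 / c * H 0 * ∫ s : ℝ in (0 : ℝ)..1, 1 / (-1 + s * Complex.I)) -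
        Complex.I * (1 / c * H 0 * ∫ s : ℝ in (0 : ℝ)..1, 1 / (1 + s * Complex.I)) =
        -(2 * δ * Complex.I * H 0) := by
      have hπ : (π : ℂ) / c = 2 * δ := by
        rw [hcdef]; push_cast
        have : (π : ℂ) ≠ 0 := by exact_mod_cast Real.pi_ne_zero
        have : (δ : ℂ) ≠ 0 := by exact_mod_cast hδ.ne'
        field_simp
      linear_combination (1 / c * H 0) * box_integral - (Complex.I * H 0) * hπ
    rw [e] at s4
    refine s4.congr' ?_
    filter_upwards [self_mem_nhdsWithin] with ε hε
    have hε0 : (ε : ℂ) ≠ 0 := by exact_mod_cast (ne_of_gt hε)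
    have red (γ : ℝ → ℂ) (a b : ℝ) (hn : ∀ s, 1 ≤ ‖γ s‖) :
        ∫ s in a..b, (ε * γ s) * φ (ε * γ s) / γ s = ε * ∫ s in a..b, φ (ε * γ s) := by
      rw [← intervalIntegral.integral_const_mul]
      congr 1; ext s
      have hγ0 : γ s ≠ 0 := fun h => by have := hn s; rw [h, norm_zero] at this; linarith
      field_simp
    rw [red _ _ _ (fun s => by simpa using Complex.abs_im_le_norm ((s : ℂ) + Complex.I)),
      red _ _ _ (fun s => by simpa using Complex.abs_re_le_norm (-1 + (s : ℂ) * Complex.I)),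
      red _ _ _ (fun s => by simpa using Complex.abs_re_le_norm (1 + (s : ℂ) * Complex.I))]
    have c1 := intervalIntegral.smul_integral_comp_mul_left (a := -1) (b := 1)
      (fun y : ℝ => φ (y + ε * Complex.I)) ε
    have c2 := intervalIntegral.smul_integral_comp_mul_left (a := 0) (b := 1)
      (fun y : ℝ => φ (-ε + y * Complex.I)) ε
    have c3 := intervalIntegral.smul_integral_comp_mul_left (a := 0) (b := 1)
      (fun y : ℝ => φ (ε + y * Complex.I)) ε
    simp only [mul_neg, mul_one, mul_zero, Complex.real_smul] at c1 c2 c3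
    rw [hBox]
    simp only [← c1, ← c2, ← c3]
    congr 2
    · congr 2; ext s; push_cast; ring_nf
    · congr 3; ext s; push_cast; ring_nf
    · congr 2; ext s; push_cast; ring_nf
  have hfin := hBoxlim.const_sub (∫ y : ℝ, φ (y + δ * Complex.I))
  rw [sub_neg_eq_add] at hfin
  simp_rw [hφtop] at hfin
  refine hfin.congr' ?_
  filter_upwards [Ioo_mem_nhdsGT hδ] with ε hε
  have := hid hε.1 hε.2
  simp_rw [hφbot, hφtop] at this
  exact this.symm

/-- `h` is continuous on the closed strip, analytic inside and `O(x⁻²)`. -/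
structure StripDecay (δ : ℝ) (h : ℂ → ℂ) : Prop where
  cont : ContinuousOn h (closedStrip δ)
  diff : DifferentiableOn ℂ h (strip δ)
  decay : ∃ C : ℝ, ∀ z ∈ closedStrip δ, ‖h z‖ ≤ C / (1 + z.re ^ 2)

lemma StripDecay.comp_neg {δ : ℝ} {h : ℂ → ℂ} (hh : StripDecay δ h) :
    StripDecay δ (fun z => h (-z)) := by
  obtain ⟨C, hC⟩ := hh.decay
  refine ⟨?_, ?_, C, fun z hz => ?_⟩
  · exact hh.cont.comp (by fun_prop) fun z hz => by simpa [closedStrip] using hz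
  · exact hh.diff.comp (by fun_prop) fun z hz => by simpa [strip] using hz
  · simpa using hC (-z) (by simpa [closedStrip] using hz)

lemma StripDecay.continuous_lower {δ : ℝ} (hδ : 0 < δ) {h : ℂ → ℂ} (hh : StripDecay δ h) :
    Continuous fun y : ℝ => h (y - Complex.I * δ / 2) := by
  rw [← continuousOn_univ]
  exact hh.cont.comp (by fun_prop) fun y _ => lower_mem_closedStrip hδ y

lemma StripDecay.continuous_upper {δ : ℝ} (hδ : 0 < δ) {h : ℂ → ℂ} (hh : StripDecay δ h) :
    Continuous fun y : ℝ => h (y + Complex.I * δ / 2) := by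
  rw [← continuousOn_univ]
  exact hh.cont.comp (by fun_prop) fun y _ => upper_mem_closedStrip hδ y

lemma StripDecay.integrable_lower {δ : ℝ} (hδ : 0 < δ) {h : ℂ → ℂ} (hh : StripDecay δ h) :
    Integrable fun y : ℝ => h (y - Complex.I * δ / 2) := by
  obtain ⟨C, hC⟩ := hh.decay
  refine integrable_of_bound (hh.continuous_lower hδ) (C := C) fun x => ?_
  simpa using hC _ (lower_mem_closedStrip hδ x)

lemma StripDecay.integrable_upper {δ : ℝ} (hδ : 0 < δ) {h : ℂ → ℂ} (hh : StripDecay δ h) :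
    Integrable fun y : ℝ => h (y + Complex.I * δ / 2) := by
  obtain ⟨C, hC⟩ := hh.decay
  refine integrable_of_bound (hh.continuous_upper hδ) (C := C) fun x => ?_
  simpa using hC _ (upper_mem_closedStrip hδ x)

theorem tendsto_truncT_lower {δ : ℝ} (hδ : 0 < δ) {h : ℂ → ℂ} (hh : StripDecay δ h) (x : ℝ) :
    Tendsto (truncT δ (fun y => h (y - Complex.I * δ / 2)) x) (𝓝[>] 0)
      (𝓝 (opTt δ (fun y => h (y + Complex.I * δ / 2)) x
        + Complex.I * h (x - Complex.I * δ / 2))) := by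
  obtain ⟨C, hC⟩ := hh.decay
  have hC0 : 0 ≤ C := by
    have := (norm_nonneg _).trans (hC 0 (by simp [closedStrip, (half_pos hδ).le]))
    simpa using this
  have hshift (z : ℂ) (h0 : 0 ≤ z.im) (h1 : z.im ≤ δ) :
      (x : ℂ) + z - Complex.I * δ / 2 ∈ closedStrip δ := by
    simp only [closedStrip, mem_ofPred_eq]
    have : ((x : ℂ) + z - Complex.I * δ / 2).im = z.im - δ / 2 := by simp
    rw [this, abs_le]; constructor <;> linarith
  have hshift' (z : ℂ) (h0 : 0 < z.im) (h1 : z.im < δ) :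
      (x : ℂ) + z - Complex.I * δ / 2 ∈ strip δ := by
    simp only [strip, mem_ofPred_eq]
    have : ((x : ℂ) + z - Complex.I * δ / 2).im = z.im - δ / 2 := by simp
    rw [this, abs_lt]; constructor <;> linarith
  have main := tendsto_integral_ccoth hδ (C := C * (2 + 2 * x ^ 2))
    (H := fun z => h (x + z - Complex.I * δ / 2))
    (hh.cont.comp (by fun_prop) fun z hz => hshift z hz.1 hz.2)
    (hh.diff.comp (by fun_prop) fun z hz => hshift' z hz.1 hz.2) (fun z h0 h1 => by
      have := hC _ (hshift z h0 h1)
      refine this.trans ?_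
      have hre : ((x : ℂ) + z - Complex.I * δ / 2).re = x + z.re := by simp
      rw [hre, div_le_div_iff₀ (by positivity) (by positivity), mul_assoc]
      refine mul_le_mul_of_nonneg_left ?_ hC0
      nlinarith [sq_nonneg (2 * x + z.re), sq_nonneg (x * (x + z.re))])
  have hδc : (δ : ℂ) ≠ 0 := by exact_mod_cast hδ.ne'
  have main2 := main.const_mul (1 / (2 * (δ : ℂ)))
  have e : 1 / (2 * (δ : ℂ)) * ((∫ y : ℝ, (Real.tanh (π / (2 * δ) * y) : ℂ) *
      h (x + (y + δ * Complex.I) - Complex.I * δ / 2)) +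
      2 * δ * Complex.I * h (x + 0 - Complex.I * δ / 2)) =
      opTt δ (fun y => h (y + Complex.I * δ / 2)) x + Complex.I * h (x - Complex.I * δ / 2) := by
    rw [opTt, mul_add]
    congr 1
    · congr 1
      rw [← integral_add_left_eq_self (fun y : ℝ => (Real.tanh (π / (2 * δ) * (y - x)) : ℂ) *
        h (y + Complex.I * δ / 2)) x]
      congr 1; ext y
      rw [add_sub_cancel_left]
      congr 2; push_cast; ring
    · rw [add_zero]; field_simp
  rw [e] at main2
  refine main2.congr fun ε => ?_
  rw [truncT, setIntegral_lt_abs_sub]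
  congr 2; ext y
  rw [add_sub_cancel_left]
  push_cast; rfl

lemma coth_neg (x : ℝ) : coth (-x) = -coth x := by
  simp [coth, div_neg]

lemma truncT_comp_neg (δ : ℝ) (g : ℝ → ℂ) (x ε : ℝ) :
    truncT δ (fun y => g (-y)) (-x) ε = - truncT δ g x ε := by
  rw [truncT, truncT, ← mul_neg, ← integral_indicator (measurableSet_lt_abs_sub _ ε),
    ← integral_indicator (measurableSet_lt_abs_sub _ ε), ← integral_neg_eq_self, ← integral_neg]
  congr 2; ext y
  have h1 : |-y - -x| = |y - x| := by rw [← abs_neg]; congr 1; ring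
  have h2 : π / (2 * δ) * (-y - -x) = -(π / (2 * δ) * (y - x)) := by ring
  simp only [indicator, mem_ofPred_eq, h1, h2, coth_neg, neg_neg]
  split_ifs <;> simp

lemma opTt_comp_neg (δ : ℝ) (g : ℝ → ℂ) (x : ℝ) :
    opTt δ (fun y => g (-y)) (-x) = - opTt δ g x := by
  rw [opTt, opTt, ← mul_neg, ← integral_neg_eq_self, ← integral_neg]
  congr 2; ext y
  have h2 : π / (2 * δ) * (-y - -x) = -(π / (2 * δ) * (y - x)) := by ring
  rw [h2, Real.tanh_neg, neg_neg]
  push_cast; ring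

theorem tendsto_truncT_upper {δ : ℝ} (hδ : 0 < δ) {h : ℂ → ℂ} (hh : StripDecay δ h) (x : ℝ) :
    Tendsto (truncT δ (fun y => h (y + Complex.I * δ / 2)) x) (𝓝[>] 0)
      (𝓝 (opTt δ (fun y => h (y - Complex.I * δ / 2)) x
        - Complex.I * h (x + Complex.I * δ / 2))) := by
  have h1 := (tendsto_truncT_lower hδ hh.comp_neg (-x)).neg
  have e1 : (fun y : ℝ => h (-((y : ℂ) - Complex.I * δ / 2))) =
      fun y => (fun y : ℝ => h ((y : ℂ) + Complex.I * δ / 2)) (-y) := by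
    ext y; congr 1; push_cast; ring
  have e2 : (fun y : ℝ => h (-((y : ℂ) + Complex.I * δ / 2))) =
      fun y => (fun y : ℝ => h ((y : ℂ) - Complex.I * δ / 2)) (-y) := by
    ext y; congr 1; push_cast; ring
  have e3 : -(((-x : ℝ) : ℂ) - Complex.I * δ / 2) = x + Complex.I * δ / 2 := by push_cast; ring
  rw [e1, e2, opTt_comp_neg δ (fun y : ℝ => h ((y : ℂ) - Complex.I * δ / 2)) x, e3, neg_add, neg_neg, ← sub_eq_add_neg] at h1
  refine h1.congr fun ε => ?_
  rw [truncT_comp_neg δ (fun y : ℝ => h ((y : ℂ) + Complex.I * δ / 2)), neg_neg]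

lemma tExists_of_tendsto {δ : ℝ} (hδ : 0 < δ) {g : ℝ → ℂ} (hg : Integrable g)
    (h : ∀ x, ∃ a, Tendsto (truncT δ g x) (𝓝[>] 0) (𝓝 a)) : TExists δ g :=
  fun x => ⟨fun _ hε => integrableOn_coth_mul hδ hg x hε, h x⟩

lemma ttExists_of_integrable {δ : ℝ} {g : ℝ → ℂ} (hg : Integrable g) : TtExists δ g :=
  fun x => integrable_tanh_mul hg _ x

/-- The transforms of `w = i(h⁻ - k⁺)` and `w' = i(k⁻ - h⁺)`. -/
theorem transforms_of_stripDecay {δ : ℝ} (hδ : 0 < δ) {h k : ℂ → ℂ} (hh : StripDecay δ h)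
    (hk : StripDecay δ k) {w w' : ℝ → ℂ}
    (hw : w = fun y : ℝ => Complex.I * (h (y - Complex.I * δ / 2) - k (y + Complex.I * δ / 2)))
    (hw' : w' = fun y : ℝ => Complex.I * (k (y - Complex.I * δ / 2) - h (y + Complex.I * δ / 2))) :
    TExists δ w ∧ TtExists δ w ∧ ∀ x : ℝ, opT δ w x + opTt δ w' x =
      -(h (x - Complex.I * δ / 2) + k (x + Complex.I * δ / 2)) := by
  have ih := hh.integrable_lower hδ
  have ih' := hh.integrable_upper hδ
  have ik := hk.integrable_upper hδ
  have ik' := hk.integrable_lower hδ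
  have iw : Integrable w := by rw [hw]; exact (ih.sub ik).const_mul _
  have htt (x : ℝ) : opTt δ w' x = Complex.I * (opTt δ (fun y : ℝ => k (y - Complex.I * δ / 2)) x
      - opTt δ (fun y : ℝ => h (y + Complex.I * δ / 2)) x) := by
    have a1 := integrable_tanh_mul ik' (π / (2 * δ)) x
    have a2 := integrable_tanh_mul ih' (π / (2 * δ)) x
    simp only [opTt, hw']
    rw [← mul_sub, ← integral_sub a1 a2, mul_left_comm, ← integral_const_mul Complex.I]
    congr 2; ext y; ring
  have hlim (x : ℝ) := ((tendsto_truncT_lower hδ hh x).sub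
    (tendsto_truncT_upper hδ hk x)).const_mul Complex.I
  have hlim' (x : ℝ) : Tendsto (truncT δ w x) (𝓝[>] 0)
      (𝓝 (-(h (x - Complex.I * δ / 2) + k (x + Complex.I * δ / 2)) - opTt δ w' x)) := by
    have e : Complex.I * (opTt δ (fun y => h (y + Complex.I * δ / 2)) x
        + Complex.I * h (x - Complex.I * δ / 2) - (opTt δ (fun y => k (y - Complex.I * δ / 2)) x
        - Complex.I * k (x + Complex.I * δ / 2))) =
        -(h (x - Complex.I * δ / 2) + k (x + Complex.I * δ / 2)) - opTt δ w' x := by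
      rw [htt]
      linear_combination (h (x - Complex.I * δ / 2) + k (x + Complex.I * δ / 2)) * Complex.I_sq
    rw [← e]
    refine (hlim x).congr' ?_
    filter_upwards [self_mem_nhdsWithin] with ε hε
    have a1 := integrableOn_coth_mul hδ ih x hε
    have a2 := integrableOn_coth_mul hδ ik x hε
    simp only [truncT, hw]
    rw [← mul_sub, ← integral_sub a1 a2, mul_left_comm, ← integral_const_mul Complex.I]
    congr 2; ext y; ring
  refine ⟨tExists_of_tendsto hδ iw fun x => ⟨_, hlim' x⟩, ttExists_of_integrable iw, fun x => ?_⟩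
  rw [opT, (hlim' x).limUnder_eq]; ring

lemma closure_strip {δ : ℝ} (hδ : 0 < δ) : closure (strip δ) = closedStrip δ := by
  have h1 : strip δ = Complex.im ⁻¹' Ioo (-(δ / 2)) (δ / 2) := by
    ext z; simp [strip, abs_lt]
  have h2 : closedStrip δ = Complex.im ⁻¹' Icc (-(δ / 2)) (δ / 2) := by
    ext z; simp [closedStrip, abs_le]
  rw [h1, h2, Complex.closure_preimage_im, closure_Ioo (by linarith)]

lemma convex_strip (δ : ℝ) : Convex ℝ (strip δ) := by
  have h1 : strip δ = Complex.imLm ⁻¹' Ioo (-(δ / 2)) (δ / 2) := by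
    ext z; simp [strip, abs_lt]
  rw [h1]
  exact (convex_Ioo _ _).linear_preimage _

/-- A derivative which extends continuously to the closed strip is a derivative along horizontal
lines up to the boundary. -/
lemma hasDerivAt_line {δ : ℝ} (hδ : 0 < δ) {f f' : ℂ → ℂ}
    (hd : ∀ z ∈ strip δ, HasDerivAt f (f' z) z) (hc : ContinuousOn f (closedStrip δ))
    (hc' : ContinuousOn f' (closedStrip δ)) {w : ℂ} (hw : |w.im| ≤ δ / 2) (x : ℝ) :
    HasDerivAt (fun y : ℝ => f (y + w)) (f' (x + w)) x := by
  have hmem (y : ℝ) : (y : ℂ) + w ∈ closedStrip δ := by simpa [closedStrip] using hw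
  have hF (z : ℂ) (hz : z ∈ strip δ) : HasFDerivAt f (f' z • (1 : ℂ →L[ℝ] ℂ)) z :=
    (hd z hz).complexToReal_fderiv
  have key : HasFDerivWithinAt f (f' (x + w) • (1 : ℂ →L[ℝ] ℂ)) (closure (strip δ)) (x + w) := by
    refine hasFDerivWithinAt_closure_of_tendsto_fderiv
      (fun z hz => (hF z hz).differentiableAt.differentiableWithinAt) (convex_strip δ)
      (isOpen_strip δ) (fun y hy => ?_) ?_
    · rw [closure_strip hδ] at hy
      exact (hc y hy).mono (strip_subset_closedStrip δ)
    · have h1 : Tendsto f' (𝓝[strip δ] (x + w)) (𝓝 (f' (x + w))) :=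
        (hc' _ (hmem x)).mono_left (nhdsWithin_mono _ (strip_subset_closedStrip δ))
      refine (h1.smul_const (1 : ℂ →L[ℝ] ℂ)).congr' ?_
      filter_upwards [self_mem_nhdsWithin] with z hz
      rw [(hF z hz).fderiv]
  rw [closure_strip hδ] at key
  have hl : HasDerivWithinAt (fun y : ℝ => (y : ℂ) + w) 1 univ x :=
    ((Complex.ofRealCLM.hasDerivAt (x := x)).add_const w).hasDerivWithinAt
  have := key.comp_hasDerivWithinAt (f := fun y : ℝ => (y : ℂ) + w) x hl (fun y _ => hmem y)
  rw [hasDerivWithinAt_univ] at this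
  simpa [Function.comp_def] using this

/-- The mixed partial derivatives agree: `∂_x ∂_t l = ∂_t ∂_x l`. -/
lemma hasDerivAt_mixed {l d lt dt' : ℝ → ℝ → ℂ}
    (h1 : ∀ x t, HasDerivAt (fun y => l y t) (d x t) x) (hc : ∀ t, Continuous fun x => d x t)
    (h2 : ∀ x t, HasDerivAt (fun s => l x s) (lt x t) t)
    (h3 : ∀ x t, HasDerivAt (fun s => d x s) (dt' x t) t)
    (h4 : Continuous (Function.uncurry dt')) (x t : ℝ) :
    HasDerivAt (fun y => lt y t) (dt' x t) x := by
  have hint (y : ℝ) : lt y t - lt 0 t = ∫ s in (0 : ℝ)..y, dt' s t := by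
    have hK : IsCompact (uIcc 0 y ×ˢ Icc (t - 1) (t + 1)) := isCompact_uIcc.prod isCompact_Icc
    obtain ⟨B, hB⟩ := hK.exists_bound_of_continuousOn (f := Function.uncurry dt') h4.continuousOn
    have h5 := (intervalIntegral.hasDerivAt_integral_of_dominated_loc_of_deriv_le
      (μ := volume) (F := fun s y => d y s) (F' := fun s y => dt' y s) (x₀ := t) (a := 0) (b := y)
      (s := Icc (t - 1) (t + 1)) (bound := fun _ => B) (Icc_mem_nhds (by linarith) (by linarith))
      (Eventually.of_forall fun s => (hc s).aestronglyMeasurable)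
      ((hc t).intervalIntegrable _ _)
      (by
        have : Continuous fun y => dt' y t := h4.comp (by fun_prop : Continuous fun y => (y, t))
        exact this.aestronglyMeasurable)
      (ae_of_all _ fun a ha s hs => hB (a, s) ⟨uIoc_subset_uIcc ha, hs⟩)
      (by simp)
      (ae_of_all _ fun a _ s _ => h3 a s)).2
    have h6 : (fun s => ∫ a in (0 : ℝ)..y, d a s) = fun s => l y s - l 0 s := by
      ext s
      exact intervalIntegral.integral_eq_sub_of_hasDerivAt (fun a _ => h1 a s)
        ((hc s).intervalIntegrable _ _)
    rw [h6] at h5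
    exact ((h2 y t).sub (h2 0 t)).unique h5
  have hct : Continuous fun y => dt' y t := h4.comp (by fun_prop : Continuous fun y => (y, t))
  have h7 : HasDerivAt (fun y => ∫ s in (0 : ℝ)..y, dt' s t) (dt' x t) x :=
    intervalIntegral.integral_hasDerivAt_right (hct.intervalIntegrable _ _)
      (hct.stronglyMeasurableAtFilter _ _) hct.continuousAt
  have h8 : (fun y => lt y t) = fun y => (∫ s in (0 : ℝ)..y, dt' s t) + lt 0 t := by
    ext y; rw [← hint y]; ring
  rw [h8]
  exact h7.add_const _

/-- A logarithm `l(x,t)` along a horizontal line, with its derivatives, converging at `+∞`. -/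
structure LineLog (l d₁ d₂ d₃ lt d₁t : ℝ → ℝ → ℂ) (f₁ : ℂ) (fp' : ℝ → ℂ) : Prop where
  deriv₁ : ∀ x t, HasDerivAt (fun y => l y t) (d₁ x t) x
  deriv₂ : ∀ x t, HasDerivAt (fun y => d₁ y t) (d₂ x t) x
  deriv₃ : ∀ x t, HasDerivAt (fun y => d₂ y t) (d₃ x t) x
  cont₃ : ∀ t, Continuous fun x => d₃ x t
  deriv_t : ∀ x t, HasDerivAt (fun s => l x s) (lt x t) t
  deriv₁_t : ∀ x t, HasDerivAt (fun s => d₁ x s) (d₁t x t) t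
  deriv_lt : ∀ x t, HasDerivAt (fun y => lt y t) (d₁t x t) x
  lim₁ : ∀ t, Tendsto (fun x => d₁ x t) atTop (𝓝 f₁)
  lim₂ : ∀ t, Tendsto (fun x => d₂ x t) atTop (𝓝 0)
  lim_t : ∀ t, Tendsto (fun x => lt x t) atTop (𝓝 (fp' t))

lemma hirotaD_one_zero {f g f' g' : ℝ → ℝ → ℂ}
    (hf : ∀ x t, HasDerivAt (fun s => f x s) (f' x t) t)
    (hg : ∀ x t, HasDerivAt (fun s => g x s) (g' x t) t) (x t : ℝ) :
    hirotaD 1 0 f g x t = f' x t * g x t - f x t * g' x t := by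
  simp only [hirotaD, Function.iterate_one, Function.iterate_zero, id_eq, antiDt]
  rw [((hf x t).mul_const _).deriv, ((hg x t).const_mul _).deriv]

lemma hirotaD_zero_two {f g f₁ g₁ f₂ g₂ : ℝ → ℝ → ℂ}
    (hf : ∀ x t, HasDerivAt (fun y => f y t) (f₁ x t) x)
    (hg : ∀ x t, HasDerivAt (fun y => g y t) (g₁ x t) x)
    (hf₁ : ∀ x t, HasDerivAt (fun y => f₁ y t) (f₂ x t) x)
    (hg₁ : ∀ x t, HasDerivAt (fun y => g₁ y t) (g₂ x t) x) (x t : ℝ) :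
    hirotaD 0 2 f g x t = f₂ x t * g x t - 2 * f₁ x t * g₁ x t + f x t * g₂ x t := by
  have h1 : antiDx (fun x x' t t' => f x t * g x' t') =
      fun x x' t t' => f₁ x t * g x' t' - f x t * g₁ x' t' := by
    funext x x' t t'
    simp only [antiDx]
    rw [((hf x t).mul_const _).deriv, ((hg x' t').const_mul _).deriv]
  simp only [hirotaD, Function.iterate_zero, id_eq, Function.iterate_succ, Function.comp_apply, h1]
  simp only [antiDx]
  rw [(((hf₁ x t).mul_const _).fun_sub ((hf x t).mul_const _)).deriv,
    (((hg x t).const_mul _).fun_sub ((hg₁ x t).const_mul _)).deriv]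
  ring

section Pair

variable {l d₁ d₂ d₃ lt d₁t m e₁ e₂ e₃ mt e₁t : ℝ → ℝ → ℂ} {f₁ : ℂ} {fp' gp' : ℝ → ℂ}

lemma LineLog.hirota (hl : LineLog l d₁ d₂ d₃ lt d₁t f₁ fp') (hm : LineLog m e₁ e₂ e₃ mt e₁t f₁ gp')
    {f g : ℝ → ℝ → ℂ} (hf : f = fun x t => Complex.exp (l x t))
    (hg : g = fun x t => Complex.exp (m x t)) (x t : ℝ) :
    Complex.I * hirotaD 1 0 f g x t - hirotaD 0 2 f g x t = f x t * g x t *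
      (Complex.I * (lt x t - mt x t) - (d₂ x t + e₂ x t + (d₁ x t - e₁ x t) ^ 2)) := by
  have exp1 {l d₁ d₂ d₃ lt d₁t : ℝ → ℝ → ℂ} {fp' : ℝ → ℂ}
      (hl : LineLog l d₁ d₂ d₃ lt d₁t f₁ fp') {f : ℝ → ℝ → ℂ}
      (hf : f = fun x t => Complex.exp (l x t)) :
      (∀ x t, HasDerivAt (fun s => f x s) (f x t * lt x t) t) ∧
      (∀ x t, HasDerivAt (fun y => f y t) (f x t * d₁ x t) x) ∧
      (∀ x t, HasDerivAt (fun y => f y t * d₁ y t)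
        (f x t * d₁ x t * d₁ x t + f x t * d₂ x t) x) := by
    subst hf
    refine ⟨fun x t => (hl.deriv_t x t).cexp, fun x t => (hl.deriv₁ x t).cexp,
      fun x t => (hl.deriv₁ x t).cexp.mul (hl.deriv₂ x t)⟩
  obtain ⟨a1, a2, a3⟩ := exp1 hl hf
  obtain ⟨b1, b2, b3⟩ := exp1 hm hg
  rw [hirotaD_one_zero (f' := fun x t => f x t * lt x t) (g' := fun x t => g x t * mt x t) a1 b1,
    hirotaD_zero_two (f₁ := fun x t => f x t * d₁ x t) (g₁ := fun x t => g x t * e₁ x t)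
    (f₂ := fun x t => f x t * d₁ x t * d₁ x t + f x t * d₂ x t)
    (g₂ := fun x t => g x t * e₁ x t * e₁ x t + g x t * e₂ x t) a2 b2 a3 b3]
  ring

/-- The bilinear equation for a pair of exponentials is equivalent to its `x`-derivative. -/
lemma LineLog.bilinear_iff (hl : LineLog l d₁ d₂ d₃ lt d₁t f₁ fp')
    (hm : LineLog m e₁ e₂ e₃ mt e₁t f₁ gp') (hfg : ∀ t, fp' t = gp' t)
    {f g : ℝ → ℝ → ℂ} (hf : f = fun x t => Complex.exp (l x t))
    (hg : g = fun x t => Complex.exp (m x t)) :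
    (∀ x t : ℝ, Complex.I * hirotaD 1 0 f g x t - hirotaD 0 2 f g x t = 0) ↔
    ∀ x t : ℝ, Complex.I * (d₁t x t - e₁t x t) -
      (d₃ x t + e₃ x t + 2 * (d₁ x t - e₁ x t) * (d₂ x t - e₂ x t)) = 0 := by
  set E : ℝ → ℝ → ℂ := fun x t =>
    Complex.I * (lt x t - mt x t) - (d₂ x t + e₂ x t + (d₁ x t - e₁ x t) ^ 2) with hE
  have hEd (x t : ℝ) : HasDerivAt (fun y => E y t) (Complex.I * (d₁t x t - e₁t x t) -
      (d₃ x t + e₃ x t + 2 * (d₁ x t - e₁ x t) * (d₂ x t - e₂ x t))) x := by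
    have := (((hl.deriv_lt x t).fun_sub (hm.deriv_lt x t)).const_mul Complex.I).fun_sub
      (((hl.deriv₃ x t).fun_add (hm.deriv₃ x t)).fun_add
      (((hl.deriv₂ x t).fun_sub (hm.deriv₂ x t)).fun_pow 2))
    simpa using this
  have hElim (t : ℝ) : Tendsto (fun x => E x t) atTop (𝓝 0) := by
    have := (((hl.lim_t t).sub (hm.lim_t t)).const_mul Complex.I).sub
      (((hl.lim₂ t).add (hm.lim₂ t)).add (((hl.lim₁ t).sub (hm.lim₁ t)).pow 2))
    simpa [hfg] using this
  have hiff : (∀ x t : ℝ, Complex.I * hirotaD 1 0 f g x t - hirotaD 0 2 f g x t = 0) ↔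
      ∀ x t : ℝ, E x t = 0 := by
    refine forall₂_congr fun x t => ?_
    rw [hl.hirota hm hf hg]
    have h0 : f x t * g x t ≠ 0 := by
      rw [hf, hg]; exact mul_ne_zero (Complex.exp_ne_zero _) (Complex.exp_ne_zero _)
    simp [h0, hE]
  rw [hiff]
  constructor
  · intro h x t
    have h1 : (fun y => E y t) = fun _ => 0 := by ext y; exact h y t
    have h2 := hEd x t
    rw [h1] at h2
    exact h2.unique (hasDerivAt_const _ _)
  · intro h x t
    have hconst (y : ℝ) : E y t = E x t :=
      is_const_of_deriv_eq_zero (fun z => (hEd z t).differentiableAt)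
        (fun z => (hEd z t).deriv.trans (h z t)) y x
    have h1 := hElim t
    simp_rw [hconst] at h1
    exact tendsto_nhds_unique tendsto_const_nhds h1

end Pair

lemma tendsto_of_bigORight {S : Set ℂ} {n : ℕ} (hn : n ≠ 0) {a : ℂ → ℂ} (h : BigORight S n a)
    {w : ℂ} (hw : w.re = 0) (hS : ∀ x : ℝ, (x : ℂ) + w ∈ S) :
    Tendsto (fun x : ℝ => a (x + w)) atTop (𝓝 0) := by
  obtain ⟨C, R, hR, h⟩ := h
  have hlim : Tendsto (fun x : ℝ => C / x ^ n) atTop (𝓝 0) :=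
    tendsto_const_nhds.div_atTop (tendsto_pow_atTop hn)
  refine squeeze_zero_norm' ?_ hlim
  filter_upwards [eventually_ge_atTop R] with x hx
  have hre : ((x : ℂ) + w).re = x := by simp [hw]
  have := h _ (hS x) (by rw [hre]; exact hx)
  rwa [hre, abs_of_nonneg (hR.le.trans hx)] at this

lemma im_I_mul_div_two (δ : ℝ) : (Complex.I * δ / 2).im = δ / 2 := by simp

/-- A regular logarithm restricts to a regular logarithm on each boundary line. -/
lemma IsRegularLog.exists_lineLog {δ : ℝ} (hδ : 0 < δ) {F L : ℂ → ℝ → ℂ} {f₁ : ℂ} {fp fm : ℝ → ℂ}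
    (h : IsRegularLog δ F L f₁ fp fm) : ∃ D₁ D₂ D₃ Lt D₁t : ℂ → ℝ → ℂ,
      LineLog (shiftM δ L) (shiftM δ D₁) (shiftM δ D₂) (shiftM δ D₃) (shiftM δ Lt) (shiftM δ D₁t)
        f₁ (deriv fp) ∧
      LineLog (shiftP δ L) (shiftP δ D₁) (shiftP δ D₂) (shiftP δ D₃) (shiftP δ Lt) (shiftP δ D₁t)
        f₁ (deriv fp) ∧
      (∀ t, StripDecay δ fun z => D₃ z t) ∧
      (shiftM δ F = fun x t => Complex.exp (shiftM δ L x t)) ∧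
      (shiftP δ F = fun x t => Complex.exp (shiftP δ L x t)) := by
  obtain ⟨D, Lt, D₁t, h0, hd, hc, ht, h1t, hct, hO⟩ := h.regular
  have line (w : ℂ) (hre : w.re = 0) (him : |w.im| ≤ δ / 2) :
      LineLog (fun x t => L (x + w) t) (fun x t => D 1 (x + w) t) (fun x t => D 2 (x + w) t)
        (fun x t => D 3 (x + w) t) (fun x t => Lt (x + w) t) (fun x t => D₁t (x + w) t)
        f₁ (deriv fp) := by
    have hmem (y : ℝ) : (y : ℂ) + w ∈ closedStrip δ := by simpa [closedStrip] using him
    have hcont (k : ℕ) (hk : k ≤ 3) (t : ℝ) : Continuous fun x : ℝ => D k (x + w) t := by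
      rw [← continuousOn_univ]
      exact (hc k hk t).comp (by fun_prop) fun y _ => hmem y
    have hder (k : ℕ) (hk : k < 3) (x t : ℝ) :
        HasDerivAt (fun y : ℝ => D k (y + w) t) (D (k + 1) (x + w) t) x :=
      hasDerivAt_line hδ (hd k hk t) (hc k hk.le t) (hc (k + 1) hk t) him x
    have hd0 : ∀ x t : ℝ, HasDerivAt (fun y : ℝ => L (y + w) t) (D 1 (x + w) t) x := by
      rw [← h0]; exact hder 0 (by norm_num)
    have hctl : Continuous (Function.uncurry fun (x : ℝ) (t : ℝ) => D₁t (x + w) t) := by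
      rw [← continuousOn_univ]
      exact hct.comp (f := fun p : ℝ × ℝ => ((p.1 : ℂ) + w, p.2)) (by fun_prop)
        fun p _ => ⟨hmem p.1, mem_univ _⟩
    have hlim (a : ℂ → ℂ) (b : ℂ) (n : ℕ) (hn : n ≠ 0)
        (ha : BigORight (closedStrip δ) n fun z => a z - b) :
        Tendsto (fun x : ℝ => a (x + w)) atTop (𝓝 b) := by
      have := (tendsto_of_bigORight hn ha hre hmem).add_const b
      simpa using this
    exact
      { deriv₁ := hd0
        deriv₂ := hder 1 (by norm_num)
        deriv₃ := hder 2 (by norm_num)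
        cont₃ := hcont 3 le_rfl
        deriv_t := fun x t => ht _ (hmem x) t
        deriv₁_t := fun x t => h1t _ (hmem x) t
        deriv_lt := fun x t => hasDerivAt_mixed hd0 (hcont 1 (by norm_num))
          (fun x t => ht _ (hmem x) t) (fun x t => h1t _ (hmem x) t) hctl x t
        lim₁ := fun t => hlim _ _ 2 two_ne_zero (hO t).1
        lim₂ := fun t => hlim (fun z => D 2 z t) 0 2 two_ne_zero (by simpa using (hO t).2.2.1)
        lim_t := fun t => hlim _ _ 1 one_ne_zero (hO t).2.2.2.2.2.2.1 }
  refine ⟨D 1, D 2, D 3, Lt, D₁t, ?_, ?_, fun t => ⟨hc 3 le_rfl t, ?_, ?_⟩, ?_, ?_⟩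
  · have := line (-(Complex.I * δ / 2)) (by simp)
      (by rw [Complex.neg_im, im_I_mul_div_two, abs_neg, abs_of_pos (half_pos hδ)])
    simp only [← sub_eq_add_neg] at this
    exact this
  · exact line (Complex.I * δ / 2) (by simp) (by rw [im_I_mul_div_two, abs_of_pos (half_pos hδ)])
  · have h2 : DifferentiableOn ℂ (fun z => D 2 z t) (strip δ) := fun z hz =>
      (hd 2 (by norm_num) t z hz).differentiableAt.differentiableWithinAt
    exact (h2.deriv (isOpen_strip δ)).congr fun z hz => (hd 2 (by norm_num) t z hz).deriv.symm
  · obtain ⟨C, -, hC⟩ := exists_bound_of_bigO (hc 3 le_rfl t) (hO t).2.2.2.2.1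
      (hO t).2.2.2.2.2.1
    exact ⟨C, hC⟩
  · ext x t; exact h.exp_eq _ (lower_mem_closedStrip hδ x) t
  · ext x t; exact h.exp_eq _ (upper_mem_closedStrip hδ x) t

lemma contDiff_two_of_hasDerivAt {f f₁ f₂ : ℝ → ℂ} (h1 : ∀ x, HasDerivAt f (f₁ x) x)
    (h2 : ∀ x, HasDerivAt f₁ (f₂ x) x) (hc : Continuous f₂) :
    ContDiff ℝ 2 f ∧ iteratedDeriv 2 f = f₂ := by
  have e1 : deriv f = f₁ := funext fun x => (h1 x).deriv
  have e2 : deriv f₁ = f₂ := funext fun x => (h2 x).deriv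
  constructor
  · rw [show (2 : WithTop ℕ∞) = 1 + 1 by norm_num, contDiff_succ_iff_deriv]
    refine ⟨fun x => (h1 x).differentiableAt, by simp, ?_⟩
    rw [e1, contDiff_one_iff_deriv, e2]
    exact ⟨fun x => (h2 x).differentiableAt, hc⟩
  · rw [iteratedDeriv_succ, iteratedDeriv_one, e1, e2]

section Pair

variable {l d₁ d₂ d₃ lt d₁t m e₁ e₂ e₃ mt e₁t : ℝ → ℝ → ℂ} {f₁ : ℂ} {fp' gp' : ℝ → ℂ}

lemma LineLog.logDeriv_div (hl : LineLog l d₁ d₂ d₃ lt d₁t f₁ fp')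
    (hm : LineLog m e₁ e₂ e₃ mt e₁t f₁ gp') {f g : ℝ → ℝ → ℂ}
    (hf : f = fun x t => Complex.exp (l x t)) (hg : g = fun x t => Complex.exp (m x t)) (x t : ℝ) :
    logDeriv (fun y : ℝ => f y t / g y t) x = d₁ x t - e₁ x t := by
  have h1 : (fun y : ℝ => f y t / g y t) = fun y => Complex.exp (l y t - m y t) := by
    ext y; rw [hf, hg, Complex.exp_sub]
  rw [h1, logDeriv_apply, ((hl.deriv₁ x t).fun_sub (hm.deriv₁ x t)).cexp.deriv,
    mul_div_cancel_left₀ _ (Complex.exp_ne_zero _)]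

/-- The derivatives of `w = i(d₁ - e₁)`. -/
lemma LineLog.derivs (hl : LineLog l d₁ d₂ d₃ lt d₁t f₁ fp')
    (hm : LineLog m e₁ e₂ e₃ mt e₁t f₁ gp') {w : ℝ → ℝ → ℂ}
    (hw : w = fun x t => Complex.I * (d₁ x t - e₁ x t)) :
    (∀ t, ContDiff ℝ 2 fun x => w x t) ∧ (∀ x, Differentiable ℝ fun t => w x t) ∧
    (∀ t, dxx w t = fun x => Complex.I * (d₃ x t - e₃ x t)) ∧
    (∀ x t, dx w x t = Complex.I * (d₂ x t - e₂ x t)) ∧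
    (∀ x t, dt w x t = Complex.I * (d₁t x t - e₁t x t)) := by
  subst hw
  have h1 (t x : ℝ) := ((hl.deriv₂ x t).fun_sub (hm.deriv₂ x t)).const_mul Complex.I
  have h2 (t x : ℝ) := ((hl.deriv₃ x t).fun_sub (hm.deriv₃ x t)).const_mul Complex.I
  have h3 (x t : ℝ) := ((hl.deriv₁_t x t).fun_sub (hm.deriv₁_t x t)).const_mul Complex.I
  have hc (t : ℝ) : Continuous fun x => Complex.I * (d₃ x t - e₃ x t) :=
    continuous_const.mul ((hl.cont₃ t).sub (hm.cont₃ t))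
  exact ⟨fun t => (contDiff_two_of_hasDerivAt (h1 t) (h2 t) (hc t)).1,
    fun x t => (h3 x t).differentiableAt,
    fun t => (contDiff_two_of_hasDerivAt (h1 t) (h2 t) (hc t)).2,
    fun x t => (h1 t x).deriv, fun x t => (h3 x t).deriv⟩

end Pair

/-- For admissible `(F, G)`, the bilinear system is equivalent to the non-chiral ILW equation. -/
theorem bilinear_iff_isSolution {δ : ℝ} (hδ : 0 < δ) {F G : ℂ → ℝ → ℂ} (hA : Admissible δ F G) :
    Bilinear δ F G ↔ IsSolution δ (uOf δ F G) (vOf δ F G) := by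
  obtain ⟨LF, LG, f₁, c, fp, fm, gp, gm, hF, hG, hfg⟩ := hA
  have hfg' (t : ℝ) : deriv fp t = deriv gp t := by
    have : fp = fun t => gp t + c := by ext t; rw [← hfg t]; ring
    rw [this, deriv_add_const]
  obtain ⟨P₁, P₂, P₃, Pt, P₁t, hPm, hPp, hP, hFm, hFp⟩ := hF.exists_lineLog hδ
  obtain ⟨Q₁, Q₂, Q₃, Qt, Q₁t, hQm, hQp, hQ, hGm, hGp⟩ := hG.exists_lineLog hδ
  have hu : uOf δ F G = fun x t => Complex.I * (shiftM δ P₁ x t - shiftP δ Q₁ x t) := by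
    ext x t; rw [uOf, hPm.logDeriv_div hQp hFm hGp]
  have hv : vOf δ F G = fun x t => Complex.I * (shiftM δ Q₁ x t - shiftP δ P₁ x t) := by
    ext x t; rw [vOf, hQm.logDeriv_div hPp hGm hFp]
  obtain ⟨u1, u2, u3, u4, u5⟩ := hPm.derivs hQp hu
  obtain ⟨v1, v2, v3, v4, v5⟩ := hQm.derivs hPp hv
  have Tu (t : ℝ) : TExists δ (dxx (uOf δ F G) t) ∧ TtExists δ (dxx (uOf δ F G) t) ∧ ∀ x : ℝ,
      opT δ (dxx (uOf δ F G) t) x + opTt δ (dxx (vOf δ F G) t) x =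
      -(shiftM δ P₃ x t + shiftP δ Q₃ x t) :=
    transforms_of_stripDecay hδ (hP t) (hQ t) (u3 t) (v3 t)
  have Tv (t : ℝ) : TExists δ (dxx (vOf δ F G) t) ∧ TtExists δ (dxx (vOf δ F G) t) ∧ ∀ x : ℝ,
      opT δ (dxx (vOf δ F G) t) x + opTt δ (dxx (uOf δ F G) t) x =
      -(shiftM δ Q₃ x t + shiftP δ P₃ x t) :=
    transforms_of_stripDecay hδ (hQ t) (hP t) (v3 t) (u3 t)
  have hI := Complex.I_sq
  have equ (x t : ℝ) : dt (uOf δ F G) x t + 2 * uOf δ F G x t * dx (uOf δ F G) x t +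
      opT δ (dxx (uOf δ F G) t) x + opTt δ (dxx (vOf δ F G) t) x =
      Complex.I * (shiftM δ P₁t x t - shiftP δ Q₁t x t) - (shiftM δ P₃ x t + shiftP δ Q₃ x t +
      2 * (shiftM δ P₁ x t - shiftP δ Q₁ x t) * (shiftM δ P₂ x t - shiftP δ Q₂ x t)) := by
    rw [add_assoc, (Tu t).2.2 x, u4, u5, hu]
    linear_combination 2 * (shiftM δ P₁ x t - shiftP δ Q₁ x t) *
      (shiftM δ P₂ x t - shiftP δ Q₂ x t) * hI
  have eqv (x t : ℝ) : dt (vOf δ F G) x t - 2 * vOf δ F G x t * dx (vOf δ F G) x t -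
      opT δ (dxx (vOf δ F G) t) x - opTt δ (dxx (uOf δ F G) t) x =
      -(Complex.I * (shiftP δ P₁t x t - shiftM δ Q₁t x t) - (shiftP δ P₃ x t + shiftM δ Q₃ x t +
      2 * (shiftP δ P₁ x t - shiftM δ Q₁ x t) * (shiftP δ P₂ x t - shiftM δ Q₂ x t))) := by
    rw [sub_sub _ (opT _ _ _), (Tv t).2.2 x, v4, v5, hv]
    linear_combination -2 * (shiftP δ P₁ x t - shiftM δ Q₁ x t) *
      (shiftP δ P₂ x t - shiftM δ Q₂ x t) * hI
  have b1 := hPm.bilinear_iff hQp hfg' hFm hGp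
  have b2 := hPp.bilinear_iff hQm hfg' hFp hGm
  rw [Bilinear, b1, b2]
  constructor
  · rintro ⟨h1, h2⟩
    exact
      { contDiff_u := u1
        contDiff_v := v1
        diff_u := u2
        diff_v := v2
        T_u := fun t => (Tu t).1
        T_v := fun t => (Tv t).1
        Tt_u := fun t => (Tu t).2.1
        Tt_v := fun t => (Tv t).2.1
        eq_u := fun x t => (equ x t).trans (h1 x t)
        eq_v := fun x t => (eqv x t).trans (by rw [h2 x t, neg_zero]) }
  · intro h
    refine ⟨fun x t => (equ x t).symm.trans (h.eq_u x t), fun x t => ?_⟩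
    have := (eqv x t).symm.trans (h.eq_v x t)
    exact neg_eq_zero.1 this

/-! ### The kernel `log cosh` -/

/-- The principal logarithm of `cosh`. -/
def logCosh (w : ℂ) : ℂ := Complex.log (Complex.cosh w)

/-- An integrable majorant for `log cosh a - |a| + log 2`. -/
def kerBound (a : ℝ) : ℝ := Real.exp (-|a|) * |a| ^ (-(1 / 2) : ℝ)

lemma kerBound_nonneg (a : ℝ) : 0 ≤ kerBound a := by unfold kerBound; positivity

lemma kerBound_neg (a : ℝ) : kerBound (-a) = kerBound a := by simp [kerBound]

lemma logCosh_neg (w : ℂ) : logCosh (-w) = logCosh w := by simp [logCosh]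

lemma neg_log_one_sub_le {a : ℝ} (ha : 0 < a) : -Real.log (1 - Real.exp (-(2 * a))) ≤ kerBound a := by
  set q := Real.exp (-(2 * a)) with hq
  have hq0 : 0 < q := Real.exp_pos _
  have hq1 : q < 1 := by rw [hq, Real.exp_lt_one_iff]; linarith
  have h1 : 0 < 1 - q := by linarith
  set t := Real.sqrt (1 - q) with ht
  have ht0 : 0 < t := Real.sqrt_pos.2 h1
  have ht2 : t ^ 2 = 1 - q := Real.sq_sqrt h1.le
  have ht1 : t < 1 := by nlinarith
  -- `-log (1 - q) ≤ q / √(1 - q)`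
  have key : -Real.log (1 - q) ≤ q / t := by
    have hs : Real.log t⁻¹ ≤ Real.sinh (Real.log t⁻¹) :=
      Real.self_le_sinh_iff.2 (Real.log_nonneg (one_le_inv_iff₀.2 ⟨ht0, ht1.le⟩))
    rw [Real.sinh_log (inv_pos.2 ht0), inv_inv, Real.log_inv] at hs
    rw [← ht2, Real.log_pow]
    have : (t⁻¹ - t) = q / t := by field_simp; linarith
    push_cast
    linarith
  refine key.trans ?_
  -- `q / t ≤ exp (-a) a^{-1/2}`
  rw [kerBound, abs_of_pos ha, Real.rpow_neg ha.le, ← Real.sqrt_eq_rpow, ← div_eq_mul_inv,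
    div_le_div_iff₀ ht0 (Real.sqrt_pos.2 ha)]
  have e1 : q = Real.exp (-a) * Real.exp (-a) := by rw [hq, ← Real.exp_add]; congr 1; ring
  have e2 : Real.exp (-a) * Real.sqrt a ≤ t := by
    rw [ht]
    apply Real.le_sqrt_of_sq_le
    rw [mul_pow, Real.sq_sqrt ha.le]
    have e3 : Real.exp (-a) ^ 2 = q := by rw [e1, sq]
    rw [e3]
    have e4 : (1 + 2 * a) * q ≤ 1 := by
      have := Real.add_one_le_exp (2 * a)
      have e5 : Real.exp (2 * a) * q = 1 := by rw [hq, ← Real.exp_add]; simp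
      nlinarith
    nlinarith
  rw [e1, mul_assoc]
  exact mul_le_mul_of_nonneg_left e2 (Real.exp_pos _).le

lemma norm_log_one_add_le_neg_log {z : ℂ} (hz : ‖z‖ < 1) :
    ‖Complex.log (1 + z)‖ ≤ -Real.log (1 - ‖z‖) := by
  have h1 := Complex.hasSum_taylorSeries_neg_log (z := -z) (by simpa using hz)
  have h2 := Real.hasSum_pow_div_log_of_abs_lt_one (x := ‖z‖) (by simpa using hz)
  have h3 : HasSum (fun n : ℕ => ‖(-z) ^ n / n‖) (-Real.log (1 - ‖z‖)) := by
    rw [← hasSum_nat_add_iff' 1]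
    have h4 (n : ℕ) : ‖(n : ℂ) + 1‖ = n + 1 := by exact_mod_cast Complex.norm_natCast (n + 1)
    simpa [h4] using h2
  rw [sub_neg_eq_add] at h1
  rw [← norm_neg, ← h1.tsum_eq, ← h3.tsum_eq]
  exact norm_tsum_le_tsum_norm h3.summable

/-- `log cosh w = w - log 2 + o(1)` in the right half of the strip `|Im w| ≤ π/2`. -/
lemma norm_logCosh_sub_le {w : ℂ} (him : |w.im| ≤ π / 2) (hre : 0 < w.re) :
    ‖logCosh w - (w - Real.log 2)‖ ≤ kerBound w.re := by
  have hn : ‖Complex.exp (-(2 * w))‖ = Real.exp (-(2 * w.re)) := by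
    rw [Complex.norm_exp]; simp
  have hlt : ‖Complex.exp (-(2 * w))‖ < 1 := by
    rw [hn, Real.exp_lt_one_iff]; linarith
  have hpos : 0 < (1 + Complex.exp (-(2 * w))).re := by
    have := Complex.abs_re_le_norm (Complex.exp (-(2 * w)))
    have := neg_abs_le (Complex.exp (-(2 * w))).re
    simp only [Complex.add_re, Complex.one_re]; linarith
  have hne : 1 + Complex.exp (-(2 * w)) ≠ 0 := by
    intro h; rw [h] at hpos; simp at hpos
  have harg : |(Complex.log (1 + Complex.exp (-(2 * w)))).im| < π / 2 := by
    rw [Complex.log_im]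
    exact Complex.abs_arg_lt_pi_div_two_iff.2 (Or.inl hpos)
  have e : Complex.cosh w =
      Complex.exp (w - Real.log 2 + Complex.log (1 + Complex.exp (-(2 * w)))) := by
    rw [Complex.exp_add, Complex.exp_sub, Complex.exp_log hne, ← Complex.ofReal_exp,
      Real.exp_log two_pos, Complex.cosh]
    have : Complex.exp (-w) = Complex.exp w * Complex.exp (-(2 * w)) := by
      rw [← Complex.exp_add]; congr 1; ring
    rw [this]; push_cast; ring
  have him' : (w - Real.log 2 + Complex.log (1 + Complex.exp (-(2 * w)))).im =
      w.im + (Complex.log (1 + Complex.exp (-(2 * w)))).im := by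
    simp only [Complex.add_im, Complex.sub_im, Complex.ofReal_im, sub_zero]
  rw [abs_le] at him
  rw [abs_lt] at harg
  rw [logCosh, e, Complex.log_exp (by rw [him']; linarith) (by rw [him']; linarith),
    add_sub_cancel_left]
  refine (norm_log_one_add_le_neg_log hlt).trans ?_
  rw [hn]
  exact neg_log_one_sub_le hre

lemma cosh_mem_slitPlane {w : ℂ} (him : |w.im| ≤ π / 2) (h : w.re ≠ 0 ∨ |w.im| < π / 2) :
    Complex.cosh w ∈ Complex.slitPlane := by
  rw [Complex.mem_slitPlane_iff, cosh_re_im]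
  simp only [Complex.add_re, Complex.ofReal_re, Complex.re_ofReal_mul, Complex.I_re, mul_zero,
    add_zero, Complex.add_im, Complex.ofReal_im, Complex.im_ofReal_mul, Complex.I_im, mul_one,
    zero_add]
  have hc := Real.cosh_pos w.re
  rcases lt_or_eq_of_le him with h1 | h1
  · left
    rw [abs_lt] at h1
    exact mul_pos hc (Real.cos_pos_of_mem_Ioo h1)
  · right
    have h2 : w.re ≠ 0 := by
      rcases h with h | h
      · exact h
      · exact absurd h1 h.ne
    refine mul_ne_zero (by simpa using h2) ?_
    rcases (abs_eq (by positivity)).1 h1 with h3 | h3 <;> simp [h3]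

lemma continuousAt_logCosh {w : ℂ} (him : |w.im| ≤ π / 2) (h : w.re ≠ 0 ∨ |w.im| < π / 2) :
    ContinuousAt logCosh w :=
  (Complex.continuous_cosh.continuousAt).clog (cosh_mem_slitPlane him h)

lemma hasDerivAt_logCosh {w : ℂ} (him : |w.im| < π / 2) :
    HasDerivAt logCosh (Complex.tanh w) w := by
  rw [Complex.tanh_eq_sinh_div_cosh]
  exact (Complex.hasDerivAt_cosh w).clog (cosh_mem_slitPlane him.le (Or.inr him))

lemma measurable_logCosh : Measurable logCosh :=
  Complex.measurable_log.comp Complex.continuous_cosh.measurable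

lemma cosh_ofReal_add_I (a : ℝ) :
    Complex.cosh (a + π / 2 * Complex.I) = (Real.sinh a : ℝ) * Complex.I := by
  rw [cosh_re_im]
  have : ((a : ℂ) + π / 2 * Complex.I).im = π / 2 := by simp
  have h2 : ((a : ℂ) + π / 2 * Complex.I).re = a := by simp
  rw [this, h2]; simp

lemma logCosh_upper_of_pos {a : ℝ} (ha : 0 < a) :
    logCosh (a + π / 2 * Complex.I) = (Real.log (Real.sinh a) : ℝ) + π / 2 * Complex.I := by
  rw [logCosh, cosh_ofReal_add_I, Complex.log_ofReal_mul (Real.sinh_pos_iff.2 ha) Complex.I_ne_zero,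
    Complex.log_I]

lemma logCosh_upper_of_neg {a : ℝ} (ha : a < 0) :
    logCosh (a + π / 2 * Complex.I) = (Real.log (Real.sinh a) : ℝ) - π / 2 * Complex.I := by
  have : (Real.sinh a : ℝ) * Complex.I = (Real.sinh (-a) : ℝ) * (-Complex.I) := by
    rw [Real.sinh_neg]; push_cast; ring
  rw [logCosh, cosh_ofReal_add_I, this,
    Complex.log_ofReal_mul (Real.sinh_pos_iff.2 (neg_pos.2 ha)) (neg_ne_zero.2 Complex.I_ne_zero),
    Complex.log_neg_I, Real.sinh_neg, Real.log_neg_eq_log]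
  ring

lemma logCosh_lower (a : ℝ) :
    logCosh (a - π / 2 * Complex.I) = logCosh ((-a : ℝ) + π / 2 * Complex.I) := by
  rw [← logCosh_neg]; congr 1; push_cast; ring

/-- The sum of the boundary values of `log cosh`. -/
lemma logCosh_upper_add_lower {a : ℝ} (ha : a ≠ 0) :
    logCosh (a + π / 2 * Complex.I) + logCosh (a - π / 2 * Complex.I) =
      2 * (Real.log (Real.sinh a) : ℝ) := by
  rw [logCosh_lower]
  rcases lt_or_gt_of_ne ha with h | h
  · rw [logCosh_upper_of_neg h, logCosh_upper_of_pos (neg_pos.2 h), Real.sinh_neg,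
      Real.log_neg_eq_log]; ring
  · rw [logCosh_upper_of_pos h, logCosh_upper_of_neg (neg_lt_zero.2 h), Real.sinh_neg,
      Real.log_neg_eq_log]; ring

/-- The jump of the boundary values of `log cosh`. -/
lemma logCosh_upper_sub_lower {a : ℝ} (ha : a ≠ 0) :
    logCosh (a + π / 2 * Complex.I) - logCosh (a - π / 2 * Complex.I) =
      (SignType.sign a : ℝ) * (π * Complex.I) := by
  rw [logCosh_lower]
  rcases lt_or_gt_of_ne ha with h | h
  · rw [logCosh_upper_of_neg h, logCosh_upper_of_pos (neg_pos.2 h), Real.sinh_neg,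
      Real.log_neg_eq_log, sign_neg h]; simp only [SignType.coe_neg_one, Complex.ofReal_neg, Complex.ofReal_one]; ring
  · rw [logCosh_upper_of_pos h, logCosh_upper_of_neg (neg_lt_zero.2 h), Real.sinh_neg,
      Real.log_neg_eq_log, sign_pos h]; simp only [SignType.coe_one, Complex.ofReal_one]; ring

lemma logCosh_ofReal (a : ℝ) : logCosh a = (Real.log (Real.cosh a) : ℝ) := by
  rw [logCosh, ← Complex.ofReal_cosh, ← Complex.ofReal_log (Real.cosh_pos a).le]

lemma norm_logCosh_le {w : ℂ} (him : |w.im| ≤ π / 2) (hre : w.re ≠ 0) :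
    ‖logCosh w‖ ≤ |w.re| + 3 + kerBound w.re := by
  have key {w : ℂ} (him : |w.im| ≤ π / 2) (hre : 0 < w.re) :
      ‖logCosh w‖ ≤ |w.re| + 3 + kerBound w.re := by
    have h1 := norm_logCosh_sub_le him hre
    have h2 : ‖w - Real.log 2‖ ≤ |w.re| + 3 := by
      refine (norm_sub_le _ _).trans ?_
      have := Complex.norm_le_abs_re_add_abs_im w
      have h3 : ‖((Real.log 2 : ℝ) : ℂ)‖ ≤ 1 := by
        rw [Complex.norm_real, Real.norm_of_nonneg (Real.log_nonneg one_le_two)]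
        linarith [Real.log_two_lt_d9]
      linarith [Real.pi_lt_four]
    calc ‖logCosh w‖ = ‖(w - Real.log 2) + (logCosh w - (w - Real.log 2))‖ := by
          congr 1; ring
      _ ≤ _ := (norm_add_le _ _).trans (by linarith)
  rcases lt_or_gt_of_ne hre with h | h
  · have := key (w := -w) (by simpa using him) (by simpa using h)
    rwa [logCosh_neg, Complex.neg_re, abs_neg, kerBound_neg] at this
  · exact key him h

/-- The kernel `log |tanh a|`. -/
def logTanh (a : ℝ) : ℝ := Real.log (Real.sinh a) - Real.log (Real.cosh a)

lemma abs_log_sinh_sub_le {a : ℝ} (ha : a ≠ 0) :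
    |Real.log (Real.sinh a) - (|a| - Real.log 2)| ≤ kerBound a := by
  have key {a : ℝ} (ha : 0 < a) : |Real.log (Real.sinh a) - (a - Real.log 2)| ≤ kerBound a := by
    have h1 := norm_logCosh_sub_le (w := a + π / 2 * Complex.I)
      (by simp [abs_of_pos (half_pos Real.pi_pos)]) (by simpa using ha)
    have h2 : (logCosh (a + π / 2 * Complex.I) - (a + π / 2 * Complex.I - Real.log 2)) =
        ((Real.log (Real.sinh a) - (a - Real.log 2) : ℝ) : ℂ) := by
      rw [logCosh_upper_of_pos ha]; push_cast; ring
    rw [h2, Complex.norm_real] at h1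
    simpa using h1
  rcases lt_or_gt_of_ne ha with h | h
  · have := key (neg_pos.2 h)
    rwa [Real.sinh_neg, Real.log_neg_eq_log, ← abs_of_neg h, kerBound, abs_abs] at this
  · have := key h
    rwa [abs_of_pos h]

lemma abs_log_cosh_sub_le {a : ℝ} (ha : a ≠ 0) :
    |Real.log (Real.cosh a) - (|a| - Real.log 2)| ≤ kerBound a := by
  have h1 := norm_logCosh_sub_le (w := (|a| : ℝ)) (by simp; positivity) (by simpa using ha)
  rw [logCosh_ofReal, Real.cosh_abs, ← Complex.ofReal_sub, ← Complex.ofReal_sub,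
    Complex.norm_real, Complex.ofReal_re] at h1
  rwa [kerBound, abs_abs] at h1

lemma abs_logTanh_le {a : ℝ} (ha : a ≠ 0) : |logTanh a| ≤ 2 * kerBound a := by
  have h1 := abs_log_sinh_sub_le ha
  have h2 := abs_log_cosh_sub_le ha
  rw [abs_le] at h1 h2 ⊢
  unfold logTanh
  constructor <;> linarith [h1.1, h1.2, h2.1, h2.2]

/-! ### Integrability of the kernels -/

lemma integrable_kerBound_mul : Integrable fun a : ℝ => kerBound a * (1 + |a|) ^ 3 := by
  have h0 (s : ℝ) (hs : 0 < s) := Real.GammaIntegral_convergent hs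
  have h1 : IntegrableOn (fun a : ℝ => kerBound a * (1 + |a|) ^ 3) (Ioi 0) := by
    have h2 := (((h0 (1 / 2) (by norm_num)).add ((h0 (3 / 2) (by norm_num)).const_mul 3)).add
      ((h0 (5 / 2) (by norm_num)).const_mul 3)).add (h0 (7 / 2) (by norm_num))
    refine h2.congr_fun (fun a ha => ?_) measurableSet_Ioi
    have ha : 0 < a := ha
    simp only [Pi.add_apply]
    have p (n : ℕ) : a ^ (-(1 / 2) + n : ℝ) = a ^ (-(1 / 2) : ℝ) * a ^ n := by
      rw [Real.rpow_add ha, Real.rpow_natCast]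
    have p0 := p 0
    have p1 := p 1
    have p2 := p 2
    have p3 := p 3
    norm_num at p0 p1 p2 p3
    rw [kerBound, abs_of_pos ha]
    norm_num
    rw [p1, p2, p3]; ring
  have h3 : IntegrableOn (fun a : ℝ => kerBound a * (1 + |a|) ^ 3) (Iic 0) := by
    rw [integrableOn_Iic_iff_integrableOn_Iio]
    have := (Measure.measurePreserving_neg (volume : Measure ℝ)).integrableOn_comp_preimage
      (Homeomorph.neg ℝ).measurableEmbedding (f := fun a : ℝ => kerBound a * (1 + |a|) ^ 3)
      (s := Ioi 0)
    have h4 := this.2 h1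
    simpa [Function.comp_def, kerBound_neg] using h4
  rw [← integrableOn_univ, ← Iic_union_Ioi (a := (0 : ℝ))]
  exact h3.union h1

lemma integrable_kerBound_comp {c : ℝ} (hc : 0 < c) :
    Integrable fun s : ℝ => kerBound (c * s) * (1 + |s|) ^ 3 := by
  have h1 := (integrable_kerBound_mul.comp_mul_left' hc.ne').const_mul ((1 + 1 / c) ^ 3)
  refine h1.mono' ?_ (ae_of_all _ fun s => ?_)
  · have : Measurable kerBound := by
      unfold kerBound
      fun_prop
    exact ((this.comp (measurable_const_mul c)).mul (by fun_prop)).aestronglyMeasurable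
  · have hk := kerBound_nonneg (c * s)
    rw [Real.norm_of_nonneg (by positivity)]
    have h2 : 1 + |s| ≤ (1 + 1 / c) * (1 + |c * s|) := by
      rw [abs_mul, abs_of_pos hc]
      have : (1 + 1 / c) * (1 + c * |s|) = 1 + |s| + (1 / c + c * |s|) := by field_simp; ring
      rw [this]
      have : 0 ≤ 1 / c + c * |s| := by positivity
      linarith
    calc kerBound (c * s) * (1 + |s|) ^ 3
        ≤ kerBound (c * s) * ((1 + 1 / c) * (1 + |c * s|)) ^ 3 := by gcongr
      _ = _ := by ring

lemma integrable_inv_one_add_abs_sq : Integrable fun s : ℝ => ((1 + |s|) ^ 2)⁻¹ := by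
  refine integrable_inv_one_add_sq.mono' ?_ (ae_of_all _ fun s => ?_)
  · have : Continuous fun s : ℝ => ((1 + |s|) ^ 2)⁻¹ :=
      Continuous.inv₀ (by fun_prop) fun s => by positivity
    exact this.aestronglyMeasurable
  · rw [Real.norm_of_nonneg (by positivity)]
    gcongr
    nlinarith [abs_nonneg s, sq_abs s]

/-! ### Cubic decay and integral kernels -/

/-- `‖g x‖ ≤ C / (1 + |x|)³`. -/
def Dec (C : ℝ) (g : ℝ → ℂ) : Prop := ∀ x, ‖g x‖ ≤ C / (1 + |x|) ^ 3

/-- Cubic decay in `x`, locally uniformly in `t`. -/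
def LocDec (g : ℝ → ℝ → ℂ) : Prop := ∀ T : ℝ, ∃ C : ℝ, ∀ t : ℝ, |t| ≤ T → Dec C fun x => g x t

lemma LocDec.dec {g : ℝ → ℝ → ℂ} (h : LocDec g) (t : ℝ) : ∃ C, Dec C fun x => g x t := by
  obtain ⟨C, hC⟩ := h |t|
  exact ⟨C, hC t le_rfl⟩

lemma Dec.nonneg {C : ℝ} {g : ℝ → ℂ} (h : Dec C g) : 0 ≤ C := by
  have := (norm_nonneg _).trans (h 0)
  simpa using this

lemma Dec.le_const {C : ℝ} {g : ℝ → ℂ} (h : Dec C g) (x : ℝ) : ‖g x‖ ≤ C :=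
  (h x).trans (div_le_self h.nonneg (one_le_pow₀ (by linarith [abs_nonneg x])))

lemma Dec.shift {C : ℝ} {g : ℝ → ℂ} (h : Dec C g) (x s : ℝ) :
    ‖g (x + s)‖ ≤ C * (1 + |s|) ^ 3 / (1 + |x|) ^ 3 := by
  refine (h (x + s)).trans ?_
  have h0 := h.nonneg
  rw [div_le_div_iff₀ (by positivity) (by positivity), mul_assoc, ← mul_pow]
  gcongr
  have h1 : |x| ≤ |x + s| + |s| := by
    have := abs_sub (x + s) s
    rwa [add_sub_cancel_right] at this
  nlinarith [abs_nonneg s, abs_nonneg (x + s), mul_nonneg (abs_nonneg s) (abs_nonneg (x + s))]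

lemma Dec.comp_neg {C : ℝ} {g : ℝ → ℂ} (h : Dec C g) : Dec C fun x => g (-x) := fun x => by
  simpa using h (-x)

lemma Dec.integrable {C : ℝ} {g : ℝ → ℂ} (h : Dec C g) (hg : Continuous g) : Integrable g := by
  refine (integrable_inv_one_add_abs_sq.const_mul C).mono' hg.aestronglyMeasurable
    (ae_of_all _ fun x => (h x).trans ?_)
  rw [div_eq_mul_inv]
  have h0 := h.nonneg
  gcongr 2
  exact pow_le_pow_right₀ (by linarith [abs_nonneg x]) (by norm_num)

lemma Dec.add {C C' : ℝ} {g g' : ℝ → ℂ} (h : Dec C g) (h' : Dec C' g') :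
    Dec (C + C') fun x => g x + g' x := fun x =>
  (norm_add_le _ _).trans (by rw [add_div]; exact add_le_add (h x) (h' x))

lemma Dec.const_mul {C : ℝ} {g : ℝ → ℂ} (h : Dec C g) (a : ℂ) : Dec (‖a‖ * C) fun x => a * g x :=
  fun x => by
    rw [norm_mul, mul_div_assoc]
    exact mul_le_mul_of_nonneg_left (h x) (norm_nonneg _)

lemma LocDec.add {g g' : ℝ → ℝ → ℂ} (h : LocDec g) (h' : LocDec g') :
    LocDec fun x t => g x t + g' x t := fun T => by
  obtain ⟨C, hC⟩ := h T
  obtain ⟨C', hC'⟩ := h' T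
  exact ⟨C + C', fun t ht => (hC t ht).add (hC' t ht)⟩

lemma LocDec.const_mul {g : ℝ → ℝ → ℂ} (h : LocDec g) (a : ℂ) :
    LocDec fun x t => a * g x t := fun T => by
  obtain ⟨C, hC⟩ := h T
  exact ⟨_, fun t ht => (hC t ht).const_mul a⟩

lemma LocDec.const {C : ℝ} {g : ℝ → ℂ} (h : Dec C g) : LocDec fun x _ => g x :=
  fun _ => ⟨C, fun _ _ => h⟩

/-- Kernels which may be integrated against functions of cubic decay. -/
structure LightKer (k : ℝ → ℂ) : Prop where
  meas : Measurable k
  integrable : Integrable fun s => ‖k s‖ / (1 + |s|) ^ 3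

lemma LightKer.integrable_mul {k : ℝ → ℂ} (hk : LightKer k) {g : ℝ → ℂ} {C : ℝ}
    (hg : Continuous g) (h : Dec C g) : Integrable fun s => k s * g s := by
  refine (hk.integrable.const_mul C).mono'
    (hk.meas.aestronglyMeasurable.mul hg.aestronglyMeasurable) (ae_of_all _ fun s => ?_)
  rw [norm_mul]
  calc ‖k s‖ * ‖g s‖ ≤ ‖k s‖ * (C / (1 + |s|) ^ 3) := by gcongr; exact h s
    _ = _ := by ring

lemma LightKer.hasDerivAt {k : ℝ → ℂ} (hk : LightKer k) {g g' : ℝ → ℝ → ℂ}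
    (hc : ∀ t, Continuous fun x => g x t) (hc' : ∀ t, Continuous fun x => g' x t)
    (hd : LocDec g) (hd' : LocDec g') (hder : ∀ x t, HasDerivAt (fun s => g x s) (g' x t) t)
    (t : ℝ) : HasDerivAt (fun t => ∫ s, k s * g s t) (∫ s, k s * g' s t) t := by
  obtain ⟨C, hC⟩ := hd' (|t| + 1)
  obtain ⟨C₁, hC₁⟩ := hd.dec t
  refine (hasDerivAt_integral_of_dominated_loc_of_deriv_le (F := fun t s => k s * g s t)
    (F' := fun t s => k s * g' s t) (x₀ := t) (s := Metric.ball t 1)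
    (bound := fun s => C * (‖k s‖ / (1 + |s|) ^ 3)) (Metric.ball_mem_nhds t one_pos)
    (Eventually.of_forall fun t => hk.meas.aestronglyMeasurable.mul (hc t).aestronglyMeasurable)
    (hk.integrable_mul (hc t) hC₁)
    (hk.meas.aestronglyMeasurable.mul (hc' t).aestronglyMeasurable)
    (ae_of_all _ fun s y hy => ?_) (hk.integrable.const_mul C)
    (ae_of_all _ fun s y _ => (hder s y).const_mul _)).2
  have hy' : |y| ≤ |t| + 1 := by
    have h1 : |y - t| < 1 := by simpa [Real.dist_eq] using hy
    have h2 := abs_sub_abs_le_abs_sub y t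
    linarith
  rw [norm_mul]
  calc ‖k s‖ * ‖g' s y‖ ≤ ‖k s‖ * (C / (1 + |s|) ^ 3) := by gcongr; exact hC y hy' s
    _ = _ := by ring

/-- Kernels whose convolutions preserve cubic decay. -/
structure HeavyKer (k : ℝ → ℂ) : Prop where
  meas : Measurable k
  integrable : Integrable fun s => ‖k s‖ * (1 + |s|) ^ 3

lemma HeavyKer.integrable_norm {k : ℝ → ℂ} (hk : HeavyKer k) : Integrable fun s => ‖k s‖ := by
  refine hk.integrable.mono' hk.meas.norm.aestronglyMeasurable (ae_of_all _ fun s => ?_)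
  rw [norm_norm]
  exact le_mul_of_one_le_right (norm_nonneg _) (one_le_pow₀ (by linarith [abs_nonneg s]))

lemma HeavyKer.lightKer_shift {k : ℝ → ℂ} (hk : HeavyKer k) (x : ℝ) :
    LightKer fun s => k (s - x) := by
  refine ⟨hk.meas.comp (measurable_sub_const x), ?_⟩
  have hm : Measurable fun s => ‖k (s - x)‖ / (1 + |s|) ^ 3 :=
    (hk.meas.comp (measurable_sub_const x)).norm.div (by fun_prop)
  refine (hk.integrable_norm.comp_sub_right x).mono' hm.aestronglyMeasurable
    (ae_of_all _ fun s => ?_)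
  rw [Real.norm_of_nonneg (by positivity)]
  exact div_le_self (norm_nonneg _) (one_le_pow₀ (by linarith [abs_nonneg s]))

/-- The convolution `∫ k(s) g(x+s) ds`. -/
def conv (k : ℝ → ℂ) (g : ℝ → ℂ) (x : ℝ) : ℂ := ∫ s, k s * g (x + s)

lemma conv_eq (k g : ℝ → ℂ) (x : ℝ) : conv k g x = ∫ s, k (s - x) * g s := by
  rw [conv, ← integral_add_left_eq_self (fun s => k (s - x) * g s) x]
  simp

lemma norm_integral_shift_le {k : ℝ → ℝ} (hk : Integrable fun s => k s * (1 + |s|) ^ 3)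
    (hk0 : ∀ s, 0 ≤ k s) {R g : ℝ → ℂ} {x C : ℝ} (h : Dec C g)
    (hR : ∀ᵐ s, ‖R s‖ ≤ k (s - x)) :
    ‖∫ s, R s * g s‖ ≤ C * (∫ s, k s * (1 + |s|) ^ 3) / (1 + |x|) ^ 3 := by
  have h1 : ‖∫ s, R s * g s‖ ≤ ∫ s, (C / (1 + |x|) ^ 3) * (k (s - x) * (1 + |s - x|) ^ 3) := by
    refine norm_integral_le_of_norm_le ((hk.comp_sub_right x).const_mul _) ?_
    filter_upwards [hR] with s hs
    have h2 := h.shift x (s - x)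
    rw [add_sub_cancel] at h2
    rw [norm_mul]
    calc ‖R s‖ * ‖g s‖ ≤ k (s - x) * (C * (1 + |s - x|) ^ 3 / (1 + |x|) ^ 3) :=
          mul_le_mul hs h2 (norm_nonneg _) (hk0 _)
      _ = _ := by ring
  rw [integral_const_mul, integral_sub_right_eq_self (fun s => k s * (1 + |s|) ^ 3) x] at h1
  rw [mul_div_right_comm]
  exact h1

lemma HeavyKer.dec_conv {k : ℝ → ℂ} (hk : HeavyKer k) {g : ℝ → ℂ} {C : ℝ} (h : Dec C g) :
    Dec (C * ∫ s, ‖k s‖ * (1 + |s|) ^ 3) (conv k g) := fun x => by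
  rw [conv_eq]
  exact norm_integral_shift_le hk.integrable (fun _ => norm_nonneg _) h (ae_of_all _ fun s => le_rfl)

lemma HeavyKer.locDec_conv {k : ℝ → ℂ} (hk : HeavyKer k) {g : ℝ → ℝ → ℂ} (h : LocDec g) :
    LocDec fun x t => conv k (fun y => g y t) x := fun T => by
  obtain ⟨C, hC⟩ := h T
  exact ⟨_, fun t ht => hk.dec_conv (hC t ht)⟩

lemma HeavyKer.continuous_conv {k : ℝ → ℂ} (hk : HeavyKer k) {g : ℝ → ℝ → ℂ}
    (hg : Continuous (Function.uncurry g)) (h : LocDec g) :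
    Continuous (Function.uncurry fun x t => conv k (fun y => g y t) x) := by
  rw [continuous_iff_continuousAt]
  rintro ⟨x₀, t₀⟩
  obtain ⟨C, hC⟩ := h (|t₀| + 1)
  refine continuousAt_of_dominated (F := fun (p : ℝ × ℝ) s => k s * g (p.1 + s) p.2)
    (bound := fun s => ‖k s‖ * C) (Eventually.of_forall fun p => ?_) ?_
    (hk.integrable_norm.mul_const C) (ae_of_all _ fun s => ?_)
  · have : Continuous fun s => g (p.1 + s) p.2 :=
      hg.comp (by fun_prop : Continuous fun s : ℝ => (p.1 + s, p.2))
    exact hk.meas.aestronglyMeasurable.mul this.aestronglyMeasurable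
  · have h1 : ∀ᶠ p : ℝ × ℝ in 𝓝 (x₀, t₀), |p.2| < |t₀| + 1 :=
      (continuous_abs.comp continuous_snd).continuousAt.eventually (gt_mem_nhds (by simp))
    filter_upwards [h1] with p hp
    refine ae_of_all _ fun s => ?_
    rw [norm_mul]
    gcongr
    exact (hC p.2 hp.le).le_const _
  · have : Continuous fun p : ℝ × ℝ => g (p.1 + s) p.2 :=
      hg.comp (by fun_prop : Continuous fun p : ℝ × ℝ => (p.1 + s, p.2))
    exact (continuous_const.mul this).continuousAt

lemma HeavyKer.hasDerivAt_conv {k : ℝ → ℂ} (hk : HeavyKer k) {g g' : ℝ → ℂ} {C C' : ℝ}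
    (hc : Continuous g) (hc' : Continuous g') (hd : Dec C g) (hd' : Dec C' g')
    (hder : ∀ x, HasDerivAt g (g' x) x) (x : ℝ) : HasDerivAt (conv k g) (conv k g' x) x := by
  refine (hasDerivAt_integral_of_dominated_loc_of_deriv_le (F := fun x s => k s * g (x + s))
    (F' := fun x s => k s * g' (x + s)) (x₀ := x) (s := univ)
    (bound := fun s => ‖k s‖ * C') univ_mem
    (Eventually.of_forall fun x => hk.meas.aestronglyMeasurable.mul
      (hc.comp (continuous_const.add continuous_id)).aestronglyMeasurable) ?_
    (hk.meas.aestronglyMeasurable.mul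
      (hc'.comp (continuous_const.add continuous_id)).aestronglyMeasurable)
    (ae_of_all _ fun s y _ => ?_) (hk.integrable_norm.mul_const C')
    (ae_of_all _ fun s y _ => ?_)).2
  · refine (hk.integrable_norm.mul_const C).mono' (hk.meas.aestronglyMeasurable.mul
      (hc.comp (continuous_const.add continuous_id)).aestronglyMeasurable) (ae_of_all _ fun s => ?_)
    rw [norm_mul]
    gcongr
    exact hd.le_const _
  · rw [norm_mul]
    gcongr
    exact hd'.le_const _
  · have := (hder (y + s)).comp_add_const y s
    exact this.const_mul _

lemma HeavyKer.hasDerivAt_conv_t {k : ℝ → ℂ} (hk : HeavyKer k) {g g' : ℝ → ℝ → ℂ}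
    (hc : ∀ t, Continuous fun x => g x t) (hc' : ∀ t, Continuous fun x => g' x t)
    (hd : LocDec g) (hd' : LocDec g') (hder : ∀ x t, HasDerivAt (fun s => g x s) (g' x t) t)
    (x t : ℝ) : HasDerivAt (fun t => conv k (fun y => g y t) x) (conv k (fun y => g' y t) x) t := by
  simp_rw [conv_eq]
  exact (hk.lightKer_shift x).hasDerivAt hc hc' hd hd' hder t

lemma tendsto_zero_of_dec {C : ℝ} {g : ℝ → ℂ} (h : Dec C g) :
    Tendsto g atTop (𝓝 0) ∧ Tendsto g atBot (𝓝 0) := by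
  have key {l : Filter ℝ} (hl : Tendsto (fun x : ℝ => |x|) l atTop) : Tendsto g l (𝓝 0) := by
    refine squeeze_zero_norm h ?_
    exact tendsto_const_nhds.div_atTop ((tendsto_pow_atTop three_ne_zero).comp
      (tendsto_atTop_add_const_left _ _ hl))
  exact ⟨key tendsto_abs_atTop_atTop, key tendsto_abs_atBot_atTop⟩

lemma integral_deriv_eq_zero {C C' : ℝ} {g g' : ℝ → ℂ} (hder : ∀ x, HasDerivAt g (g' x) x)
    (hd : Dec C g) (hc' : Continuous g') (hd' : Dec C' g') : ∫ x, g' x = 0 := by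
  have := integral_of_hasDerivAt_of_tendsto hder (hd'.integrable hc') (tendsto_zero_of_dec hd).2
    (tendsto_zero_of_dec hd).1
  simpa using this

lemma HeavyKer.integral_conv_deriv {k : ℝ → ℂ} (hk : HeavyKer k) {C C' : ℝ} {g g' : ℝ → ℂ}
    (hder : ∀ x, HasDerivAt g (g' x) x) (hd : Dec C g) (hc' : Continuous g') (hd' : Dec C' g') :
    ∫ x, conv k g' x = 0 := by
  have hk1 : Integrable k := (integrable_norm_iff hk.meas.aestronglyMeasurable).1 hk.integrable_norm
  have hg1 : Integrable g' := hd'.integrable hc'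
  have hi : Integrable (Function.uncurry fun x s => k s * g' (x + s)) (volume.prod volume) := by
    have h1 : Integrable (fun p : ℝ × ℝ => k p.1 * g' p.2) (volume.prod volume) := hk1.mul_prod hg1
    have h2 := (measurePreserving_prod_add (volume : Measure ℝ) (volume : Measure ℝ)).integrable_comp
      (g := fun p : ℝ × ℝ => k p.1 * g' p.2) h1.aestronglyMeasurable
    have h3 := (h2.2 h1).swap
    refine h3.congr (ae_of_all _ fun p => ?_)
    simp [Function.uncurry, add_comm]
  simp only [conv]
  rw [integral_integral_swap hi]
  have : ∀ s, ∫ x, k s * g' (x + s) = 0 := fun s => by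
    rw [integral_const_mul, integral_add_right_eq_self g' s,
      integral_deriv_eq_zero hder hd hc' hd', mul_zero]
  simp [this]

/-! ### The logarithmic potential on the strip -/

/-- The argument `π(s - z)/δ` of the kernels. -/
def karg (δ : ℝ) (z : ℂ) (s : ℝ) : ℂ := (π : ℂ) * ((s : ℂ) - z) / (δ : ℂ)

lemma karg_re (δ : ℝ) (z : ℂ) (s : ℝ) : (karg δ z s).re = π / δ * (s - z.re) := by
  rw [karg, Complex.div_ofReal_re, Complex.re_ofReal_mul, Complex.sub_re, Complex.ofReal_re]; ring

lemma karg_im (δ : ℝ) (z : ℂ) (s : ℝ) : (karg δ z s).im = -(π / δ * z.im) := by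
  rw [karg, Complex.div_ofReal_im, Complex.im_ofReal_mul, Complex.sub_im, Complex.ofReal_im]; ring

lemma abs_karg_im_le {δ : ℝ} (hδ : 0 < δ) {z : ℂ} (hz : z ∈ closedStrip δ) (s : ℝ) :
    |(karg δ z s).im| ≤ π / 2 := by
  simp only [closedStrip, mem_ofPred_eq] at hz
  rw [karg_im, abs_neg, abs_mul, abs_of_pos (by positivity : 0 < π / δ)]
  calc π / δ * |z.im| ≤ π / δ * (δ / 2) := by gcongr
    _ = π / 2 := by field_simp

lemma abs_karg_im_lt {δ : ℝ} (hδ : 0 < δ) {z : ℂ} (hz : z ∈ strip δ) (s : ℝ) :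
    |(karg δ z s).im| < π / 2 := by
  simp only [strip, mem_ofPred_eq] at hz
  rw [karg_im, abs_neg, abs_mul, abs_of_pos (by positivity : 0 < π / δ)]
  calc π / δ * |z.im| < π / δ * (δ / 2) := by gcongr
    _ = π / 2 := by field_simp

lemma karg_re_ne_zero {δ : ℝ} (hδ : 0 < δ) {z : ℂ} {s : ℝ} (h : s ≠ z.re) :
    (karg δ z s).re ≠ 0 := by
  rw [karg_re]
  exact mul_ne_zero (by positivity) (sub_ne_zero.2 h)

lemma karg_shift (δ : ℝ) (z : ℂ) (s : ℝ) :
    karg δ z (z.re + s) = karg δ (z.im * Complex.I) s := by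
  unfold karg
  congr 2
  push_cast
  linear_combination Complex.re_add_im z

lemma continuous_karg (δ : ℝ) : Continuous fun p : ℂ × ℝ => karg δ p.1 p.2 := by
  unfold karg; fun_prop

lemma measurable_logCosh_karg (δ : ℝ) (z : ℂ) : Measurable fun s => logCosh (karg δ z s) :=
  measurable_logCosh.comp
    ((continuous_karg δ).comp (by fun_prop : Continuous fun s : ℝ => (z, s))).measurable

/-- `(1/2π) ∫ log cosh(π(s - z)/δ) g(s) ds`. -/
def pot (δ : ℝ) (g : ℝ → ℂ) (z : ℂ) : ℂ :=
  1 / (2 * π) * ∫ s : ℝ, logCosh (karg δ z s) * g s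

lemma ae_ne (x : ℝ) : ∀ᵐ s : ℝ, s ≠ x := by
  simp [ae_iff]

lemma integrable_potBound {δ : ℝ} (hδ : 0 < δ) (A : ℝ) : Integrable fun s : ℝ =>
    (π / δ * |s| + A + kerBound (π / δ * s)) / (1 + |s|) ^ 3 := by
  have hc : 0 < π / δ := by positivity
  have h1 := (integrable_inv_one_add_abs_sq.const_mul (π / δ + |A|)).add
    (integrable_kerBound_comp hc)
  have hm : Measurable kerBound := by unfold kerBound; fun_prop
  have hm' : Measurable fun s => kerBound (π / δ * s) := hm.comp (measurable_const_mul _)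
  refine h1.mono' (Measurable.aestronglyMeasurable (by fun_prop)) (ae_of_all _ fun s => ?_)
  have hk := kerBound_nonneg (π / δ * s)
  have h1s : 1 ≤ 1 + |s| := by linarith [abs_nonneg s]
  have hp : 1 ≤ (1 + |s|) ^ 3 := one_le_pow₀ h1s
  rw [norm_div, Real.norm_of_nonneg (by positivity : 0 ≤ (1 + |s|) ^ 3)]
  · simp only [Pi.add_apply]
    have e1 : ‖(π / δ * |s| + A + kerBound (π / δ * s))‖ ≤
        (π / δ + |A|) * (1 + |s|) + kerBound (π / δ * s) := by
      refine (norm_add_le _ _).trans ?_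
      rw [Real.norm_of_nonneg hk]
      gcongr
      refine (norm_add_le _ _).trans ?_
      rw [Real.norm_of_nonneg (by positivity), Real.norm_eq_abs]
      nlinarith [abs_nonneg A, abs_nonneg s, mul_nonneg (abs_nonneg A) (abs_nonneg s)]
    refine (div_le_div_of_nonneg_right e1 (by positivity)).trans ?_
    rw [add_div]
    gcongr
    · rw [div_eq_mul_inv, mul_assoc]
      gcongr
      apply le_of_eq; field_simp
    · refine (div_le_self hk hp).trans (le_mul_of_one_le_right hk hp)

lemma norm_logCosh_karg_le {δ : ℝ} (hδ : 0 < δ) {z : ℂ} (hz : z ∈ closedStrip δ) {s : ℝ}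
    (hs : s ≠ z.re) : ‖logCosh (karg δ z s)‖ ≤
      π / δ * |s - z.re| + 3 + kerBound (π / δ * (s - z.re)) := by
  have h := norm_logCosh_le (abs_karg_im_le hδ hz s) (karg_re_ne_zero hδ hs)
  rwa [karg_re, abs_mul, abs_of_pos (by positivity : 0 < π / δ)] at h

lemma lightKer_logCosh {δ : ℝ} (hδ : 0 < δ) {z : ℂ} (hz : z ∈ closedStrip δ) :
    LightKer fun s => logCosh (karg δ z s) := by
  refine ⟨measurable_logCosh_karg δ z, ?_⟩
  have h1 := ((integrable_potBound hδ 3).comp_sub_right z.re).const_mul ((1 + |z.re|) ^ 3)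
  refine h1.mono' ((measurable_logCosh_karg δ z).norm.div (by fun_prop)).aestronglyMeasurable ?_
  filter_upwards [ae_ne z.re] with s hs
  rw [norm_div, norm_norm, Real.norm_of_nonneg (by positivity : 0 ≤ (1 + |s|) ^ 3), ← mul_div_assoc,
    div_le_div_iff₀ (by positivity) (by positivity)]
  have h2 := norm_logCosh_karg_le hδ hz hs
  have h3 : 1 + |s - z.re| ≤ (1 + |z.re|) * (1 + |s|) := by
    have := abs_sub s z.re
    nlinarith [mul_nonneg (abs_nonneg s) (abs_nonneg z.re)]
  have hk := kerBound_nonneg (π / δ * (s - z.re))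
  calc ‖logCosh (karg δ z s)‖ * (1 + |s - z.re|) ^ 3 ≤
      (π / δ * |s - z.re| + 3 + kerBound (π / δ * (s - z.re))) *
        ((1 + |z.re|) * (1 + |s|)) ^ 3 := by gcongr
    _ = _ := by ring

lemma continuousOn_pot {δ : ℝ} (hδ : 0 < δ) {g : ℝ → ℝ → ℂ} (hg : Continuous (Function.uncurry g))
    (h : LocDec g) :
    ContinuousOn (Function.uncurry fun z t => pot δ (fun x => g x t) z)
      (closedStrip δ ×ˢ univ) := by
  rintro ⟨z₀, t₀⟩ ⟨hz₀, -⟩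
  obtain ⟨C, hC⟩ := h (|t₀| + 1)
  have hC0 : 0 ≤ C := (hC t₀ (by linarith)).nonneg
  have e : (Function.uncurry fun z t => pot δ (fun x => g x t) z) = fun p : ℂ × ℝ =>
      1 / (2 * π) * ∫ s : ℝ, logCosh (karg δ (p.1.im * Complex.I) s) * g (p.1.re + s) p.2 := by
    ext p
    simp only [Function.uncurry, pot]
    rw [← integral_add_left_eq_self (fun s => logCosh (karg δ p.1 s) * g s p.2) p.1.re]
    simp_rw [karg_shift]
  rw [e]
  refine ContinuousWithinAt.mul continuousWithinAt_const ?_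
  have hmem (p : ℂ × ℝ) (hp : p.1 ∈ closedStrip δ) : (p.1.im * Complex.I) ∈ closedStrip δ := by
    simpa [closedStrip] using hp
  refine continuousWithinAt_of_dominated (bound := fun s => (C * (2 + |z₀.re|) ^ 3) *
    ((π / δ * |s| + 3 + kerBound (π / δ * s)) / (1 + |s|) ^ 3))
    (Eventually.of_forall fun p => ?_) ?_ ((integrable_potBound hδ 3).const_mul _) ?_
  · have : Continuous fun s => g (p.1.re + s) p.2 :=
      hg.comp (by fun_prop : Continuous fun s : ℝ => (p.1.re + s, p.2))
    exact (measurable_logCosh_karg δ _).aestronglyMeasurable.mul this.aestronglyMeasurable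
  · have h1 : ∀ᶠ p : ℂ × ℝ in 𝓝 (z₀, t₀), |p.2| < |t₀| + 1 :=
      (continuous_abs.comp continuous_snd).continuousAt.eventually (gt_mem_nhds (by simp))
    have h2 : ∀ᶠ p : ℂ × ℝ in 𝓝 (z₀, t₀), |p.1.re| < |z₀.re| + 1 :=
      (continuous_abs.comp (Complex.continuous_re.comp continuous_fst)).continuousAt.eventually
        (gt_mem_nhds (by simp))
    filter_upwards [h1.filter_mono nhdsWithin_le_nhds, h2.filter_mono nhdsWithin_le_nhds,
      self_mem_nhdsWithin] with p hp1 hp2 hp3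
    filter_upwards [ae_ne 0] with s hs
    have b1 := norm_logCosh_karg_le hδ (hmem p hp3.1) (s := s) (by simpa using hs)
    have b2 := (hC p.2 hp1.le).shift s p.1.re
    simp only [Complex.mul_re, Complex.ofReal_re, Complex.I_re, mul_zero, Complex.ofReal_im,
      Complex.I_im, zero_mul, sub_zero] at b1
    have hk := kerBound_nonneg (π / δ * s)
    rw [add_comm s] at b2
    rw [norm_mul]
    calc _ ≤ (π / δ * |s| + 3 + kerBound (π / δ * s)) *
          (C * (1 + |p.1.re|) ^ 3 / (1 + |s|) ^ 3) :=
          mul_le_mul b1 b2 (norm_nonneg _) (by positivity)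
      _ ≤ (π / δ * |s| + 3 + kerBound (π / δ * s)) *
          (C * (2 + |z₀.re|) ^ 3 / (1 + |s|) ^ 3) := by
          gcongr ?_ * (C * ?_ ^ 3 / _)
          linarith
      _ = _ := by ring
  · filter_upwards [ae_ne 0] with s hs
    refine ContinuousAt.continuousWithinAt ?_
    refine ContinuousAt.mul ?_ ?_
    · have h1 : ContinuousAt logCosh (karg δ (z₀.im * Complex.I) s) :=
        continuousAt_logCosh (abs_karg_im_le hδ (hmem (z₀, t₀) hz₀) s)
          (Or.inl (karg_re_ne_zero hδ (by simpa using hs)))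
      have h2 : Continuous fun p : ℂ × ℝ => karg δ (p.1.im * Complex.I) s :=
        (continuous_karg δ).comp
          (by fun_prop : Continuous fun p : ℂ × ℝ => ((p.1.im : ℂ) * Complex.I, s))
      exact ContinuousAt.comp (g := logCosh) (f := fun p : ℂ × ℝ => karg δ (p.1.im * Complex.I) s)
        (x := (z₀, t₀)) h1 h2.continuousAt
    · have : Continuous fun p : ℂ × ℝ => g (p.1.re + s) p.2 :=
        hg.comp (by fun_prop : Continuous fun p : ℂ × ℝ => (p.1.re + s, p.2))
      exact this.continuousAt

lemma continuousOn_pot_static {δ : ℝ} (hδ : 0 < δ) {g : ℝ → ℂ} (hg : Continuous g) {C : ℝ}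
    (h : Dec C g) : ContinuousOn (pot δ g) (closedStrip δ) := by
  have := continuousOn_pot hδ (g := fun x _ => g x) (hg.comp continuous_fst) (LocDec.const h)
  exact this.comp (f := fun z : ℂ => (z, (0 : ℝ))) (by fun_prop) fun z hz => ⟨hz, mem_univ _⟩

lemma hasDerivAt_pot_t {δ : ℝ} (hδ : 0 < δ) {g g' : ℝ → ℝ → ℂ}
    (hc : ∀ t, Continuous fun x => g x t) (hc' : ∀ t, Continuous fun x => g' x t)
    (hd : LocDec g) (hd' : LocDec g') (hder : ∀ x t, HasDerivAt (fun s => g x s) (g' x t) t)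
    {z : ℂ} (hz : z ∈ closedStrip δ) (t : ℝ) :
    HasDerivAt (fun t => pot δ (fun x => g x t) z) (pot δ (fun x => g' x t) z) t :=
  ((lightKer_logCosh hδ hz).hasDerivAt hc hc' hd hd' hder t).const_mul _

lemma norm_tanh_le {w : ℂ} {b : ℝ} (hw : |w.im| ≤ b) (hb : b < π / 2) :
    ‖Complex.tanh w‖ ≤ 1 / Real.cos b := by
  have hb0 : 0 ≤ b := (abs_nonneg _).trans hw
  have hcb : 0 < Real.cos b := Real.cos_pos_of_mem_Ioo ⟨by linarith, hb⟩
  have hcos : Real.cos b ≤ Real.cos w.im := by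
    rw [← Real.cos_abs w.im]
    exact Real.cos_le_cos_of_nonneg_of_le_pi (abs_nonneg _) (by linarith) hw
  have h1 : ‖Complex.sinh w‖ ≤ Real.cosh w.re := by
    rw [Complex.sinh, Real.cosh_eq, norm_div]
    have := norm_sub_le (Complex.exp w) (Complex.exp (-w))
    rw [Complex.norm_exp, Complex.norm_exp, Complex.neg_re] at this
    simp only [Complex.norm_ofNat]
    linarith
  have h2 : Real.cosh w.re * Real.cos b ≤ ‖Complex.cosh w‖ := by
    have h3 : (Complex.cosh w).re = Real.cosh w.re * Real.cos w.im := by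
      rw [cosh_re_im]; simp [-Complex.ofReal_mul]
    have h4 := Complex.abs_re_le_norm (Complex.cosh w)
    rw [h3] at h4
    have := Real.cosh_pos w.re
    exact ((mul_le_mul_of_nonneg_left hcos this.le).trans (le_abs_self _)).trans h4
  have hp : 0 < Real.cosh w.re * Real.cos b := mul_pos (Real.cosh_pos _) hcb
  rw [Complex.tanh_eq_sinh_div_cosh, norm_div, div_le_div_iff₀ (hp.trans_le h2) hcb]
  nlinarith

lemma continuous_tanh_karg {δ : ℝ} (hδ : 0 < δ) {z : ℂ} (hz : z ∈ strip δ) :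
    Continuous fun s => Complex.tanh (karg δ z s) := by
  simp_rw [Complex.tanh_eq_sinh_div_cosh]
  have hk : Continuous fun s => karg δ z s :=
    (continuous_karg δ).comp (by fun_prop : Continuous fun s : ℝ => (z, s))
  refine (Complex.continuous_sinh.comp hk).div (Complex.continuous_cosh.comp hk) fun s => ?_
  exact Complex.slitPlane_ne_zero
    (cosh_mem_slitPlane (abs_karg_im_lt hδ hz s).le (Or.inr (abs_karg_im_lt hδ hz s)))

lemma integrable_tanh_karg_mul {δ : ℝ} (hδ : 0 < δ) {z : ℂ} (hz : z ∈ strip δ) {g : ℝ → ℂ}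
    (hg : Integrable g) : Integrable fun s => Complex.tanh (karg δ z s) * g s := by
  have h0 := abs_karg_im_lt hδ hz 0
  refine hg.bdd_mul (c := 1 / Real.cos |(karg δ z 0).im|)
    (continuous_tanh_karg hδ hz).aestronglyMeasurable (ae_of_all _ fun s => ?_)
  refine norm_tanh_le ?_ h0
  rw [karg_im, karg_im]

/-- The potential is analytic on the open strip. -/
lemma hasDerivAt_pot_tanh {δ : ℝ} (hδ : 0 < δ) {g : ℝ → ℂ} (hg : Continuous g) {C : ℝ}
    (h : Dec C g) {z : ℂ} (hz : z ∈ strip δ) :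
    HasDerivAt (pot δ g) (-(1 / (2 * δ)) * ∫ s, Complex.tanh (karg δ z s) * g s) z := by
  have hzi : |z.im| < δ / 2 := hz
  set η := (δ / 2 - |z.im|) / 2 with hη
  have hη0 : 0 < η := by rw [hη]; linarith
  set b := π / δ * (|z.im| + η) with hb
  have hb2 : b < π / 2 := by
    have : π / δ * (|z.im| + η) < π / δ * (δ / 2) := by gcongr; rw [hη]; linarith
    have e : π / δ * (δ / 2) = π / 2 := by field_simp
    linarith
  have hball (w : ℂ) (hw : w ∈ Metric.ball z η) (s : ℝ) :
      w ∈ strip δ ∧ |(karg δ w s).im| ≤ b := by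
    have h1 : |w.im| ≤ |z.im| + η := by
      have h2 : ‖w - z‖ < η := by simpa [dist_eq_norm] using hw
      have h3 := Complex.abs_im_le_norm (w - z)
      rw [Complex.sub_im] at h3
      have := abs_sub_abs_le_abs_sub w.im z.im
      linarith
    refine ⟨?_, ?_⟩
    · simp only [strip, mem_ofPred_eq]; rw [hη] at h1; linarith
    · rw [karg_im, abs_neg, abs_mul, abs_of_pos (by positivity : 0 < π / δ), hb]
      gcongr
  have hgi := h.integrable hg
  have key := (hasDerivAt_integral_of_dominated_loc_of_deriv_le (μ := volume)
    (F := fun w s => logCosh (karg δ w s) * g s)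
    (F' := fun w s => (Complex.tanh (karg δ w s) * (-(π / δ))) * g s) (x₀ := z)
    (s := Metric.ball z η) (bound := fun s => (1 / Real.cos b * (π / δ)) * ‖g s‖)
    (Metric.ball_mem_nhds z hη0)
    (Eventually.of_forall fun w =>
      (measurable_logCosh_karg δ w).aestronglyMeasurable.mul hg.aestronglyMeasurable)
    ((lightKer_logCosh hδ (strip_subset_closedStrip δ hz)).integrable_mul hg h)
    (((continuous_tanh_karg hδ hz).mul continuous_const).mul hg).aestronglyMeasurable
    (ae_of_all _ fun s w hw => ?_) (hgi.norm.const_mul _) (ae_of_all _ fun s w hw => ?_)).2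
  · have key2 := key.const_mul (1 / (2 * π) : ℂ)
    refine key2.congr_deriv ?_
    have e (s : ℝ) : Complex.tanh (karg δ z s) * (-(π / δ)) * g s =
        (-(π / δ)) * (Complex.tanh (karg δ z s) * g s) := by ring
    simp_rw [e]
    rw [integral_const_mul, ← mul_assoc]
    congr 1
    have h1 : (π : ℂ) ≠ 0 := by exact_mod_cast Real.pi_ne_zero
    have h2 : (δ : ℂ) ≠ 0 := by exact_mod_cast hδ.ne'
    field_simp
  · have h1 := norm_tanh_le (hball w hw s).2 hb2
    have h2 : ‖(-((π : ℂ) / δ))‖ = π / δ := by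
      rw [norm_neg, norm_div, Complex.norm_real, Complex.norm_real,
        Real.norm_of_nonneg Real.pi_pos.le, Real.norm_of_nonneg hδ.le]
    rw [norm_mul, norm_mul, h2]
    gcongr
  · have h1 := hasDerivAt_logCosh (abs_karg_im_lt hδ (hball w hw s).1 s)
    have h2 : HasDerivAt (fun w => karg δ w s) (-(π / δ)) w := by
      have := (((hasDerivAt_id w).const_sub (s : ℂ)).const_mul (π : ℂ)).div_const (δ : ℂ)
      refine this.congr_deriv ?_
      ring
    exact (h1.comp w h2).mul_const _

lemma pot_deriv_eq {δ : ℝ} (hδ : 0 < δ) {g g' : ℝ → ℂ} (hg : Continuous g) (hg' : Continuous g')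
    {C C' : ℝ} (h : Dec C g) (h' : Dec C' g') (hder : ∀ x, HasDerivAt g (g' x) x)
    {z : ℂ} (hz : z ∈ strip δ) :
    pot δ g' z = -(1 / (2 * δ)) * ∫ s, Complex.tanh (karg δ z s) * g s := by
  have hl := lightKer_logCosh hδ (strip_subset_closedStrip δ hz)
  have hu (s : ℝ) : HasDerivAt (fun s => logCosh (karg δ z s))
      (Complex.tanh (karg δ z s) * (π / δ)) s := by
    have h1 := hasDerivAt_logCosh (abs_karg_im_lt hδ hz s)
    have h2 : HasDerivAt (fun s => karg δ z s) (π / δ) s := by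
      have := (((Complex.ofRealCLM.hasDerivAt (x := s)).sub_const z).const_mul
        (π : ℂ)).div_const (δ : ℂ)
      refine this.congr_deriv ?_
      simp
    exact h1.comp s h2
  have ht := integrable_tanh_karg_mul hδ hz (h.integrable hg)
  have e (s : ℝ) : Complex.tanh (karg δ z s) * (π / δ) * g s =
      (π / δ) * (Complex.tanh (karg δ z s) * g s) := by ring
  have key := integral_mul_deriv_eq_deriv_mul_of_integrable (fun s _ => hu s) (fun s _ => hder s)
    (hl.integrable_mul hg' h') (by
      have : Integrable fun s => Complex.tanh (karg δ z s) * (π / δ) * g s := by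
        simp_rw [e]; exact ht.const_mul _
      exact this) (hl.integrable_mul hg h)
  rw [pot, key]
  simp_rw [e]
  rw [integral_const_mul]
  have h1 : (π : ℂ) ≠ 0 := by exact_mod_cast Real.pi_ne_zero
  have h2 : (δ : ℂ) ≠ 0 := by exact_mod_cast hδ.ne'
  field_simp

/-- The derivative of the potential of `g` is the potential of `g'`. -/
lemma hasDerivAt_pot {δ : ℝ} (hδ : 0 < δ) {g g' : ℝ → ℂ} (hg : Continuous g) (hg' : Continuous g')
    {C C' : ℝ} (h : Dec C g) (h' : Dec C' g') (hder : ∀ x, HasDerivAt g (g' x) x)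
    {z : ℂ} (hz : z ∈ strip δ) : HasDerivAt (pot δ g) (pot δ g' z) z := by
  rw [pot_deriv_eq hδ hg hg' h h' hder hz]
  exact hasDerivAt_pot_tanh hδ hg h hz

/-! ### Asymptotics of the potential -/

/-- The slope of the potential at infinity. -/
def charge (δ : ℝ) (g : ℝ → ℂ) : ℂ := 1 / (2 * δ) * ∫ s, g s

/-- The constant term of the potential at `+∞`. -/
def moment (δ : ℝ) (g : ℝ → ℂ) : ℂ :=
  1 / (2 * π) * ∫ s : ℝ, -(π / δ * s + Real.log 2 : ℂ) * g s

lemma lightKer_affine (a b : ℂ) : LightKer fun s : ℝ => a * s + b := by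
  refine ⟨by fun_prop, ?_⟩
  refine (integrable_inv_one_add_abs_sq.const_mul (‖a‖ + ‖b‖)).mono' (Measurable.aestronglyMeasurable (by fun_prop))
    (ae_of_all _ fun s => ?_)
  rw [norm_div, norm_norm, Real.norm_of_nonneg (by positivity : 0 ≤ (1 + |s|) ^ 3),
    div_le_iff₀ (by positivity)]
  have h1 : ‖a * s + b‖ ≤ ‖a‖ * |s| + ‖b‖ := by
    refine (norm_add_le _ _).trans ?_
    rw [norm_mul, Complex.norm_real, Real.norm_eq_abs]
  refine h1.trans ?_
  have : (‖a‖ + ‖b‖) * ((1 + |s|) ^ 2)⁻¹ * (1 + |s|) ^ 3 = (‖a‖ + ‖b‖) * (1 + |s|) := by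
    field_simp
  rw [this]
  nlinarith [norm_nonneg a, norm_nonneg b, abs_nonneg s, mul_nonneg (norm_nonneg b) (abs_nonneg s)]

lemma karg_eq (δ : ℝ) (z : ℂ) (s : ℝ) : karg δ z s = π / δ * s + -(π / δ * z) := by
  unfold karg; ring

lemma lightKer_karg (δ : ℝ) (z : ℂ) : LightKer fun s => karg δ z s := by
  simp_rw [karg_eq]; exact lightKer_affine _ _

lemma integral_karg_mul {δ : ℝ} (hδ : 0 < δ) (z : ℂ) {g : ℝ → ℂ} {C : ℝ} (hg : Continuous g)
    (h : Dec C g) : 1 / (2 * π) * ∫ s, (karg δ z s + Real.log 2) * g s =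
      -(moment δ g + charge δ g * z) := by
  have e (s : ℝ) : (karg δ z s + Real.log 2) * g s =
      -(-(π / δ * s + Real.log 2 : ℂ) * g s) - (π / δ * z) * g s := by
    rw [karg_eq]; ring
  have hi : Integrable fun s : ℝ => -(-(π / δ * s + Real.log 2 : ℂ) * g s) := by
    refine ((lightKer_affine (π / δ) (Real.log 2)).integrable_mul hg h).congr
      (ae_of_all _ fun s => ?_)
    simp only; ring
  simp_rw [e]
  rw [integral_sub hi ((h.integrable hg).const_mul _), integral_neg, integral_const_mul, moment,
    charge]
  have h1 : (π : ℂ) ≠ 0 := by exact_mod_cast Real.pi_ne_zero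
  have h2 : (δ : ℂ) ≠ 0 := by exact_mod_cast hδ.ne'
  field_simp
  ring

lemma norm_logCosh_add_sub_le {δ : ℝ} (hδ : 0 < δ) {z : ℂ} (hz : z ∈ closedStrip δ) {s : ℝ}
    (hs : s ≠ z.re) :
    ‖logCosh (karg δ z s) + (karg δ z s + Real.log 2)
      - (Ioi z.re).indicator (fun s => 2 * karg δ z s) s‖ ≤ kerBound (π / δ * (s - z.re)) := by
  have him := abs_karg_im_le hδ hz s
  have hre := karg_re δ z s
  have hc : 0 < π / δ := by positivity
  rcases lt_or_gt_of_ne hs with h | h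
  · rw [indicator_of_notMem (by simpa using h.le), sub_zero]
    have h1 := norm_logCosh_sub_le (w := -karg δ z s) (by simpa using him) (by
      rw [Complex.neg_re, hre]; have := mul_pos hc (sub_pos.2 h); linarith)
    rw [logCosh_neg, Complex.neg_re, kerBound_neg, hre] at h1
    convert h1 using 2
    ring
  · rw [indicator_of_mem (by simpa using h)]
    have h1 := norm_logCosh_sub_le (w := karg δ z s) him (by
      rw [hre]; exact mul_pos hc (sub_pos.2 h))
    rw [hre] at h1
    convert h1 using 2
    ring

lemma norm_pot_sub_le {δ : ℝ} (hδ : 0 < δ) {z : ℂ} (hz : z ∈ closedStrip δ) {g : ℝ → ℂ} {C : ℝ}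
    (hg : Continuous g) (h : Dec C g) :
    ‖pot δ g z - (moment δ g + charge δ g * z)‖ ≤
      C * (∫ s, kerBound (π / δ * s) * (1 + |s|) ^ 3) / (1 + |z.re|) ^ 3
        + ‖∫ s in Ioi z.re, karg δ z s * g s‖ := by
  have hc : 0 < π / δ := by positivity
  have i1 := (lightKer_logCosh hδ hz).integrable_mul hg h
  have i2 : Integrable fun s => (karg δ z s + Real.log 2) * g s := by
    have := ((lightKer_karg δ z).integrable_mul hg h).add ((h.integrable hg).const_mul (Real.log 2))
    refine this.congr (ae_of_all _ fun s => ?_)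
    simp only [Pi.add_apply]; ring
  have i3 := (((lightKer_karg δ z).integrable_mul hg h).const_mul 2).indicator
    (measurableSet_Ioi (a := z.re))
  have i12 : Integrable fun s => logCosh (karg δ z s) * g s + (karg δ z s + Real.log 2) * g s :=
    i1.add i2
  have e1 : ∫ s, (logCosh (karg δ z s) + (karg δ z s + Real.log 2)
      - (Ioi z.re).indicator (fun s => 2 * karg δ z s) s) * g s =
      (∫ s, logCosh (karg δ z s) * g s) + (∫ s, (karg δ z s + Real.log 2) * g s)
        - 2 * ∫ s in Ioi z.re, karg δ z s * g s := by
    rw [← integral_const_mul, ← integral_indicator measurableSet_Ioi, ← integral_add i1 i2,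
      ← integral_sub i12 i3]
    congr 1; ext s
    by_cases hs : s ∈ Ioi z.re
    · simp only [indicator_of_mem hs]; ring
    · simp only [indicator_of_notMem hs]; ring
  have hπ : (1 / (2 * π) : ℝ) ≤ 1 / 2 := by
    apply one_div_le_one_div_of_le two_pos
    linarith [Real.pi_gt_three]
  have e2 : pot δ g z - (moment δ g + charge δ g * z) = ((1 / (2 * π) : ℝ) : ℂ) *
      ((∫ s, (logCosh (karg δ z s) + (karg δ z s + Real.log 2)
      - (Ioi z.re).indicator (fun s => 2 * karg δ z s) s) * g s)
        + 2 * ∫ s in Ioi z.re, karg δ z s * g s) := by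
    rw [e1, pot]
    push_cast
    linear_combination -integral_karg_mul hδ z hg h
  have b1 := norm_integral_shift_le (integrable_kerBound_comp hc) (fun s => kerBound_nonneg _)
    (x := z.re) h (R := fun s => logCosh (karg δ z s) + (karg δ z s + Real.log 2)
      - (Ioi z.re).indicator (fun s => 2 * karg δ z s) s)
    (by filter_upwards [ae_ne z.re] with s hs using norm_logCosh_add_sub_le hδ hz hs)
  rw [e2, norm_mul, Complex.norm_real, Real.norm_of_nonneg (by positivity)]
  set X := ∫ s, (logCosh (karg δ z s) + (karg δ z s + Real.log 2)
      - (Ioi z.re).indicator (fun s => 2 * karg δ z s) s) * g s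
  set Y := ∫ s in Ioi z.re, karg δ z s * g s
  have b2 : ‖X + 2 * Y‖ ≤ ‖X‖ + 2 * ‖Y‖ := by
    refine (norm_add_le _ _).trans ?_
    rw [norm_mul]; simp
  calc 1 / (2 * π) * ‖X + 2 * Y‖ ≤ 1 / 2 * (‖X‖ + 2 * ‖Y‖) := by gcongr
    _ ≤ _ := by linarith [norm_nonneg X]

lemma tail_two {x : ℝ} (hx : 0 < x) : IntegrableOn (fun s : ℝ => ((1 + s) ^ 2)⁻¹) (Ioi x) ∧
    ∫ s in Ioi x, ((1 + s) ^ 2)⁻¹ = (1 + x)⁻¹ := by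
  have hd (s : ℝ) (hs : s ∈ Ici x) : HasDerivAt (fun s : ℝ => -(1 + s)⁻¹) ((1 + s) ^ 2)⁻¹ s := by
    have h0 : 1 + s ≠ 0 := by have : x ≤ s := hs; linarith
    have := (((hasDerivAt_id s).const_add 1).inv h0).neg
    refine this.congr_deriv ?_
    simp [div_eq_mul_inv]
  have hp (s : ℝ) (_ : s ∈ Ioi x) : 0 ≤ ((1 + s) ^ 2)⁻¹ := by positivity
  have hl : Tendsto (fun s : ℝ => -(1 + s)⁻¹) atTop (𝓝 0) := by
    have := (tendsto_inv_atTop_zero.comp (tendsto_atTop_add_const_left atTop (1 : ℝ) tendsto_id)).neg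
    simpa [Function.comp_def] using this
  refine ⟨integrableOn_Ioi_deriv_of_nonneg' hd hp hl, ?_⟩
  rw [integral_Ioi_of_hasDerivAt_of_nonneg' hd hp hl]; ring

lemma tail_three {x : ℝ} (hx : 0 < x) : IntegrableOn (fun s : ℝ => ((1 + s) ^ 3)⁻¹) (Ioi x) ∧
    ∫ s in Ioi x, ((1 + s) ^ 3)⁻¹ ≤ ((1 + x) ^ 2)⁻¹ := by
  have hd (s : ℝ) (hs : s ∈ Ici x) :
      HasDerivAt (fun s : ℝ => -(1 / 2) * ((1 + s) ^ 2)⁻¹) ((1 + s) ^ 3)⁻¹ s := by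
    have h0 : 1 + s ≠ 0 := by have : x ≤ s := hs; linarith
    have := ((((hasDerivAt_id s).const_add 1).pow 2).inv (pow_ne_zero 2 h0)).const_mul (-(1 / 2))
    refine this.congr_deriv ?_
    simp only [id, Pi.pow_apply]
    field_simp
    norm_num
  have hp (s : ℝ) (hs : s ∈ Ioi x) : 0 ≤ ((1 + s) ^ 3)⁻¹ := by
    have : x < s := hs
    have : 0 < 1 + s := by linarith
    positivity
  have hl : Tendsto (fun s : ℝ => -(1 / 2) * ((1 + s) ^ 2)⁻¹) atTop (𝓝 0) := by
    have := (tendsto_inv_atTop_zero.comp ((tendsto_pow_atTop two_ne_zero).comp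
      (tendsto_atTop_add_const_left atTop (1 : ℝ) tendsto_id))).const_mul (-(1 / 2))
    simpa [Function.comp_def] using this
  refine ⟨integrableOn_Ioi_deriv_of_nonneg' hd hp hl, ?_⟩
  rw [integral_Ioi_of_hasDerivAt_of_nonneg' hd hp hl]
  have : 0 ≤ ((1 + x) ^ 2)⁻¹ := by positivity
  linarith

lemma norm_karg_le {δ : ℝ} (hδ : 0 < δ) {z : ℂ} (hz : z ∈ closedStrip δ) {s : ℝ} :
    ‖karg δ z s‖ ≤ π / δ * |s - z.re| + π / 2 := by
  refine (Complex.norm_le_abs_re_add_abs_im _).trans (add_le_add ?_ (abs_karg_im_le hδ hz s))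
  rw [karg_re, abs_mul, abs_of_pos (by positivity : 0 < π / δ)]

/-- The potential grows linearly at the right end. -/
lemma bigORight_pot {δ : ℝ} (hδ : 0 < δ) {g : ℝ → ℂ} {C : ℝ} (hg : Continuous g) (h : Dec C g) :
    BigORight (closedStrip δ) 1 fun z => pot δ g z - (moment δ g + charge δ g * z) := by
  have hC := h.nonneg
  set A := ∫ s, kerBound (π / δ * s) * (1 + |s|) ^ 3
  have hA : 0 ≤ A := integral_nonneg fun s => mul_nonneg (kerBound_nonneg _) (by positivity)
  refine ⟨C * A + (π / δ + π / 2) * C, 1, one_pos, fun z hz hz1 => ?_⟩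
  have hx : 0 < z.re := by linarith
  have b1 := norm_pot_sub_le hδ hz hg h
  have b2 : ‖∫ s in Ioi z.re, karg δ z s * g s‖ ≤ (π / δ + π / 2) * C * (1 + z.re)⁻¹ := by
    rw [← (tail_two hx).2, ← integral_const_mul]
    refine norm_integral_le_of_norm_le ((tail_two hx).1.const_mul _) ?_
    refine (ae_restrict_iff' measurableSet_Ioi).2 (ae_of_all _ fun s hs => ?_)
    have hs : z.re < s := hs
    have hs0 : 0 < s := hx.trans hs
    have b3 := h s
    rw [abs_of_pos hs0] at b3
    have b4 : ‖karg δ z s‖ ≤ (π / δ + π / 2) * (1 + s) := by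
      refine (norm_karg_le hδ hz).trans ?_
      rw [abs_of_pos (sub_pos.2 hs)]
      have : 0 < π / δ := by positivity
      have := Real.pi_pos
      nlinarith
    rw [norm_mul]
    calc ‖karg δ z s‖ * ‖g s‖ ≤ ((π / δ + π / 2) * (1 + s)) * (C / (1 + s) ^ 3) :=
          mul_le_mul b4 b3 (norm_nonneg _) (by positivity)
      _ = _ := by field_simp
  refine b1.trans ?_
  rw [abs_of_pos hx, pow_one, add_div]
  gcongr
  · calc z.re ≤ (1 + z.re) ^ 1 := by linarith
      _ ≤ (1 + z.re) ^ 3 := pow_le_pow_right₀ (by linarith) (by norm_num)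
  · refine b2.trans ?_
    rw [← div_eq_mul_inv]
    gcongr
    linarith

lemma charge_deriv {δ : ℝ} {g g' : ℝ → ℂ} (hg' : Continuous g') {C C' : ℝ} (h : Dec C g)
    (h' : Dec C' g') (hder : ∀ x, HasDerivAt g (g' x) x) : charge δ g' = 0 := by
  rw [charge, integral_deriv_eq_zero hder h hg' h', mul_zero]

lemma moment_deriv {δ : ℝ} {g g' : ℝ → ℂ} (hg : Continuous g)
    (hg' : Continuous g') {C C' : ℝ} (h : Dec C g)
    (h' : Dec C' g') (hder : ∀ x, HasDerivAt g (g' x) x) : moment δ g' = charge δ g := by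
  have hl : LightKer fun s : ℝ => -(π / δ * s + Real.log 2 : ℂ) := by
    have := lightKer_affine (-(π / δ)) (-Real.log 2)
    have e : (fun s : ℝ => -(π / δ * s + Real.log 2 : ℂ)) =
        fun s : ℝ => -(π / δ : ℂ) * s + -Real.log 2 := by funext s; ring
    rwa [e]
  have hu (s : ℝ) : HasDerivAt (fun s : ℝ => -(π / δ * s + Real.log 2 : ℂ)) (-(π / δ)) s := by
    have := (((Complex.ofRealCLM.hasDerivAt (x := s)).const_mul (π / δ : ℂ)).add_const
      (Real.log 2 : ℂ)).neg
    refine this.congr_deriv ?_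
    simp
  have key := integral_mul_deriv_eq_deriv_mul_of_integrable (fun s _ => hu s) (fun s _ => hder s)
    (hl.integrable_mul hg' h') ((h.integrable hg).const_mul _) (hl.integrable_mul hg h)
  rw [moment, key, integral_const_mul, charge]
  have h1 : (π : ℂ) ≠ 0 := by exact_mod_cast Real.pi_ne_zero
  by_cases h2 : (δ : ℂ) = 0
  · simp [h2]
  · field_simp

/-- The potential of a derivative converges at the right end. -/
lemma bigORight_pot_deriv {δ : ℝ} (hδ : 0 < δ) {g g' : ℝ → ℂ} (hg : Continuous g)
    (hg' : Continuous g') {C C' : ℝ} (h : Dec C g)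
    (h' : Dec C' g') (hder : ∀ x, HasDerivAt g (g' x) x) :
    BigORight (closedStrip δ) 2 fun z => pot δ g' z - charge δ g := by
  have hC := h.nonneg
  have hC' := h'.nonneg
  set A := ∫ s, kerBound (π / δ * s) * (1 + |s|) ^ 3
  have hA : 0 ≤ A := integral_nonneg fun s => mul_nonneg (kerBound_nonneg _) (by positivity)
  refine ⟨C' * A + (π / 2 * C + π / δ * C), 1, one_pos, fun z hz hz1 => ?_⟩
  have hx : 0 < z.re := by linarith
  have b1 := norm_pot_sub_le hδ hz hg' h'
  rw [charge_deriv hg' h h' hder, moment_deriv hg hg' h h' hder, zero_mul, add_zero] at b1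
  have ik := (lightKer_karg δ z).integrable_mul hg' h'
  have ig := (h.integrable hg).const_mul (π / δ : ℂ)
  have hparts : ∫ s in Ioi z.re, karg δ z s * g' s =
      -(karg δ z z.re * g z.re) - (π / δ) * ∫ s in Ioi z.re, g s := by
    have hd (s : ℝ) : HasDerivAt (fun s => karg δ z s * g s)
        (π / δ * g s + karg δ z s * g' s) s := by
      have h2 : HasDerivAt (fun s => karg δ z s) (π / δ) s := by
        have := (((Complex.ofRealCLM.hasDerivAt (x := s)).sub_const z).const_mul
          (π : ℂ)).div_const (δ : ℂ)
        refine this.congr_deriv ?_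
        simp
      exact h2.mul (hder s)
    have hlim : Tendsto (fun s => karg δ z s * g s) atTop (𝓝 0) :=
      tendsto_zero_of_hasDerivAt_of_integrableOn_Ioi (a := 0) (fun s _ => hd s)
        (ig.add ik).integrableOn ((lightKer_karg δ z).integrable_mul hg h).integrableOn
    have key := integral_Ioi_of_hasDerivAt_of_tendsto' (a := z.re) (fun s _ => hd s)
      (ig.add ik).integrableOn hlim
    rw [integral_add ig.integrableOn ik.integrableOn, integral_const_mul] at key
    linear_combination key
  have b2 : ‖∫ s in Ioi z.re, g s‖ ≤ C * ((1 + z.re) ^ 2)⁻¹ := by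
    have : ‖∫ s in Ioi z.re, g s‖ ≤ ∫ s in Ioi z.re, C * ((1 + s) ^ 3)⁻¹ := by
      refine norm_integral_le_of_norm_le ((tail_three hx).1.const_mul _) ?_
      refine (ae_restrict_iff' measurableSet_Ioi).2 (ae_of_all _ fun s hs => ?_)
      have hs : z.re < s := hs
      have b3 := h s
      rwa [abs_of_pos (hx.trans hs), div_eq_mul_inv] at b3
    rw [integral_const_mul] at this
    exact this.trans (mul_le_mul_of_nonneg_left (tail_three hx).2 hC)
  have b3 : ‖karg δ z z.re‖ ≤ π / 2 := by
    have := norm_karg_le hδ hz (s := z.re)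
    simpa using this
  have b4 := h z.re
  have hπδ : ‖(π / δ : ℂ)‖ = π / δ := by
    rw [norm_div, Complex.norm_real, Complex.norm_real,
      Real.norm_of_nonneg Real.pi_pos.le, Real.norm_of_nonneg hδ.le]
  have b5 : ‖∫ s in Ioi z.re, karg δ z s * g' s‖ ≤
      π / 2 * (C / (1 + |z.re|) ^ 3) + π / δ * (C * ((1 + z.re) ^ 2)⁻¹) := by
    rw [hparts]
    refine (norm_sub_le _ _).trans ?_
    rw [norm_neg, norm_mul, norm_mul, hπδ]
    gcongr
  refine b1.trans ((add_le_add_right b5 _).trans ?_)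
  rw [abs_of_pos hx]
  have p2 : z.re ^ 2 ≤ (1 + z.re) ^ 2 := by gcongr; linarith
  have p3 : z.re ^ 2 ≤ (1 + z.re) ^ 3 := p2.trans (pow_le_pow_right₀ (by linarith) (by norm_num))
  have q1 : C' * A / (1 + z.re) ^ 3 ≤ C' * A / z.re ^ 2 := by gcongr
  have q2 : C / (1 + z.re) ^ 3 ≤ C / z.re ^ 2 := by gcongr
  have q3 : C * ((1 + z.re) ^ 2)⁻¹ ≤ C / z.re ^ 2 := by
    rw [← div_eq_mul_inv]; gcongr
  calc _ ≤ C' * A / z.re ^ 2 + (π / 2 * (C / z.re ^ 2) + π / δ * (C / z.re ^ 2)) := by gcongr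
    _ = _ := by ring

lemma pot_comp_neg (δ : ℝ) (g : ℝ → ℂ) (z : ℂ) : pot δ (fun x => g (-x)) (-z) = pot δ g z := by
  rw [pot, pot, ← integral_neg_eq_self]
  congr 2; ext s
  have : karg δ (-z) (-s) = -karg δ z s := by unfold karg; push_cast; ring
  rw [this, logCosh_neg, neg_neg]

lemma charge_comp_neg (δ : ℝ) (g : ℝ → ℂ) : charge δ (fun x => g (-x)) = charge δ g := by
  rw [charge, charge, integral_neg_eq_self]

lemma bigOLeft_of_neg {δ : ℝ} {n : ℕ} {a b : ℂ → ℂ} (h : BigORight (closedStrip δ) n a)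
    (hab : ∀ z, ‖b z‖ = ‖a (-z)‖) : BigOLeft (closedStrip δ) n b := by
  obtain ⟨C, R, hR, h⟩ := h
  refine ⟨C, R, hR, fun z hz hzR => ?_⟩
  have := h (-z) (by simpa [closedStrip] using hz) (by rw [Complex.neg_re]; linarith)
  rwa [hab, ← abs_neg, ← Complex.neg_re]

lemma bigOLeft_pot {δ : ℝ} (hδ : 0 < δ) {g : ℝ → ℂ} {C : ℝ} (hg : Continuous g) (h : Dec C g) :
    BigOLeft (closedStrip δ) 1 fun z =>
      pot δ g z - (moment δ (fun x => g (-x)) - charge δ g * z) := by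
  refine bigOLeft_of_neg (bigORight_pot hδ (hg.comp continuous_neg) h.comp_neg) fun z => ?_
  congr 1
  rw [Function.comp_def, pot_comp_neg, charge_comp_neg]; ring

lemma bigOLeft_pot_deriv {δ : ℝ} (hδ : 0 < δ) {g g' : ℝ → ℂ} (hg : Continuous g)
    (hg' : Continuous g') {C C' : ℝ} (h : Dec C g)
    (h' : Dec C' g') (hder : ∀ x, HasDerivAt g (g' x) x) :
    BigOLeft (closedStrip δ) 2 fun z => pot δ g' z + charge δ g := by
  have hd (x : ℝ) : HasDerivAt (fun x => g (-x)) (-1 * g' (-x)) x := by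
    have := (hder (-x)).scomp x (hasDerivAt_neg x)
    simpa [Function.comp_def] using this
  refine bigOLeft_of_neg (bigORight_pot_deriv hδ (g := fun x => g (-x))
    (g' := fun x => -1 * g' (-x)) (hg.comp continuous_neg)
    (continuous_const.mul (hg'.comp continuous_neg)) h.comp_neg (h'.comp_neg.const_mul (-1)) hd)
    fun z => ?_
  have e : pot δ (fun x => -1 * g' (-x)) (-z) = -pot δ g' z := by
    rw [← pot_comp_neg δ g' z]
    simp only [pot, neg_mul, one_mul, mul_neg, integral_neg]
  rw [charge_comp_neg]
  rw [e, ← norm_neg]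
  congr 1; ring

/-! ### Boundary values of the potential and the transforms of smooth functions -/

lemma Dec.translate {C : ℝ} {g : ℝ → ℂ} (h : Dec C g) (x : ℝ) :
    Dec (C * (1 + |x|) ^ 3) fun s => g (x + s) := fun s => by
  have := h.shift s x
  rwa [add_comm s x] at this

/-- The kernel `log |sinh(πs/δ)|`. -/
def sinhKer (δ s : ℝ) : ℂ := (Real.log (Real.sinh (π / δ * s)) : ℝ)

/-- The kernel `log cosh(πs/δ)`. -/
def coshKer (δ s : ℝ) : ℂ := (Real.log (Real.cosh (π / δ * s)) : ℝ)

lemma norm_sinhKer_le {δ : ℝ} (hδ : 0 < δ) {s : ℝ} (hs : s ≠ 0) :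
    ‖sinhKer δ s‖ ≤ π / δ * |s| + 3 + kerBound (π / δ * s) := by
  have hc : 0 < π / δ := by positivity
  have h := abs_log_sinh_sub_le (mul_ne_zero hc.ne' hs)
  have h2 := Real.log_two_lt_d9
  have h3 := Real.log_nonneg one_le_two
  rw [sinhKer, Complex.norm_real, Real.norm_eq_abs]
  rw [abs_mul, abs_of_pos hc, abs_le] at h
  have : 0 ≤ π / δ * |s| := by positivity
  rw [abs_le]
  constructor <;> linarith [h.1, h.2]

lemma norm_coshKer_le {δ : ℝ} (hδ : 0 < δ) {s : ℝ} (hs : s ≠ 0) :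
    ‖coshKer δ s‖ ≤ π / δ * |s| + 3 + kerBound (π / δ * s) := by
  have hc : 0 < π / δ := by positivity
  have h := abs_log_cosh_sub_le (mul_ne_zero hc.ne' hs)
  have h2 := Real.log_two_lt_d9
  have h3 := Real.log_nonneg one_le_two
  rw [coshKer, Complex.norm_real, Real.norm_eq_abs]
  rw [abs_mul, abs_of_pos hc, abs_le] at h
  have : 0 ≤ π / δ * |s| := by positivity
  rw [abs_le]
  constructor <;> linarith [h.1, h.2]

lemma lightKer_of_bound {δ : ℝ} (hδ : 0 < δ) {k : ℝ → ℂ} (hk : Measurable k)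
    (h : ∀ s, s ≠ 0 → ‖k s‖ ≤ π / δ * |s| + 3 + kerBound (π / δ * s)) : LightKer k := by
  refine ⟨hk, (integrable_potBound hδ 3).mono'
    (Measurable.aestronglyMeasurable (hk.norm.div (by fun_prop))) ?_⟩
  filter_upwards [ae_ne 0] with s hs
  rw [norm_div, norm_norm, Real.norm_of_nonneg (by positivity : 0 ≤ (1 + |s|) ^ 3)]
  gcongr
  exact h s hs

lemma lightKer_sinhKer {δ : ℝ} (hδ : 0 < δ) : LightKer (sinhKer δ) :=
  lightKer_of_bound hδ (Complex.measurable_ofReal.comp (Real.measurable_log.comp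
    (Real.continuous_sinh.measurable.comp (measurable_const_mul _)))) fun _ => norm_sinhKer_le hδ

lemma lightKer_coshKer {δ : ℝ} (hδ : 0 < δ) : LightKer (coshKer δ) :=
  lightKer_of_bound hδ (Complex.measurable_ofReal.comp (Real.measurable_log.comp
    (Real.continuous_cosh.measurable.comp (measurable_const_mul _)))) fun _ => norm_coshKer_le hδ

lemma LightKer.integrable_conv {k : ℝ → ℂ} (hk : LightKer k) {g : ℝ → ℂ} {C : ℝ}
    (hg : Continuous g) (h : Dec C g) (x : ℝ) : Integrable fun s => k s * g (x + s) :=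
  hk.integrable_mul (hg.comp (continuous_const.add continuous_id)) (h.translate x)

lemma LightKer.conv_add {k : ℝ → ℂ} (hk : LightKer k) {g g' : ℝ → ℂ} {C C' : ℝ}
    (hg : Continuous g) (hg' : Continuous g') (h : Dec C g) (h' : Dec C' g') (a b : ℂ) (x : ℝ) :
    conv k (fun y => a * g y + b * g' y) x = a * conv k g x + b * conv k g' x := by
  simp only [conv]
  rw [← integral_const_mul, ← integral_const_mul, ← integral_add
    ((hk.integrable_conv hg h x).const_mul a) ((hk.integrable_conv hg' h' x).const_mul b)]
  congr 1; ext s; ring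

lemma pot_eq_shift (δ : ℝ) (g : ℝ → ℂ) (z : ℂ) :
    pot δ g z = 1 / (2 * π) * ∫ s : ℝ, logCosh (karg δ (z.im * Complex.I) s) * g (z.re + s) := by
  rw [pot, ← integral_add_left_eq_self (fun s => logCosh (karg δ z s) * g s) z.re]
  simp_rw [karg_shift]

lemma pot_lower {δ : ℝ} (hδ : 0 < δ) (g : ℝ → ℂ) (x : ℝ) :
    pot δ g (x - Complex.I * δ / 2) = 1 / (2 * π) *
      ∫ s : ℝ, logCosh ((π / δ * s : ℝ) + π / 2 * Complex.I) * g (x + s) := by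
  have hδ' : (δ : ℂ) ≠ 0 := by exact_mod_cast hδ.ne'
  have h1 : ((x : ℂ) - Complex.I * δ / 2).re = x := by simp
  have h2 : ((x : ℂ) - Complex.I * δ / 2).im = -(δ / 2) := by simp
  rw [pot_eq_shift, h1, h2]
  congr 2; ext s
  congr 2
  unfold karg; push_cast; field_simp; ring

lemma pot_upper {δ : ℝ} (hδ : 0 < δ) (g : ℝ → ℂ) (x : ℝ) :
    pot δ g (x + Complex.I * δ / 2) = 1 / (2 * π) *
      ∫ s : ℝ, logCosh ((π / δ * s : ℝ) - π / 2 * Complex.I) * g (x + s) := by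
  have hδ' : (δ : ℂ) ≠ 0 := by exact_mod_cast hδ.ne'
  have h1 : ((x : ℂ) + Complex.I * δ / 2).re = x := by simp
  have h2 : ((x : ℂ) + Complex.I * δ / 2).im = δ / 2 := by simp
  rw [pot_eq_shift, h1, h2]
  congr 2; ext s
  congr 2
  unfold karg; push_cast; field_simp

lemma integrable_logCosh_boundary {δ : ℝ} (hδ : 0 < δ) {σ : ℝ} (hσ : |σ| = 1) {g : ℝ → ℂ}
    {C : ℝ} (hg : Continuous g) (h : Dec C g) (x : ℝ) :
    Integrable fun s : ℝ => logCosh ((π / δ * s : ℝ) + σ * (π / 2 * Complex.I)) * g (x + s) := by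
  refine LightKer.integrable_conv (k := fun s : ℝ =>
    logCosh ((π / δ * s : ℝ) + σ * (π / 2 * Complex.I))) (lightKer_of_bound hδ ?_ fun s hs => ?_)
    hg h x
  · exact measurable_logCosh.comp (by fun_prop)
  · have hre : (((π / δ * s : ℝ) : ℂ) + σ * (π / 2 * Complex.I)).re = π / δ * s := by simp
    have him : (((π / δ * s : ℝ) : ℂ) + σ * (π / 2 * Complex.I)).im = σ * (π / 2) := by simp
    have hc : 0 < π / δ := by positivity
    have := norm_logCosh_le (w := (π / δ * s : ℝ) + σ * (π / 2 * Complex.I))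
      (by rw [him, abs_mul, hσ, one_mul, abs_of_pos (half_pos Real.pi_pos)])
      (by rw [hre]; exact mul_ne_zero hc.ne' hs)
    rwa [hre, abs_mul, abs_of_pos hc] at this

lemma integrable_logCosh_upper {δ : ℝ} (hδ : 0 < δ) {g : ℝ → ℂ}
    {C : ℝ} (hg : Continuous g) (h : Dec C g) (x : ℝ) :
    Integrable fun s : ℝ => logCosh ((π / δ * s : ℝ) + π / 2 * Complex.I) * g (x + s) := by
  simpa using integrable_logCosh_boundary hδ (σ := 1) (by simp) hg h x

lemma integrable_logCosh_lower {δ : ℝ} (hδ : 0 < δ) {g : ℝ → ℂ}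
    {C : ℝ} (hg : Continuous g) (h : Dec C g) (x : ℝ) :
    Integrable fun s : ℝ => logCosh ((π / δ * s : ℝ) - π / 2 * Complex.I) * g (x + s) := by
  simpa [sub_eq_add_neg] using integrable_logCosh_boundary hδ (σ := -1) (by simp) hg h x

lemma integral_sign_mul_deriv {g g' : ℝ → ℂ} {C C' : ℝ} (h : Dec C g) (hg' : Continuous g')
    (h' : Dec C' g') (hder : ∀ x, HasDerivAt g (g' x) x) (x : ℝ) :
    ∫ s : ℝ, ((SignType.sign s : ℝ) : ℂ) * g' (x + s) = -2 * g x := by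
  have hi : Integrable fun s => g' (x + s) := (h'.integrable hg').comp_add_left x
  have hd (s : ℝ) : HasDerivAt (fun s => g (x + s)) (g' (x + s)) s := (hder (x + s)).comp_const_add x s
  have ht := tendsto_zero_of_dec (h.translate x)
  have h1 := integral_Ioi_of_hasDerivAt_of_tendsto' (a := 0) (fun s _ => hd s) hi.integrableOn ht.1
  have h2 := integral_Iic_of_hasDerivAt_of_tendsto' (a := 0) (fun s _ => hd s) hi.integrableOn ht.2
  have e : (fun s : ℝ => ((SignType.sign s : ℝ) : ℂ) * g' (x + s)) =ᵐ[volume] fun s =>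
      (Ioi 0).indicator (fun s => g' (x + s)) s - (Iic 0).indicator (fun s => g' (x + s)) s := by
    filter_upwards [ae_ne 0] with s hs
    rcases lt_or_gt_of_ne hs with h | h
    · rw [sign_neg h, indicator_of_notMem (by simpa using h.le), indicator_of_mem (by simpa using h.le)]
      simp
    · rw [sign_pos h, indicator_of_mem (by simpa using h), indicator_of_notMem (by simpa using h)]
      simp
  rw [integral_congr_ae e, integral_sub (hi.indicator measurableSet_Ioi)
    (hi.indicator measurableSet_Iic), integral_indicator measurableSet_Ioi,
    integral_indicator measurableSet_Iic, h1, h2]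
  simp only [add_zero]; ring

/-- The jump of the potential across the strip. -/
lemma pot_lower_sub_upper {δ : ℝ} (hδ : 0 < δ) {g g' : ℝ → ℂ} {C C' : ℝ} (h : Dec C g)
    (hg' : Continuous g') (h' : Dec C' g') (hder : ∀ x, HasDerivAt g (g' x) x) (x : ℝ) :
    pot δ g' (x - Complex.I * δ / 2) - pot δ g' (x + Complex.I * δ / 2) = -Complex.I * g x := by
  rw [pot_lower hδ, pot_upper hδ, ← mul_sub, ← integral_sub (integrable_logCosh_upper hδ hg' h' x)
    (integrable_logCosh_lower hδ hg' h' x)]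
  have hc : 0 < π / δ := by positivity
  have e : (fun s : ℝ => logCosh ((π / δ * s : ℝ) + π / 2 * Complex.I) * g' (x + s) -
      logCosh ((π / δ * s : ℝ) - π / 2 * Complex.I) * g' (x + s)) =ᵐ[volume]
      fun s => (π * Complex.I) * (((SignType.sign s : ℝ) : ℂ) * g' (x + s)) := by
    filter_upwards [ae_ne 0] with s hs
    have := logCosh_upper_sub_lower (mul_ne_zero hc.ne' hs)
    rw [sign_mul, sign_pos hc, one_mul] at this
    rw [← sub_mul, this]; ring
  rw [integral_congr_ae e, integral_const_mul, integral_sign_mul_deriv h hg' h' hder]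
  have h1 : (π : ℂ) ≠ 0 := by exact_mod_cast Real.pi_ne_zero
  field_simp

lemma pot_lower_add_upper {δ : ℝ} (hδ : 0 < δ) {g : ℝ → ℂ} {C : ℝ}
    (hg : Continuous g) (h : Dec C g) (x : ℝ) :
    pot δ g (x - Complex.I * δ / 2) + pot δ g (x + Complex.I * δ / 2) =
      1 / π * conv (sinhKer δ) g x := by
  rw [pot_lower hδ, pot_upper hδ, ← mul_add, ← integral_add (integrable_logCosh_upper hδ hg h x)
    (integrable_logCosh_lower hδ hg h x)]
  have hc : 0 < π / δ := by positivity
  have e : (fun s : ℝ => logCosh ((π / δ * s : ℝ) + π / 2 * Complex.I) * g (x + s) +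
      logCosh ((π / δ * s : ℝ) - π / 2 * Complex.I) * g (x + s)) =ᵐ[volume]
      fun s => 2 * (sinhKer δ s * g (x + s)) := by
    filter_upwards [ae_ne 0] with s hs
    rw [← add_mul, logCosh_upper_add_lower (mul_ne_zero hc.ne' hs), sinhKer]; ring
  rw [integral_congr_ae e, integral_const_mul, conv, ← mul_assoc]
  congr 1
  have h1 : (π : ℂ) ≠ 0 := by exact_mod_cast Real.pi_ne_zero
  field_simp

lemma pot_ofReal {δ : ℝ} (g : ℝ → ℂ) (x : ℝ) :
    pot δ g x = 1 / (2 * π) * conv (coshKer δ) g x := by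
  rw [pot_eq_shift, conv]
  congr 2; ext s
  have : karg δ (((x : ℂ).im : ℂ) * Complex.I) s = (π / δ * s : ℝ) := by
    unfold karg; simp; ring
  rw [this, logCosh_ofReal, coshKer, Complex.ofReal_re]

lemma opTt_eq_conv {δ : ℝ} (hδ : 0 < δ) {f f' : ℝ → ℂ} (hf : Continuous f) (hf' : Continuous f')
    {C C' : ℝ} (h : Dec C f) (h' : Dec C' f') (hder : ∀ x, HasDerivAt f (f' x) x) (x : ℝ) :
    opTt δ f x = -(1 / π) * conv (coshKer (2 * δ)) f' x := by
  have h2δ : 0 < 2 * δ := by positivity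
  have h1 := pot_deriv_eq h2δ hf hf' h h' hder (z := x) (by simpa [strip] using hδ)
  rw [pot_ofReal] at h1
  have e (s : ℝ) : Complex.tanh (karg (2 * δ) x s) = (Real.tanh (π / (2 * δ) * (s - x)) : ℝ) := by
    rw [Complex.ofReal_tanh]; congr 1; unfold karg; push_cast; ring
  simp_rw [e] at h1
  rw [opTt]
  push_cast at h1 ⊢
  have h3 : (π : ℂ) ≠ 0 := by exact_mod_cast Real.pi_ne_zero
  have h4 : (δ : ℂ) ≠ 0 := by exact_mod_cast hδ.ne'
  field_simp at h1 ⊢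
  linear_combination h1

lemma tendsto_mul_sinhKer {δ : ℝ} (hδ : 0 < δ) :
    Tendsto (fun ε : ℝ => ε * ‖sinhKer δ ε‖) (𝓝[>] 0) (𝓝 0) := by
  have hc : 0 < π / δ := by positivity
  have hlim : Tendsto (fun ε : ℝ => ε * (π / δ * ε + 3) + (π / δ)⁻¹ * (π / δ * ε) ^ (1 / 2 : ℝ))
      (𝓝[>] 0) (𝓝 0) := by
    have : ContinuousAt (fun ε : ℝ => ε * (π / δ * ε + 3) +
        (π / δ)⁻¹ * (π / δ * ε) ^ (1 / 2 : ℝ)) 0 := by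
      refine ContinuousAt.add (by fun_prop) (continuousAt_const.mul ?_)
      exact ContinuousAt.rpow_const (by fun_prop) (Or.inr (by norm_num))
    have h := this.tendsto.mono_left (nhdsWithin_le_nhds (s := Ioi 0))
    have h0 : (0 : ℝ) ^ (1 / 2 : ℝ) = 0 := Real.zero_rpow (by norm_num)
    simpa [h0] using h
  refine squeeze_zero' ?_ ?_ hlim
  · filter_upwards [self_mem_nhdsWithin] with ε hε
    have : 0 < ε := hε
    positivity
  · filter_upwards [self_mem_nhdsWithin] with ε hε
    have hε : 0 < ε := hε
    have h1 := norm_sinhKer_le hδ hε.ne'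
    rw [abs_of_pos hε] at h1
    have hp : 0 < π / δ * ε := by positivity
    have h2 : kerBound (π / δ * ε) ≤ (π / δ * ε) ^ (-(1 / 2) : ℝ) := by
      rw [kerBound, abs_of_pos hp]
      exact mul_le_of_le_one_left (by positivity) (Real.exp_le_one_iff.2 (by linarith))
    have h3 : (π / δ * ε) ^ (1 / 2 : ℝ) = (π / δ * ε) * (π / δ * ε) ^ (-(1 / 2) : ℝ) := by
      rw [← Real.rpow_one_add' hp.le (by norm_num)]; norm_num
    rw [h3]
    calc ε * ‖sinhKer δ ε‖ ≤ ε * (π / δ * ε + 3 + (π / δ * ε) ^ (-(1 / 2) : ℝ)) := by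
          gcongr; linarith
      _ = _ := by field_simp

lemma sinhKer_neg (δ s : ℝ) : sinhKer δ (-s) = sinhKer δ s := by
  rw [sinhKer, mul_neg, Real.sinh_neg, Real.log_neg_eq_log, sinhKer]

lemma hasDerivAt_sinhKer {δ : ℝ} (hδ : 0 < δ) {s : ℝ} (hs : s ≠ 0) :
    HasDerivAt (sinhKer δ) ((π / δ * coth (π / δ * s) : ℝ) : ℂ) s := by
  have hc : 0 < π / δ := by positivity
  have h0 : Real.sinh (π / δ * s) ≠ 0 := Real.sinh_ne_zero.2 (mul_ne_zero hc.ne' hs)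
  have h1 : HasDerivAt (fun s : ℝ => Real.log (Real.sinh (π / δ * s)))
      (π / δ * coth (π / δ * s)) s := by
    have := (((hasDerivAt_id s).const_mul (π / δ)).sinh).log h0
    refine this.congr_deriv ?_
    simp only [coth, id]; ring
  exact h1.ofReal_comp

/-- Integration by parts for the truncated principal value integral. -/
lemma truncT_eq {δ : ℝ} (hδ : 0 < δ) {f f' : ℝ → ℂ} (hf : Continuous f) (hf' : Continuous f')
    {C C' : ℝ} (h : Dec C f) (h' : Dec C' f') (hder : ∀ x, HasDerivAt f (f' x) x) (x : ℝ)
    {ε : ℝ} (hε : 0 < ε) : truncT δ f x ε = 1 / π * (sinhKer (2 * δ) ε * (f (x - ε) - f (x + ε)) -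
      ∫ s in {s : ℝ | ε < |s|}, sinhKer (2 * δ) s * f' (x + s)) := by
  have h2δ : 0 < 2 * δ := by positivity
  have hd (s : ℝ) : HasDerivAt (fun s => f (x + s)) (f' (x + s)) s :=
    (hder (x + s)).comp_const_add x s
  have il := (lightKer_sinhKer h2δ).integrable_conv hf h x
  have il' := (lightKer_sinhKer h2δ).integrable_conv hf' h' x
  have ic : IntegrableOn (fun s : ℝ => ((π / (2 * δ) * coth (π / (2 * δ) * s) : ℝ) : ℂ) * f (x + s))
      {s : ℝ | ε < |s|} := by
    have := (integrableOn_coth_mul hδ ((h.integrable hf).comp_add_left x) 0 hε).const_mul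
      (π / (2 * δ))
    simp only [sub_zero] at this
    refine this.congr (ae_of_all _ fun s => ?_)
    push_cast; ring
  have isum := Integrable.add ic il'.integrableOn
  have hD (s : ℝ) (hs : s ≠ 0) : HasDerivAt (fun s => sinhKer (2 * δ) s * f (x + s))
      (((π / (2 * δ) * coth (π / (2 * δ) * s) : ℝ) : ℂ) * f (x + s)
        + sinhKer (2 * δ) s * f' (x + s)) s := (hasDerivAt_sinhKer h2δ hs).mul (hd s)
  have isum' : IntegrableOn (fun s => ((π / (2 * δ) * coth (π / (2 * δ) * s) : ℝ) : ℂ) * f (x + s)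
        + sinhKer (2 * δ) s * f' (x + s)) {s : ℝ | ε < |s|} := isum
  have hu := lt_abs_eq_union ε
  have i1 := isum'
  rw [hu] at i1
  have iR := i1.mono_set subset_union_right
  have iL : IntegrableOn _ (Iic (-ε)) :=
    (integrableOn_Iic_iff_integrableOn_Iio).2 (i1.mono_set subset_union_left)
  have dR (s : ℝ) (hs : s ∈ Ici ε) := hD s (by have : ε ≤ s := hs; linarith)
  have dL (s : ℝ) (hs : s ∈ Iic (-ε)) := hD s (by have : s ≤ -ε := hs; linarith)
  have tR := tendsto_zero_of_hasDerivAt_of_integrableOn_Ioi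
    (fun s hs => dR s (Ioi_subset_Ici_self hs)) iR il.integrableOn
  have tL := tendsto_zero_of_hasDerivAt_of_integrableOn_Iic
    dL iL il.integrableOn
  have eR := integral_Ioi_of_hasDerivAt_of_tendsto' dR iR tR
  have eL := integral_Iic_of_hasDerivAt_of_tendsto' dL iL tL
  have e1 := integral_lt_abs hε isum'
  rw [eR, eL, integral_add ic il'.integrableOn, sinhKer_neg] at e1
  have e2 : ∫ s in {s : ℝ | ε < |s|}, ((π / (2 * δ) * coth (π / (2 * δ) * s) : ℝ) : ℂ) * f (x + s) =
      (π / (2 * δ)) * ∫ s in {s : ℝ | ε < |s|}, (coth (π / (2 * δ) * s) : ℂ) * f (x + s) := by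
    rw [← integral_const_mul]
    congr 1; ext s; push_cast; ring
  rw [e2, ← sub_eq_add_neg] at e1
  rw [truncT, setIntegral_lt_abs_sub]
  simp only [add_sub_cancel_left]
  have h3 : (π : ℂ) ≠ 0 := by exact_mod_cast Real.pi_ne_zero
  have h4 : (δ : ℂ) ≠ 0 := by exact_mod_cast hδ.ne'
  field_simp at e1 ⊢
  linear_combination e1

/-- For a differentiable function with decay, the principal value integral `T f` exists. -/
lemma tendsto_truncT_of_dec {δ : ℝ} (hδ : 0 < δ) {f f' : ℝ → ℂ} (hf : Continuous f)
    (hf' : Continuous f') {C C' : ℝ} (h : Dec C f) (h' : Dec C' f')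
    (hder : ∀ x, HasDerivAt f (f' x) x) (x : ℝ) :
    Tendsto (truncT δ f x) (𝓝[>] 0) (𝓝 (-(1 / π) * conv (sinhKer (2 * δ)) f' x)) := by
  have h2δ : 0 < 2 * δ := by positivity
  have il' := (lightKer_sinhKer h2δ).integrable_conv hf' h' x
  have t1 : Tendsto (fun ε : ℝ => sinhKer (2 * δ) ε * (f (x - ε) - f (x + ε))) (𝓝[>] 0) (𝓝 0) := by
    have hl := (tendsto_mul_sinhKer h2δ).const_mul (2 * C')
    rw [mul_zero] at hl
    refine squeeze_zero_norm' ?_ hl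
    filter_upwards [self_mem_nhdsWithin] with ε hε
    have hε : 0 < ε := hε
    have b := Convex.norm_image_sub_le_of_norm_hasDerivWithin_le (f := f) (f' := f') (C := C')
      (s := univ) (fun y _ => (hder y).hasDerivWithinAt) (fun y _ => h'.le_const y) convex_univ
      (mem_univ (x + ε)) (mem_univ (x - ε))
    have e : ‖x - ε - (x + ε)‖ = 2 * ε := by
      rw [Real.norm_eq_abs, ← abs_neg, abs_of_pos] <;> linarith
    rw [e] at b
    rw [norm_mul]
    calc ‖sinhKer (2 * δ) ε‖ * ‖f (x - ε) - f (x + ε)‖ ≤ ‖sinhKer (2 * δ) ε‖ * (C' * (2 * ε)) := by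
          gcongr
      _ = _ := by ring
  have t2 : Tendsto (fun ε : ℝ => ∫ s in {s : ℝ | ε < |s|}, sinhKer (2 * δ) s * f' (x + s))
      (𝓝[>] 0) (𝓝 (conv (sinhKer (2 * δ)) f' x)) := by
    have hm (ε : ℝ) : MeasurableSet {s : ℝ | ε < |s|} := by simpa using measurableSet_lt_abs_sub 0 ε
    simp_rw [← integral_indicator (hm _)]
    refine tendsto_integral_filter_of_dominated_convergence
      (fun s => ‖sinhKer (2 * δ) s * f' (x + s)‖)
      (Eventually.of_forall fun ε => (il'.aestronglyMeasurable.indicator (hm ε)))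
      (Eventually.of_forall fun ε => ae_of_all _ fun s => norm_indicator_le_norm_self _ _)
      il'.norm ?_
    filter_upwards [ae_ne 0] with s hs
    have h0 : ∀ᶠ ε : ℝ in 𝓝[>] 0, ε < |s| :=
      (gt_mem_nhds (abs_pos.2 hs) : ∀ᶠ ε : ℝ in 𝓝 0, ε < |s|).filter_mono nhdsWithin_le_nhds
    refine tendsto_const_nhds.congr' ?_
    filter_upwards [h0] with ε hε
    rw [indicator_of_mem (show s ∈ {s : ℝ | ε < |s|} from hε)]
  have t3 := (t1.sub t2).const_mul (1 / π : ℂ)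
  have e : (1 / π : ℂ) * (0 - conv (sinhKer (2 * δ)) f' x) =
      -(1 / π) * conv (sinhKer (2 * δ)) f' x := by ring
  rw [e] at t3
  refine t3.congr' ?_
  filter_upwards [self_mem_nhdsWithin] with ε hε
  rw [truncT_eq hδ hf hf' h h' hder x hε]

/-- The kernel `-(1/π) log |tanh(πs/2δ)|` of `T - T̃`, acting on derivatives. -/
def diffKer (δ s : ℝ) : ℂ := -(1 / π) * (sinhKer (2 * δ) s - coshKer (2 * δ) s)

lemma heavyKer_diffKer {δ : ℝ} (hδ : 0 < δ) : HeavyKer (diffKer δ) := by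
  have h2δ : 0 < 2 * δ := by positivity
  have hc : 0 < π / (2 * δ) := by positivity
  have hm : Measurable (diffKer δ) :=
    ((lightKer_sinhKer h2δ).meas.sub (lightKer_coshKer h2δ).meas).const_mul _
  refine ⟨hm, ((integrable_kerBound_comp hc).const_mul 2).mono'
    (Measurable.aestronglyMeasurable (hm.norm.mul (by fun_prop))) ?_⟩
  filter_upwards [ae_ne 0] with s hs
  have h1 := abs_logTanh_le (mul_ne_zero hc.ne' hs)
  have h2 : ‖diffKer δ s‖ ≤ 2 * kerBound (π / (2 * δ) * s) := by
    have e : diffKer δ s = ((-(1 / π) * logTanh (π / (2 * δ) * s) : ℝ) : ℂ) := by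
      rw [diffKer, sinhKer, coshKer, logTanh]; push_cast; ring
    rw [e, Complex.norm_real, norm_mul, norm_neg, Real.norm_of_nonneg (by positivity)]
    refine le_trans ?_ h1
    refine mul_le_of_le_one_left (norm_nonneg _) ?_
    rw [div_le_one Real.pi_pos]
    linarith [Real.pi_gt_three]
  rw [norm_mul, norm_norm, Real.norm_of_nonneg (by positivity : 0 ≤ (1 + |s|) ^ 3), ← mul_assoc]
  gcongr

lemma conv_diffKer {δ : ℝ} (hδ : 0 < δ) {g : ℝ → ℂ} {C : ℝ} (hg : Continuous g) (h : Dec C g)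
    (x : ℝ) : conv (diffKer δ) g x =
      -(1 / π) * (conv (sinhKer (2 * δ)) g x - conv (coshKer (2 * δ)) g x) := by
  have h2δ : 0 < 2 * δ := by positivity
  simp only [conv]
  rw [← integral_sub ((lightKer_sinhKer h2δ).integrable_conv hg h x)
    ((lightKer_coshKer h2δ).integrable_conv hg h x), ← integral_const_mul]
  congr 1; ext s; rw [diffKer]; ring

/-- The Cauchy transform of `f` with kernel `1 / sinh`, in terms of the potential of `f'`. -/
def cauchyCsch (δ : ℝ) (f' : ℝ → ℂ) (z : ℂ) : ℂ :=
  -2 * (pot (2 * δ) f' (z - Complex.I * δ / 2) - pot (2 * δ) f' (z + Complex.I * δ / 2))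

lemma stripDecay_cauchyCsch {δ : ℝ} (hδ : 0 < δ) {f f' : ℝ → ℂ} (hf : Continuous f)
    (hf' : Continuous f') {C C' : ℝ} (h : Dec C f) (h' : Dec C' f')
    (hder : ∀ x, HasDerivAt f (f' x) x) : StripDecay δ (cauchyCsch δ f') := by
  have h2δ : 0 < 2 * δ := by positivity
  have sM (z : ℂ) (hz : z ∈ closedStrip δ) : z - Complex.I * δ / 2 ∈ closedStrip (2 * δ) := by
    simp only [closedStrip, mem_ofPred_eq] at hz ⊢
    rw [Complex.sub_im, im_I_mul_div_two]
    rw [abs_le] at hz ⊢; constructor <;> linarith [hz.1, hz.2]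
  have sP (z : ℂ) (hz : z ∈ closedStrip δ) : z + Complex.I * δ / 2 ∈ closedStrip (2 * δ) := by
    simp only [closedStrip, mem_ofPred_eq] at hz ⊢
    rw [Complex.add_im, im_I_mul_div_two]
    rw [abs_le] at hz ⊢; constructor <;> linarith [hz.1, hz.2]
  have sM' (z : ℂ) (hz : z ∈ strip δ) : z - Complex.I * δ / 2 ∈ strip (2 * δ) := by
    simp only [strip, mem_ofPred_eq] at hz ⊢
    rw [Complex.sub_im, im_I_mul_div_two]
    rw [abs_lt] at hz ⊢; constructor <;> linarith [hz.1, hz.2]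
  have sP' (z : ℂ) (hz : z ∈ strip δ) : z + Complex.I * δ / 2 ∈ strip (2 * δ) := by
    simp only [strip, mem_ofPred_eq] at hz ⊢
    rw [Complex.add_im, im_I_mul_div_two]
    rw [abs_lt] at hz ⊢; constructor <;> linarith [hz.1, hz.2]
  have rM (z : ℂ) : (z - Complex.I * δ / 2).re = z.re := by simp
  have rP (z : ℂ) : (z + Complex.I * δ / 2).re = z.re := by simp
  have hcont : ContinuousOn (cauchyCsch δ f') (closedStrip δ) := by
    have hp := continuousOn_pot_static h2δ hf' h'
    exact continuousOn_const.mul ((hp.comp (by fun_prop) sM).sub (hp.comp (by fun_prop) sP))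
  have hdiff : DifferentiableOn ℂ (cauchyCsch δ f') (strip δ) := by
    have hp : DifferentiableOn ℂ (pot (2 * δ) f') (strip (2 * δ)) := fun z hz =>
      (hasDerivAt_pot_tanh h2δ hf' h' hz).differentiableAt.differentiableWithinAt
    exact (differentiableOn_const _).mul
      ((hp.comp (by fun_prop) sM').sub (hp.comp (by fun_prop) sP'))
  have bound (a b c : ℂ) (K : ℝ) (ha : ‖a - c‖ ≤ K) (hb : ‖b - c‖ ≤ K) :
      ‖-2 * (a - b)‖ ≤ 4 * K := by
    have e : a - b = (a - c) - (b - c) := by ring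
    rw [norm_mul, e]
    have := norm_sub_le (a - c) (b - c)
    simp only [norm_neg, Complex.norm_ofNat]
    linarith
  have hr : BigORight (closedStrip δ) 2 (cauchyCsch δ f') := by
    obtain ⟨K, R, hR, hK⟩ := bigORight_pot_deriv h2δ hf hf' h h' hder
    refine ⟨4 * K, R, hR, fun z hz hzR => ?_⟩
    have h1 := hK _ (sM z hz) (by rwa [rM])
    have h2 := hK _ (sP z hz) (by rwa [rP])
    rw [rM] at h1
    rw [rP] at h2
    rw [mul_div_assoc]
    exact bound _ _ _ _ h1 h2
  have hl : BigOLeft (closedStrip δ) 2 (cauchyCsch δ f') := by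
    obtain ⟨K, R, hR, hK⟩ := bigOLeft_pot_deriv h2δ hf hf' h h' hder
    refine ⟨4 * K, R, hR, fun z hz hzR => ?_⟩
    have h1 := hK _ (sM z hz) (by rwa [rM])
    have h2 := hK _ (sP z hz) (by rwa [rP])
    rw [rM] at h1
    rw [rP] at h2
    rw [mul_div_assoc]
    exact bound _ _ (-charge (2 * δ) f) _ (by rw [sub_neg_eq_add]; exact h1)
      (by rw [sub_neg_eq_add]; exact h2)
  obtain ⟨K, -, hK⟩ := exists_bound_of_bigO hcont hr hl
  exact ⟨hcont, hdiff, K, hK⟩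

lemma cauchyCsch_boundary {δ : ℝ} (hδ : 0 < δ) {f f' : ℝ → ℂ}
    (hf' : Continuous f') {C C' : ℝ} (h : Dec C f) (h' : Dec C' f')
    (hder : ∀ x, HasDerivAt f (f' x) x) (x : ℝ) :
    cauchyCsch δ f' (x - Complex.I * δ / 2) = 1 * conv (diffKer δ) f' x + Complex.I * f x ∧
    cauchyCsch δ f' (x + Complex.I * δ / 2) = -1 * conv (diffKer δ) f' x + Complex.I * f x := by
  have h2δ : 0 < 2 * δ := by positivity
  have h3 : (π : ℂ) ≠ 0 := by exact_mod_cast Real.pi_ne_zero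
  have a1 := pot_lower_sub_upper h2δ h hf' h' hder x
  have a2 := pot_lower_add_upper h2δ hf' h' x
  have a3 := pot_ofReal (δ := 2 * δ) f' x
  have e1 : (x : ℂ) - Complex.I * δ / 2 - Complex.I * δ / 2 =
      x - Complex.I * ((2 * δ : ℝ) : ℂ) / 2 := by push_cast; ring
  have e2 : (x : ℂ) + Complex.I * δ / 2 + Complex.I * δ / 2 =
      x + Complex.I * ((2 * δ : ℝ) : ℂ) / 2 := by push_cast; ring
  have hπ : (1 / (2 * π) : ℂ) = 1 / 2 * (1 / π) := by field_simp
  rw [hπ] at a3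
  constructor
  · rw [cauchyCsch, e1, sub_add_cancel, conv_diffKer hδ hf' h']
    linear_combination -a1 - a2 + 2 * a3
  · rw [cauchyCsch, e2, add_sub_cancel_right, conv_diffKer hδ hf' h']
    linear_combination -a1 + a2 - 2 * a3

/-- `(T + T̃)(T - T̃) f = -f`, expressed through the boundary values of the potential of
`((T - T̃) f)'`. -/
theorem pot_conv_diffKer {δ : ℝ} (hδ : 0 < δ) {f f' f'' : ℝ → ℂ} (hf : Continuous f)
    (hf' : Continuous f') (hf'' : Continuous f'') {C C' C'' : ℝ} (h : Dec C f) (h' : Dec C' f')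
    (h'' : Dec C'' f'') (hder : ∀ x, HasDerivAt f (f' x) x) (hder' : ∀ x, HasDerivAt f' (f'' x) x)
    (x : ℝ) : pot δ (conv (diffKer δ) f'') (x - Complex.I * δ / 2) +
      pot δ (conv (diffKer δ) f'') (x + Complex.I * δ / 2) = f x := by
  have h2δ : 0 < 2 * δ := by positivity
  have h3 : (π : ℂ) ≠ 0 := by exact_mod_cast Real.pi_ne_zero
  have hc : 0 < π / (2 * δ) := by positivity
  have hk := heavyKer_diffKer hδ
  set g := conv (diffKer δ) f' with hg
  set g' := conv (diffKer δ) f'' with hg'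
  have gd (y : ℝ) : HasDerivAt g (g' y) y := hk.hasDerivAt_conv hf' hf'' h' h'' hder' y
  have gc : Continuous g := continuous_iff_continuousAt.2 fun y => (gd y).continuousAt
  have gc' : Continuous g' := by
    have := hk.continuous_conv (g := fun y _ => f'' y) (hf''.comp continuous_fst)
      (LocDec.const h'')
    exact this.comp (by fun_prop : Continuous fun y : ℝ => (y, (0 : ℝ)))
  have gD := hk.dec_conv h'
  have gD' := hk.dec_conv h''
  have hS := stripDecay_cauchyCsch hδ hf hf' h h' hder
  have t1 := tendsto_truncT_lower hδ hS x
  have eM : (fun y : ℝ => cauchyCsch δ f' (y - Complex.I * δ / 2)) =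
      fun y => 1 * g y + Complex.I * f y :=
    funext fun y => (cauchyCsch_boundary hδ hf' h h' hder y).1
  have eP : (fun y : ℝ => cauchyCsch δ f' (y + Complex.I * δ / 2)) =
      fun y => -1 * g y + Complex.I * f y :=
    funext fun y => (cauchyCsch_boundary hδ hf' h h' hder y).2
  rw [eM, eP, (cauchyCsch_boundary hδ hf' h h' hder x).1] at t1
  have comb (a : ℂ) : Continuous (fun y => a * g y + Complex.I * f y) ∧
      Continuous (fun y => a * g' y + Complex.I * f' y) ∧
      ∀ y, HasDerivAt (fun y => a * g y + Complex.I * f y) (a * g' y + Complex.I * f' y) y :=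
    ⟨by fun_prop, by fun_prop, fun y => ((gd y).const_mul a).add ((hder y).const_mul Complex.I)⟩
  have t2 := tendsto_truncT_of_dec hδ (comb 1).1 (comb 1).2.1
    ((gD.const_mul 1).add (h.const_mul Complex.I))
    ((gD'.const_mul 1).add (h'.const_mul Complex.I)) (comb 1).2.2 x
  have t3 := opTt_eq_conv hδ (comb (-1)).1 (comb (-1)).2.1
    ((gD.const_mul (-1)).add (h.const_mul Complex.I))
    ((gD'.const_mul (-1)).add (h'.const_mul Complex.I)) (comb (-1)).2.2 x
  have key := tendsto_nhds_unique t1 t2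
  rw [t3, (lightKer_coshKer h2δ).conv_add gc' hf' gD' h',
    (lightKer_sinhKer h2δ).conv_add gc' hf' gD' h'] at key
  have egx : g x = -(1 / π) * (conv (sinhKer (2 * δ)) f' x - conv (coshKer (2 * δ)) f' x) :=
    conv_diffKer hδ hf' h' x
  -- doubling
  have hdouble : conv (sinhKer δ) g' x =
      conv (sinhKer (2 * δ)) g' x + conv (coshKer (2 * δ)) g' x := by
    have z0 : ∫ s, g' (x + s) = 0 := by
      rw [integral_add_left_eq_self g' x]
      exact integral_deriv_eq_zero gd gD gc' gD'
    have i1 := (lightKer_sinhKer h2δ).integrable_conv gc' gD' x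
    have i2 := (lightKer_coshKer h2δ).integrable_conv gc' gD' x
    have i3 : Integrable fun s => (Real.log 2 : ℂ) * g' (x + s) :=
      ((gD'.integrable gc').comp_add_left x).const_mul _
    have i12 : Integrable fun s => sinhKer (2 * δ) s * g' (x + s) +
      coshKer (2 * δ) s * g' (x + s) := i1.add i2
    have e : (fun s => sinhKer δ s * g' (x + s)) =ᵐ[volume] fun s =>
        (sinhKer (2 * δ) s * g' (x + s) + coshKer (2 * δ) s * g' (x + s)) +
        (Real.log 2 : ℂ) * g' (x + s) := by
      filter_upwards [ae_ne 0] with s hs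
      have e1 : π / δ * s = 2 * (π / (2 * δ) * s) := by field_simp
      have e2 : Real.sinh (π / (2 * δ) * s) ≠ 0 := Real.sinh_ne_zero.2 (mul_ne_zero hc.ne' hs)
      have e3 : sinhKer δ s = Real.log 2 + sinhKer (2 * δ) s + coshKer (2 * δ) s := by
        rw [sinhKer, sinhKer, coshKer, e1, Real.sinh_two_mul,
          Real.log_mul (mul_ne_zero two_ne_zero e2) (Real.cosh_pos _).ne',
          Real.log_mul two_ne_zero e2]
        push_cast; ring
      rw [e3]; ring
    rw [conv, integral_congr_ae e, integral_add i12 i3, integral_add i1 i2, integral_const_mul, z0,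
      mul_zero, add_zero, conv, conv]
  rw [pot_lower_add_upper hδ gc' gD', hdouble]
  linear_combination key - Complex.I * egx - f x * Complex.I_sq

/-- `J k` (`k ≤ n`) are the `x`-derivatives of `J 0` and `Jt k` (`k ≤ m`) the `t`-derivatives of
`J k`, all of them jointly continuous and of cubic decay, locally uniformly in `t`. -/
structure DecayTower (n m : ℕ) (J Jt : ℕ → ℝ → ℝ → ℂ) : Prop where
  cont : ∀ k ≤ n, Continuous (Function.uncurry (J k))
  dec : ∀ k ≤ n, LocDec (J k)
  deriv_x : ∀ k < n, ∀ x t, HasDerivAt (fun y => J k y t) (J (k + 1) x t) x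
  cont_t : ∀ k ≤ m, Continuous (Function.uncurry (Jt k))
  dec_t : ∀ k ≤ m, LocDec (Jt k)
  deriv_t : ∀ k ≤ m, ∀ x t, HasDerivAt (fun s => J k x s) (Jt k x t) t

lemma continuous_slice {g : ℝ → ℝ → ℂ} (hg : Continuous (Function.uncurry g)) (t : ℝ) :
    Continuous fun x => g x t := hg.comp (by fun_prop : Continuous fun x : ℝ => (x, t))

lemma DecayTower.mono {n m n' m' : ℕ} {J Jt : ℕ → ℝ → ℝ → ℂ} (h : DecayTower n m J Jt)
    (hn : n' ≤ n) (hm : m' ≤ m) : DecayTower n' m' J Jt :=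
  ⟨fun k hk => h.cont k (hk.trans hn), fun k hk => h.dec k (hk.trans hn),
    fun k hk => h.deriv_x k (hk.trans_le hn), fun k hk => h.cont_t k (hk.trans hm),
    fun k hk => h.dec_t k (hk.trans hm), fun k hk => h.deriv_t k (hk.trans hm)⟩

lemma DecayTower.add {n m : ℕ} {J Jt K Kt : ℕ → ℝ → ℝ → ℂ} (h : DecayTower n m J Jt)
    (h' : DecayTower n m K Kt) :
    DecayTower n m (fun k x t => J k x t + K k x t) fun k x t => Jt k x t + Kt k x t :=
  ⟨fun k hk => (h.cont k hk).add (h'.cont k hk), fun k hk => (h.dec k hk).add (h'.dec k hk),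
    fun k hk x t => (h.deriv_x k hk x t).fun_add (h'.deriv_x k hk x t),
    fun k hk => (h.cont_t k hk).add (h'.cont_t k hk),
    fun k hk => (h.dec_t k hk).add (h'.dec_t k hk),
    fun k hk x t => (h.deriv_t k hk x t).fun_add (h'.deriv_t k hk x t)⟩

lemma DecayTower.const_mul {n m : ℕ} {J Jt : ℕ → ℝ → ℝ → ℂ} (h : DecayTower n m J Jt) (a : ℂ) :
    DecayTower n m (fun k x t => a * J k x t) fun k x t => a * Jt k x t :=
  ⟨fun k hk => continuous_const.mul (h.cont k hk), fun k hk => (h.dec k hk).const_mul a,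
    fun k hk x t => (h.deriv_x k hk x t).const_mul a,
    fun k hk => continuous_const.mul (h.cont_t k hk),
    fun k hk => (h.dec_t k hk).const_mul a,
    fun k hk x t => (h.deriv_t k hk x t).const_mul a⟩

lemma DecayTower.shift {n m : ℕ} {J Jt : ℕ → ℝ → ℝ → ℂ} (h : DecayTower (n + 1) (m + 1) J Jt) :
    DecayTower n m (fun k => J (k + 1)) fun k => Jt (k + 1) :=
  ⟨fun k hk => h.cont _ (by lia), fun k hk => h.dec _ (by lia),
    fun k hk => h.deriv_x _ (by lia), fun k hk => h.cont_t _ (by lia),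
    fun k hk => h.dec_t _ (by lia), fun k hk => h.deriv_t _ (by lia)⟩

lemma DecayTower.conv {n m : ℕ} {J Jt : ℕ → ℝ → ℝ → ℂ} (h : DecayTower n m J Jt) (hmn : m ≤ n)
    {κ : ℝ → ℂ} (hκ : HeavyKer κ) :
    DecayTower n m (fun k x t => conv κ (fun y => J k y t) x)
      fun k x t => conv κ (fun y => Jt k y t) x where
  cont k hk := hκ.continuous_conv (h.cont k hk) (h.dec k hk)
  dec k hk := hκ.locDec_conv (h.dec k hk)
  deriv_x k hk x t := by
    obtain ⟨C, hC⟩ := (h.dec k hk.le).dec t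
    obtain ⟨C', hC'⟩ := (h.dec (k + 1) hk).dec t
    exact hκ.hasDerivAt_conv (continuous_slice (h.cont k hk.le) t)
      (continuous_slice (h.cont (k + 1) hk) t) hC hC' (fun x => h.deriv_x k hk x t) x
  cont_t k hk := hκ.continuous_conv (h.cont_t k hk) (h.dec_t k hk)
  dec_t k hk := hκ.locDec_conv (h.dec_t k hk)
  deriv_t k hk x t :=
    hκ.hasDerivAt_conv_t (continuous_slice (h.cont k (hk.trans hmn)))
      (continuous_slice (h.cont_t k hk)) (h.dec k (hk.trans hmn)) (h.dec_t k hk)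
      (h.deriv_t k hk) x t

lemma contDiff_deriv_fst {n m : WithTop ℕ∞} {g : ℝ → ℝ → ℂ} (hg : ContDiff ℝ m (Function.uncurry g))
    (h : n + 1 ≤ m) : ContDiff ℝ n (Function.uncurry fun x t => deriv (fun y => g y t) x) := by
  have h1 : (Function.uncurry fun x t => deriv (fun y => g y t) x) =
      fun p => fderiv ℝ (Function.uncurry g) p (1, 0) := by
    ext ⟨x, t⟩
    have hd : HasFDerivAt (Function.uncurry g) (fderiv ℝ (Function.uncurry g) (x, t)) (x, t) :=
      (hg.differentiable (ne_of_gt (lt_of_lt_of_le (by simp) h)) _).hasFDerivAt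
    exact (hd.comp_hasDerivAt x ((hasDerivAt_id x).prodMk (hasDerivAt_const x t))).deriv
  rw [h1]
  exact (hg.fderiv_right h).clm_apply contDiff_const

lemma contDiff_deriv_snd {n m : WithTop ℕ∞} {g : ℝ → ℝ → ℂ} (hg : ContDiff ℝ m (Function.uncurry g))
    (h : n + 1 ≤ m) : ContDiff ℝ n (Function.uncurry fun x t => deriv (fun s => g x s) t) := by
  have hs : ContDiff ℝ m (Function.uncurry fun t x => g x t) := hg.comp (contDiff_snd.prodMk contDiff_fst)
  exact (contDiff_deriv_fst hs h).comp (contDiff_snd.prodMk contDiff_fst)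

lemma RegularDecaying.decayTower {u : ℝ → ℝ → ℂ} (hu : RegularDecaying u) :
    DecayTower 4 3 (fun k x t => iteratedDeriv k (fun y => u y t) x)
      fun k x t => deriv (fun s => iteratedDeriv k (fun y => u y s) x) t := by
  have hC (k : ℕ) (hk : k ≤ 4) : ContDiff ℝ ((4 - k : ℕ) : WithTop ℕ∞)
      (Function.uncurry fun x t => iteratedDeriv k (fun y => u y t) x) := by
    induction k with
    | zero => simpa using hu.contDiff
    | succ k ih =>
      simp only [iteratedDeriv_succ]
      refine contDiff_deriv_fst (ih (by lia)) ?_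
      exact_mod_cast (by lia : 4 - (k + 1) + 1 ≤ 4 - k)
  have hd (k : ℕ) (hk : k < 4) : Differentiable ℝ
      (Function.uncurry fun x t => iteratedDeriv k (fun y => u y t) x) :=
    (hC k hk.le).differentiable (by exact_mod_cast (by lia : 4 - k ≠ 0))
  refine ⟨fun k hk => (hC k hk).continuous, fun k hk T => ?_, fun k hk x t => ?_, fun k hk => ?_,
    fun k hk T => ?_, fun k hk x t => ?_⟩
  · obtain ⟨C, hC⟩ := hu.decay_x T
    exact ⟨C, fun t ht x => hC k hk x t ht⟩
  · rw [iteratedDeriv_succ]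
    exact ((hd k hk).comp (by fun_prop : Differentiable ℝ fun y : ℝ => (y, t)) x).hasDerivAt
  · refine (contDiff_deriv_snd (n := 0) (hC k (by lia)) ?_).continuous
    exact_mod_cast (by lia : 0 + 1 ≤ 4 - k)
  · obtain ⟨C, hC⟩ := hu.decay_t T
    exact ⟨C, fun t ht x => hC k hk x t ht⟩
  · exact ((hd k (by lia)).comp (by fun_prop : Differentiable ℝ fun s : ℝ => (x, s)) t).hasDerivAt

lemma LocDec.comp_neg {g : ℝ → ℝ → ℂ} (hg : LocDec g) : LocDec fun x t => g (-x) t := fun T => by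
  obtain ⟨C, hC⟩ := hg T
  exact ⟨C, fun t ht => (hC t ht).comp_neg⟩

lemma hasDerivAt_moment (δ : ℝ) {g g' : ℝ → ℝ → ℂ}
    (hc : ∀ t, Continuous fun x => g x t) (hc' : ∀ t, Continuous fun x => g' x t)
    (hd : LocDec g) (hd' : LocDec g') (hder : ∀ x t, HasDerivAt (fun s => g x s) (g' x t) t)
    (t : ℝ) : HasDerivAt (fun t => moment δ fun x => g x t) (moment δ fun x => g' x t) t := by
  have e (f : ℝ → ℂ) : moment δ f =
      1 / (2 * π) * ∫ s : ℝ, (-(π / δ) * s + -Real.log 2 : ℂ) * f s := by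
    rw [moment]
    refine congrArg _ (integral_congr_ae (ae_of_all _ fun s => ?_))
    beta_reduce
    ring
  simp only [e]
  exact ((lightKer_affine _ _).hasDerivAt hc hc' hd hd' hder t).const_mul _

/-- The potential of a decaying density with conserved charge is a regular logarithm. -/
lemma DecayTower.isRegularLog {δ : ℝ} (hδ : 0 < δ) {J Jt : ℕ → ℝ → ℝ → ℂ}
    (h : DecayTower 3 1 J Jt) {q : ℂ} (hq : ∀ t, charge δ (fun x => J 0 x t) = q)
    (hqt : ∀ t, charge δ (fun x => Jt 0 x t) = 0) {α : ℝ → ℂ} (hα : Differentiable ℝ α) :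
    IsRegularLog δ (fun z t => Complex.exp (pot δ (fun x => J 0 x t) z + α t))
      (fun z t => pot δ (fun x => J 0 x t) z + α t) q
      (fun t => moment δ (fun x => J 0 x t) + α t)
      fun t => moment δ (fun x => J 0 (-x) t) + α t := by
  have c0 (k) (hk : k ≤ 3) (t) := continuous_slice (h.cont k hk) t
  have ct (t) := continuous_slice (h.cont_t 0 (by simp)) t
  have hm := hasDerivAt_moment δ (c0 0 (by simp)) ct (h.dec 0 (by simp)) (h.dec_t 0 (by simp))
    (h.deriv_t 0 (by simp))
  have hm' := hasDerivAt_moment δ (fun t => (c0 0 (by simp) t).comp continuous_neg)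
    (fun t => (ct t).comp continuous_neg) (h.dec 0 (by simp)).comp_neg (h.dec_t 0 (by simp)).comp_neg
    (fun x => h.deriv_t 0 (by simp) (-x))
  simp only [Function.comp_def] at hm'
  refine ⟨fun z _ t => rfl, ⟨fun t => ((hm t).differentiableAt.add (hα t)),
    fun t => ((hm' t).differentiableAt.add (hα t)), fun t => ?_, fun t => ?_⟩, ?_⟩
  · obtain ⟨C, hC⟩ := (h.dec 0 (by simp)).dec t
    convert bigORight_pot hδ (c0 0 (by simp) t) hC using 2 with z
    rw [hq]; ring
  · obtain ⟨C, hC⟩ := (h.dec 0 (by simp)).dec t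
    convert bigOLeft_pot hδ (c0 0 (by simp) t) hC using 2 with z
    rw [hq]; ring
  refine ⟨fun k z t => pot δ (fun x => J k x t) z + if k = 0 then α t else 0,
    fun z t => pot δ (fun x => Jt 0 x t) z + deriv α t, fun z t => pot δ (fun x => Jt 1 x t) z,
    by simp, fun k hk t z hz => ?_, fun k hk t => ?_, fun z hz t => ?_, fun z hz t => ?_, ?_,
    fun t => ?_⟩
  · obtain ⟨C, hC⟩ := (h.dec k hk.le).dec t
    obtain ⟨C', hC'⟩ := (h.dec (k + 1) hk).dec t
    simpa using (hasDerivAt_pot hδ (c0 k hk.le t) (c0 (k + 1) hk t) hC hC'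
      (fun x => h.deriv_x k hk x t) hz).add_const (if k = 0 then α t else 0)
  · obtain ⟨C, hC⟩ := (h.dec k hk).dec t
    exact (continuousOn_pot_static hδ (c0 k hk t) hC).add continuousOn_const
  · exact (hasDerivAt_pot_t hδ (c0 0 (by simp)) ct (h.dec 0 (by simp)) (h.dec_t 0 (by simp))
      (h.deriv_t 0 (by simp)) hz t).fun_add (hα t).hasDerivAt
  · simpa using hasDerivAt_pot_t hδ (c0 1 (by simp)) (continuous_slice (h.cont_t 1 le_rfl))
      (h.dec 1 (by simp)) (h.dec_t 1 le_rfl) (h.deriv_t 1 le_rfl) hz t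
  · exact continuousOn_pot hδ (h.cont_t 1 le_rfl) (h.dec_t 1 le_rfl)
  obtain ⟨C₀, h₀⟩ := (h.dec 0 (by simp)).dec t
  obtain ⟨C₁, h₁⟩ := (h.dec 1 (by simp)).dec t
  obtain ⟨C₂, h₂⟩ := (h.dec 2 (by simp)).dec t
  obtain ⟨C₃, h₃⟩ := (h.dec 3 (by simp)).dec t
  obtain ⟨Ct, ht⟩ := (h.dec_t 0 (by simp)).dec t
  have d0 (x) := h.deriv_x 0 (by simp) x t
  have d1 (x) := h.deriv_x 1 (by simp) x t
  have d2 (x) := h.deriv_x 2 (by simp) x t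
  have k0 := c0 0 (by simp) t
  have k1 := c0 1 (by simp) t
  have k2 := c0 2 (by simp) t
  have k3 := c0 3 (by simp) t
  have q1 := charge_deriv (δ := δ) k1 h₀ h₁ d0
  have q2 := charge_deriv (δ := δ) k2 h₁ h₂ d1
  have r1 := bigORight_pot_deriv hδ k0 k1 h₀ h₁ d0
  have r2 := bigORight_pot_deriv hδ k1 k2 h₁ h₂ d1
  have r3 := bigORight_pot_deriv hδ k2 k3 h₂ h₃ d2
  have l1 := bigOLeft_pot_deriv hδ k0 k1 h₀ h₁ d0
  have l2 := bigOLeft_pot_deriv hδ k1 k2 h₁ h₂ d1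
  have l3 := bigOLeft_pot_deriv hδ k2 k3 h₂ h₃ d2
  rw [hq] at r1 l1
  rw [q1] at r2 l2
  rw [q2] at r3 l3
  simp only [sub_zero, add_zero] at r2 r3 l2 l3
  simp only [one_ne_zero, OfNat.ofNat_ne_zero, if_false, add_zero]
  refine ⟨r1, l1, r2, l2, r3, l3, ?_, ?_⟩
  · convert bigORight_pot hδ (ct t) ht using 2 with z
    rw [((hm t).fun_add (hα t).hasDerivAt).deriv, hqt]; ring
  · convert bigOLeft_pot hδ (ct t) ht using 2 with z
    rw [((hm' t).fun_add (hα t).hasDerivAt).deriv, hqt]; ring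

lemma HeavyKer.lightKer {k : ℝ → ℂ} (hk : HeavyKer k) : LightKer k := by
  simpa using hk.lightKer_shift 0

lemma opT_sub_opTt {δ : ℝ} (hδ : 0 < δ) {f f' : ℝ → ℂ} (hf : Continuous f) (hf' : Continuous f')
    {C C' : ℝ} (h : Dec C f) (h' : Dec C' f') (hder : ∀ x, HasDerivAt f (f' x) x) (x : ℝ) :
    opT δ f x - opTt δ f x = conv (diffKer δ) f' x := by
  rw [opT, (tendsto_truncT_of_dec hδ hf hf' h h' hder x).limUnder_eq,
    opTt_eq_conv hδ hf hf' h h' hder, conv_diffKer hδ hf' h']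
  ring

/-- `∂_x^k ((u + v) / 2 + a (T - T̃) (u - v))`. -/
def density (δ : ℝ) (u v : ℝ → ℝ → ℂ) (a : ℂ) (k : ℕ) (x t : ℝ) : ℂ :=
  1 / 2 * (iteratedDeriv k (fun y => u y t) x + iteratedDeriv k (fun y => v y t) x) +
    a * conv (diffKer δ) (fun z => iteratedDeriv (k + 1) (fun y => u y t) z +
      -1 * iteratedDeriv (k + 1) (fun y => v y t) z) x

/-- `∂_t ∂_x^k ((u + v) / 2 + a (T - T̃) (u - v))`. -/
def densityT (δ : ℝ) (u v : ℝ → ℝ → ℂ) (a : ℂ) (k : ℕ) (x t : ℝ) : ℂ :=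
  1 / 2 * (deriv (fun s => iteratedDeriv k (fun y => u y s) x) t +
      deriv (fun s => iteratedDeriv k (fun y => v y s) x) t) +
    a * conv (diffKer δ) (fun z => deriv (fun s => iteratedDeriv (k + 1) (fun y => u y s) z) t +
      -1 * deriv (fun s => iteratedDeriv (k + 1) (fun y => v y s) z) t) x

section

variable {δ : ℝ} {u v : ℝ → ℝ → ℂ}

lemma RegularDecaying.density (hδ : 0 < δ) (hu : RegularDecaying u) (hv : RegularDecaying v)
    (a : ℂ) : DecayTower 3 1 (density δ u v a) (densityT δ u v a) := by
  have h1 := (hu.decayTower.add hv.decayTower).const_mul (1 / 2)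
  have h2 := ((hu.decayTower.add (hv.decayTower.const_mul (-1))).shift.conv (by simp)
    (heavyKer_diffKer hδ)).const_mul a
  exact ((h1.mono (by simp) (by simp)).add h2).mono le_rfl (by simp)

/-- The regularity of `u(·, t)` at a fixed time. -/
lemma RegularDecaying.slice (hu : RegularDecaying u) {k : ℕ} (hk : k < 4) (t : ℝ) :
    Continuous (iteratedDeriv k fun y => u y t) ∧
    Continuous (iteratedDeriv (k + 1) fun y => u y t) ∧
    (∃ C, Dec C (iteratedDeriv k fun y => u y t)) ∧
    (∃ C, Dec C (iteratedDeriv (k + 1) fun y => u y t)) ∧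
    ∀ x, HasDerivAt (iteratedDeriv k fun y => u y t) (iteratedDeriv (k + 1) (fun y => u y t) x) x :=
  ⟨continuous_slice (hu.decayTower.cont k hk.le) t,
    continuous_slice (hu.decayTower.cont (k + 1) hk) t, (hu.decayTower.dec k hk.le).dec t,
    (hu.decayTower.dec (k + 1) hk).dec t, fun x => hu.decayTower.deriv_x k hk x t⟩

lemma RegularDecaying.opT_sub_opTt (hδ : 0 < δ) (hu : RegularDecaying u) {k : ℕ} (hk : k < 4)
    (x t : ℝ) : opT δ (iteratedDeriv k fun y => u y t) x - opTt δ (iteratedDeriv k fun y => u y t) x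
      = conv (diffKer δ) (iteratedDeriv (k + 1) fun y => u y t) x := by
  obtain ⟨c, c', ⟨C, h⟩, ⟨C', h'⟩, hd⟩ := hu.slice hk t
  exact NonchiralILW.opT_sub_opTt hδ c c' h h' hd x

lemma density_zero (hδ : 0 < δ) (hu : RegularDecaying u) (hv : RegularDecaying v) (a : ℂ)
    (x t : ℝ) : NonchiralILW.density δ u v a 0 x t = 1 / 2 * (u x t + v x t) +
      a * ((opT δ (fun y => u y t) x - opTt δ (fun y => u y t) x) -
        (opT δ (fun y => v y t) x - opTt δ (fun y => v y t) x)) := by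
  obtain ⟨-, c, -, ⟨C, h⟩, -⟩ := hu.slice (k := 0) (by simp) t
  obtain ⟨-, c', -, ⟨C', h'⟩, -⟩ := hv.slice (k := 0) (by simp) t
  have e := (heavyKer_diffKer hδ).lightKer.conv_add c c' h h' 1 (-1) x
  have e1 := hu.opT_sub_opTt hδ (k := 0) (by simp) x t
  have e2 := hv.opT_sub_opTt hδ (k := 0) (by simp) x t
  simp only [one_mul] at e
  simp only [iteratedDeriv_zero] at e1 e2
  rw [NonchiralILW.density, e, e1, e2]
  simp only [iteratedDeriv_zero]
  ring

lemma uPlus_add_vPlus (hδ : 0 < δ) (hu : RegularDecaying u) (hv : RegularDecaying v) :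
    (fun x t => uPlus δ u v x t + vPlus δ u v x t) =
      NonchiralILW.density δ u v (-Complex.I / 2) 0 := by
  ext x t
  rw [density_zero hδ hu hv, uPlus, vPlus]
  ring

lemma uMinus_add_vMinus (hδ : 0 < δ) (hu : RegularDecaying u) (hv : RegularDecaying v) :
    (fun x t => uMinus δ u v x t + vMinus δ u v x t) =
      NonchiralILW.density δ u v (Complex.I / 2) 0 := by
  ext x t
  rw [density_zero hδ hu hv, uMinus, vMinus]
  ring

lemma RegularDecaying.integral_self_mul_deriv (hu : RegularDecaying u) (t : ℝ) :
    Integrable (fun x => u x t * dx u x t) ∧ ∫ x, u x t * dx u x t = 0 := by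
  obtain ⟨c, c', ⟨C, h⟩, ⟨C', h'⟩, hd⟩ := hu.slice (k := 0) (by simp) t
  simp only [iteratedDeriv_zero, zero_add, iteratedDeriv_one] at c c' h h' hd
  have dm {C C' : ℝ} {f g : ℝ → ℂ} (h : Dec C f) (h' : Dec C' g) :
      Dec (C * C') fun x => f x * g x := fun x => by
    rw [norm_mul, mul_div_assoc]
    exact mul_le_mul (h.le_const x) (h' x) (norm_nonneg _) h.nonneg
  have hder (x : ℝ) := ((hd x).fun_mul (hd x)).const_mul (1 / 2 : ℂ)
  have e (x : ℝ) : (1 / 2 : ℂ) * (dx u x t * u x t + u x t * dx u x t) = u x t * dx u x t := by ring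
  have hder' (x : ℝ) : HasDerivAt (fun x => 1 / 2 * (u x t * u x t)) (u x t * dx u x t) x := by
    rw [← e]; exact hder x
  exact ⟨(dm h h').integrable (c.mul c'),
    integral_deriv_eq_zero hder' ((dm h h).const_mul _) (c.mul c') (dm h h')⟩

lemma integral_dt_add_dt (hδ : 0 < δ) (hu : RegularDecaying u) (hv : RegularDecaying v)
    (hs : IsSolution δ u v) (t : ℝ) : ∫ x, (dt u x t + dt v x t) = 0 := by
  have hk := heavyKer_diffKer hδ
  obtain ⟨iu, eu⟩ := hu.integral_self_mul_deriv t
  obtain ⟨iv, ev⟩ := hv.integral_self_mul_deriv t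
  have cv {w : ℝ → ℝ → ℂ} (hw : RegularDecaying w) :
      Integrable (fun x => conv (diffKer δ) (iteratedDeriv 3 fun y => w y t) x) ∧
      ∫ x, conv (diffKer δ) (iteratedDeriv 3 fun y => w y t) x = 0 := by
    obtain ⟨c, c', ⟨C, h⟩, ⟨C', h'⟩, hd⟩ := hw.slice (k := 2) (by simp) t
    refine ⟨(hk.dec_conv h').integrable ?_, hk.integral_conv_deriv hd h c' h'⟩
    exact continuous_slice (hk.continuous_conv (hw.decayTower.cont 3 (by simp))
      (hw.decayTower.dec 3 (by simp))) t
  obtain ⟨ju, fu⟩ := cv hu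
  obtain ⟨jv, fv⟩ := cv hv
  have e (x : ℝ) : dt u x t + dt v x t = (-2 * (u x t * dx u x t) + 2 * (v x t * dx v x t)) +
      (conv (diffKer δ) (iteratedDeriv 3 fun y => v y t) x -
        conv (diffKer δ) (iteratedDeriv 3 fun y => u y t) x) := by
    have e1 := hs.eq_u x t
    have e2 := hs.eq_v x t
    have e3 := hu.opT_sub_opTt hδ (k := 2) (by simp) x t
    have e4 := hv.opT_sub_opTt hδ (k := 2) (by simp) x t
    have d1 : dxx u t = iteratedDeriv 2 fun y => u y t := rfl
    have d2 : dxx v t = iteratedDeriv 2 fun y => v y t := rfl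
    rw [d1, d2] at e1 e2
    simp only [Nat.reduceAdd] at e3 e4
    linear_combination e1 + e2 - e3 + e4
  simp_rw [e]
  have i1 : Integrable fun x => -2 * (u x t * dx u x t) + 2 * (v x t * dx v x t) :=
    (iu.const_mul _).add (iv.const_mul _)
  have i2 : Integrable fun x => conv (diffKer δ) (iteratedDeriv 3 fun y => v y t) x -
      conv (diffKer δ) (iteratedDeriv 3 fun y => u y t) x := jv.sub ju
  rw [integral_add i1 i2, integral_add (iu.const_mul _) (iv.const_mul _), integral_sub jv ju,
    integral_const_mul, integral_const_mul, eu, ev, fu, fv]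
  simp

/-- The conserved quantity `∫ (u + v) dx / (4δ)` is the charge of both densities. -/
lemma charge_density (hδ : 0 < δ) (hu : RegularDecaying u) (hv : RegularDecaying v)
    (hs : IsSolution δ u v) (a : ℂ) (t : ℝ) :
    charge δ (fun x => NonchiralILW.density δ u v a 0 x t) =
      charge δ (fun x => 1 / 2 * (u x 0 + v x 0)) ∧
    charge δ (fun x => densityT δ u v a 0 x t) = 0 := by
  have hk := heavyKer_diffKer hδ
  have hJ := hu.density hδ hv a
  have hσ := (hu.decayTower.add hv.decayTower).const_mul (1 / 2)
  have hf := hu.decayTower.add (hv.decayTower.const_mul (-1))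
  have dcharge {J Jt : ℕ → ℝ → ℝ → ℂ} {n m : ℕ} (h : DecayTower n m J Jt) (t : ℝ) :
      HasDerivAt (fun t => charge δ fun x => J 0 x t) (charge δ fun x => Jt 0 x t) t := by
    have := ((lightKer_affine 0 1).hasDerivAt (continuous_slice (h.cont 0 (by simp)))
      (continuous_slice (h.cont_t 0 (by simp))) (h.dec 0 (by simp)) (h.dec_t 0 (by simp))
      (h.deriv_t 0 (by simp)) t).const_mul (1 / (2 * δ) : ℂ)
    simpa only [charge, zero_mul, zero_add, one_mul] using this
  have h1 (t : ℝ) : charge δ (fun x => NonchiralILW.density δ u v a 0 x t) =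
      charge δ (fun x => 1 / 2 * (u x t + v x t)) := by
    obtain ⟨C, hC⟩ := (hσ.dec 0 (by simp)).dec t
    obtain ⟨C₀, h₀⟩ := (hf.dec 0 (by simp)).dec t
    obtain ⟨C₁, h₁⟩ := (hf.dec 1 (by simp)).dec t
    have c1 := continuous_slice (hf.cont 1 (by simp)) t
    have i1 := hC.integrable (continuous_slice (hσ.cont 0 (by simp)) t)
    have i2 := ((hk.dec_conv h₁).integrable (continuous_slice
      (hk.continuous_conv (hf.cont 1 (by simp)) (hf.dec 1 (by simp))) t)).const_mul a
    have z := hk.integral_conv_deriv (fun x => hf.deriv_x 0 (by simp) x t) h₀ c1 h₁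
    have := integral_add i1 i2
    simp only [zero_add] at z
    rw [integral_const_mul a, z, mul_zero, add_zero] at this
    simp only [charge]
    refine congrArg _ (Eq.trans this ?_)
    simp
  have h2 (t : ℝ) : HasDerivAt (fun t => charge δ fun x => 1 / 2 * (u x t + v x t)) 0 t := by
    have := dcharge hσ t
    simp only [iteratedDeriv_zero] at this
    refine this.congr_deriv ?_
    rw [charge, integral_const_mul]
    have := integral_dt_add_dt hδ hu hv hs t
    simp only [dt] at this
    rw [this]; simp
  have h3 (t : ℝ) : charge δ (fun x => NonchiralILW.density δ u v a 0 x t) =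
      charge δ (fun x => 1 / 2 * (u x 0 + v x 0)) := by
    rw [h1]
    exact is_const_of_deriv_eq_zero (fun t => (h2 t).differentiableAt) (fun t => (h2 t).deriv) t 0
  refine ⟨h3 t, ?_⟩
  have h4 := dcharge hJ t
  simp only [h3] at h4
  exact h4.unique (hasDerivAt_const t _)

end

lemma IsRegularLog.isLog {δ : ℝ} {F L : ℂ → ℝ → ℂ} {f₁ : ℂ} {fp fm : ℝ → ℂ}
    (h : IsRegularLog δ F L f₁ fp fm) : IsLog δ F L f₁ fp fm := by
  have hsub := strip_subset_closedStrip δ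
  refine ⟨fun z hz t => h.exp_eq z (hsub hz) t, fun t => ?_, h.asymp.diff_fp, h.asymp.diff_fm,
    fun t => ?_, fun t => ?_⟩
  · obtain ⟨D, Lt, D1t, rfl, hd, -⟩ := h.regular
    exact fun z hz => (hd 0 (by simp) t z hz).differentiableAt.differentiableWithinAt
  · obtain ⟨C, R, hR, hC⟩ := h.asymp.right t
    exact ⟨C, R, hR, fun z hz => hC z (hsub hz)⟩
  · obtain ⟨C, R, hR, hC⟩ := h.asymp.left t
    exact ⟨C, R, hR, fun z hz => hC z (hsub hz)⟩

lemma eq_of_tendsto_affine {a b : ℂ}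
    (h : Tendsto (fun x : ℝ => a + b * x) atTop (𝓝 0)) : a = 0 := by
  have h1 : Tendsto (fun x : ℝ => a + b * (x + 1 : ℝ)) atTop (𝓝 0) :=
    h.comp (tendsto_atTop_add_const_right _ 1 tendsto_id)
  have h2 := h1.sub h
  have hb : b = 0 := by
    rw [sub_self] at h2
    exact tendsto_nhds_unique tendsto_const_nhds
      (h2.congr (f₂ := fun _ => b) fun x => by push_cast; ring)
  subst hb
  simpa using h

/-- Two logarithms with the same derivative differ by the difference of their asymptotics. -/
lemma IsLog.sub_eq {δ : ℝ} (hδ : 0 < δ) {F₁ F₂ L₁ L₂ : ℂ → ℝ → ℂ} {q₁ q₂ : ℂ}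
    {p₁ m₁ p₂ m₂ : ℝ → ℂ} (h₁ : IsLog δ F₁ L₁ q₁ p₁ m₁) (h₂ : IsLog δ F₂ L₂ q₂ p₂ m₂)
    {t : ℝ} (h : ∀ z ∈ strip δ, logDeriv (fun w => F₁ w t) z = logDeriv (fun w => F₂ w t) z)
    {z : ℂ} (hz : z ∈ strip δ) : L₂ z t = L₁ z t + (p₂ t - p₁ t) := by
  have hopen : IsOpen (strip δ) := isOpen_strip δ
  have ld {F L : ℂ → ℝ → ℂ} {q : ℂ} {p m : ℝ → ℂ} (h : IsLog δ F L q p m) {z : ℂ}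
      (hz : z ∈ strip δ) : HasDerivAt (fun w => L w t) (logDeriv (fun w => F w t) z) z := by
    have hd := ((h.analytic t).differentiableAt (hopen.mem_nhds hz)).hasDerivAt
    have he : (fun w => F w t) =ᶠ[𝓝 z] fun w => Complex.exp (L w t) := by
      filter_upwards [hopen.mem_nhds hz] with w hw using h.exp_eq w hw t
    rwa [logDeriv_apply, he.deriv_eq, hd.cexp.deriv, h.exp_eq z hz t,
      mul_div_cancel_left₀ _ (Complex.exp_ne_zero _)]
  have hd (z : ℂ) (hz : z ∈ strip δ) : HasDerivAt (fun w => L₂ w t - L₁ w t) 0 z := by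
    have := (ld h₂ hz).fun_sub (ld h₁ hz)
    rwa [h z hz, sub_self] at this
  have h0 (x : ℝ) : (x : ℂ) ∈ strip δ := by simpa [strip] using hδ
  have hconst (x : ℝ) : L₂ x t - L₁ x t = L₂ z t - L₁ z t :=
    hopen.is_const_of_deriv_eq_zero (convex_strip δ).isPreconnected
      (fun z hz => (hd z hz).differentiableAt.differentiableWithinAt)
      (fun z hz => (hd z hz).deriv) (h0 x) hz
  have t1 := tendsto_of_bigORight one_ne_zero (h₁.asymp.right t) (w := 0) rfl (by simpa using h0)
  have t2 := tendsto_of_bigORight one_ne_zero (h₂.asymp.right t) (w := 0) rfl (by simpa using h0)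
  have t3 := t2.sub t1
  rw [sub_zero] at t3
  have := eq_of_tendsto_affine (a := L₂ z t - L₁ z t - (p₂ t - p₁ t)) (b := q₁ - q₂)
    (t3.congr fun x => by rw [← hconst x, add_zero]; ring)
  linear_combination this

lemma logDeriv_exp_div_exp {l m : ℝ → ℂ} {d e : ℂ} {x : ℝ} (hl : HasDerivAt l d x)
    (hm : HasDerivAt m e x) :
    logDeriv (fun y => Complex.exp (l y) / Complex.exp (m y)) x = d - e := by
  simp_rw [← Complex.exp_sub]
  rw [logDeriv_apply, (hl.fun_sub hm).cexp.deriv, mul_div_cancel_left₀ _ (Complex.exp_ne_zero _)]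

lemma tanhFormula_pot {δ : ℝ} (hδ : 0 < δ) {J Jt : ℕ → ℝ → ℝ → ℂ} {n m : ℕ}
    (h : DecayTower n m J Jt) (α : ℝ → ℂ) :
    TanhFormula δ (fun z t => Complex.exp (pot δ (fun x => J 0 x t) z + α t)) (J 0) := by
  intro z hz t
  obtain ⟨C, hC⟩ := (h.dec 0 (by simp)).dec t
  have hc := continuous_slice (h.cont 0 (by simp)) t
  refine ⟨integrable_tanh_karg_mul hδ hz (hC.integrable hc), ?_⟩
  have hd := (hasDerivAt_pot_tanh hδ hc hC hz).add_const (α t)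
  rw [logDeriv_apply, hd.cexp.deriv, mul_div_cancel_left₀ _ (Complex.exp_ne_zero _)]
  change _ = 1 / (2 * (δ : ℂ) * Complex.I) * ∫ s, Complex.tanh (karg δ z s) * J 0 s t
  have : (1 : ℂ) / (2 * δ * Complex.I) = Complex.I * -(1 / (2 * δ)) := by
    rw [← div_div, div_eq_mul_inv _ Complex.I, Complex.inv_I]; ring
  rw [this]; ring

lemma pot_lin {δ : ℝ} (hδ : 0 < δ) {z : ℂ} (hz : z ∈ closedStrip δ) {g g' : ℝ → ℂ} {C C' : ℝ}
    (hg : Continuous g) (hg' : Continuous g') (h : Dec C g) (h' : Dec C' g') (a b : ℂ) :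
    pot δ (fun x => a * g x + b * g' x) z = a * pot δ g z + b * pot δ g' z := by
  have e := (lightKer_logCosh hδ hz).conv_add hg hg' h h' a b 0
  simp only [conv, zero_add] at e
  rw [pot, e, pot, pot]
  ring

section

variable {δ : ℝ} {u v : ℝ → ℝ → ℂ}

/-- The difference of the derivatives of the two potentials at opposite boundary points. -/
lemma pot_density_lower_sub_upper (hδ : 0 < δ) (hu : RegularDecaying u) (hv : RegularDecaying v)
    (a : ℂ) (x t : ℝ) :
    pot δ (fun y => density δ u v a 1 y t) (x - Complex.I * δ / 2) -
      pot δ (fun y => density δ u v (-a) 1 y t) (x + Complex.I * δ / 2) =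
      -Complex.I / 2 * (u x t + v x t) + a * (u x t - v x t) := by
  have hk := heavyKer_diffKer hδ
  have hσ := hu.decayTower.add hv.decayTower
  have hf := hu.decayTower.add (hv.decayTower.const_mul (-1))
  have hS := hf.conv (by simp) hk
  obtain ⟨A₀, a₀⟩ := (hσ.dec 0 (by simp)).dec t
  obtain ⟨A₁, a₁⟩ := (hσ.dec 1 (by simp)).dec t
  obtain ⟨B₀, b₀⟩ := (hf.dec 0 (by simp)).dec t
  obtain ⟨B₁, b₁⟩ := (hf.dec 1 (by simp)).dec t
  obtain ⟨B₂, b₂⟩ := (hf.dec 2 (by simp)).dec t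
  obtain ⟨C₂, c₂⟩ := (hS.dec 2 (by simp)).dec t
  have cσ := continuous_slice (hσ.cont 1 (by simp)) t
  have cS := continuous_slice (hS.cont 2 (by simp)) t
  have e (a : ℂ) {z : ℂ} (hz : z ∈ closedStrip δ) := pot_lin hδ hz cσ cS a₁ c₂ (1 / 2) a
  have k1 := pot_lower_sub_upper hδ a₀ cσ a₁ (fun x => hσ.deriv_x 0 (by simp) x t) x
  have k2 := pot_conv_diffKer hδ (continuous_slice (hf.cont 0 (by simp)) t)
    (continuous_slice (hf.cont 1 (by simp)) t) (continuous_slice (hf.cont 2 (by simp)) t) b₀ b₁ b₂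
    (fun x => hf.deriv_x 0 (by simp) x t) (fun x => hf.deriv_x 1 (by simp) x t) x
  simp only [iteratedDeriv_zero] at k1 k2
  have e1 := e a (lower_mem_closedStrip hδ x)
  have e2 := e (-a) (upper_mem_closedStrip hδ x)
  simp only [density, Nat.reduceAdd]
  rw [e1, e2]
  linear_combination 1 / 2 * k1 + a * k2

/-- The potentials recover `u` and `v`, whatever the integration constants `α` and `β`. -/
lemma pot_recovers (hδ : 0 < δ) (hu : RegularDecaying u) (hv : RegularDecaying v)
    (α β : ℝ → ℂ) (x t : ℝ) :
    u x t = uOf δ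
      (fun z t => Complex.exp (pot δ (fun x => density δ u v (-Complex.I / 2) 0 x t) z + α t))
      (fun z t => Complex.exp (pot δ (fun x => density δ u v (Complex.I / 2) 0 x t) z + β t)) x t ∧
    v x t = vOf δ
      (fun z t => Complex.exp (pot δ (fun x => density δ u v (-Complex.I / 2) 0 x t) z + α t))
      (fun z t => Complex.exp (pot δ (fun x => density δ u v (Complex.I / 2) 0 x t) z + β t)) x t
    := by
  have line (a : ℂ) (γ : ℝ → ℂ) {w : ℂ} (hw : |w.im| ≤ δ / 2) :
      HasDerivAt (fun y : ℝ => pot δ (fun x => density δ u v a 0 x t) (y + w) + γ t)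
        (pot δ (fun x => density δ u v a 1 x t) (x + w)) x := by
    have h := hu.density hδ hv a
    obtain ⟨A₀, a₀⟩ := (h.dec 0 (by simp)).dec t
    obtain ⟨A₁, a₁⟩ := (h.dec 1 (by simp)).dec t
    have c₀ := continuous_slice (h.cont 0 (by simp)) t
    have c₁ := continuous_slice (h.cont 1 (by simp)) t
    exact (hasDerivAt_line hδ (fun z hz => hasDerivAt_pot hδ c₀ c₁ a₀ a₁
      (fun x => h.deriv_x 0 (by simp) x t) hz) (continuousOn_pot_static hδ c₀ a₀)
      (continuousOn_pot_static hδ c₁ a₁) hw x).add_const _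
  have wP : |(Complex.I * δ / 2).im| ≤ δ / 2 := by
    rw [im_I_mul_div_two, abs_of_pos (by positivity)]
  have wM : |(-(Complex.I * δ / 2)).im| ≤ δ / 2 := by
    rwa [Complex.neg_im, abs_neg]
  have k1 := pot_density_lower_sub_upper hδ hu hv (-Complex.I / 2) x t
  have k2 := pot_density_lower_sub_upper hδ hu hv (Complex.I / 2) x t
  rw [show -(-Complex.I / 2) = Complex.I / 2 by ring] at k1
  rw [show -(Complex.I / 2) = -Complex.I / 2 by ring] at k2
  simp only [uOf, vOf, shiftM, shiftP, sub_eq_add_neg (_ : ℂ) (Complex.I * δ / 2)] at k1 k2 ⊢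
  rw [logDeriv_exp_div_exp (line _ α wM) (line _ β wP),
    logDeriv_exp_div_exp (line _ β wM) (line _ α wP)]
  constructor
  · linear_combination -Complex.I * k1 + u x t * Complex.I_sq
  · linear_combination -Complex.I * k2 + v x t * Complex.I_sq

lemma isRegularLog_density (hδ : 0 < δ) (hu : RegularDecaying u) (hv : RegularDecaying v)
    (hs : IsSolution δ u v) (a : ℂ) {α : ℝ → ℂ} (hα : Differentiable ℝ α) :
    IsRegularLog δ (fun z t => Complex.exp (pot δ (fun x => density δ u v a 0 x t) z + α t))
      (fun z t => pot δ (fun x => density δ u v a 0 x t) z + α t)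
      (charge δ fun x => 1 / 2 * (u x 0 + v x 0))
      (fun t => moment δ (fun x => density δ u v a 0 x t) + α t)
      fun t => moment δ (fun x => density δ u v a 0 (-x) t) + α t :=
  (hu.density hδ hv a).isRegularLog hδ (fun t => (charge_density hδ hu hv hs a t).1)
    (fun t => (charge_density hδ hu hv hs a t).2) hα

theorem exists_isPotentialPair (hδ : 0 < δ) (hu : RegularDecaying u) (hv : RegularDecaying v)
    (hs : IsSolution δ u v) : ∃ F G : ℂ → ℝ → ℂ, IsPotentialPair δ u v F G := by
  have h1 := (isRegularLog_density hδ hu hv hs (-Complex.I / 2) (differentiable_const 0)).isLog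
  have h2 := (isRegularLog_density hδ hu hv hs (Complex.I / 2) (differentiable_const 0)).isLog
  have h3 := (isRegularLog_density hδ hu hv hs (Complex.I / 2)
    (h1.asymp.diff_fp.sub h2.asymp.diff_fp)).isLog
  refine ⟨_, _, ?_, ?_, _, _, _, 0, _, _, _, _, h1, h3, fun t => ?_⟩
  · rw [uPlus_add_vPlus hδ hu hv]
    exact tanhFormula_pot hδ (hu.density hδ hv _) _
  · rw [uMinus_add_vMinus hδ hu hv]
    exact tanhFormula_pot hδ (hu.density hδ hv _) _
  · simp

lemma TanhFormula.logDeriv_eq {F₁ F₂ : ℂ → ℝ → ℂ} {J : ℝ → ℝ → ℂ} (h₁ : TanhFormula δ F₁ J)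
    (h₂ : TanhFormula δ F₂ J) (t : ℝ) : ∀ z ∈ strip δ,
      logDeriv (fun w => F₁ w t) z = logDeriv (fun w => F₂ w t) z := fun z hz =>
  mul_left_cancel₀ Complex.I_ne_zero ((h₁ z hz t).2.trans (h₂ z hz t).2.symm)

theorem IsPotentialPair.unique (hδ : 0 < δ) {F₁ G₁ F₂ G₂ : ℂ → ℝ → ℂ}
    (h₁ : IsPotentialPair δ u v F₁ G₁) (h₂ : IsPotentialPair δ u v F₂ G₂) :
    ∃ (a : ℝ → ℂ) (b : ℂ), (∀ t : ℝ, a t ≠ 0) ∧ b ≠ 0 ∧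
      ∀ z ∈ strip δ, ∀ t : ℝ, F₂ z t = a t * F₁ z t ∧ G₂ z t = b * a t * G₁ z t := by
  obtain ⟨L₁, M₁, q₁, c₁, p₁, _, r₁, _, hF₁, hG₁, e₁⟩ := h₁.logs
  obtain ⟨L₂, M₂, q₂, c₂, p₂, _, r₂, _, hF₂, hG₂, e₂⟩ := h₂.logs
  refine ⟨fun t => Complex.exp (p₂ t - p₁ t), Complex.exp (c₁ - c₂),
    fun t => Complex.exp_ne_zero _, Complex.exp_ne_zero _, fun z hz t => ?_⟩
  rw [hF₁.exp_eq z hz, hF₂.exp_eq z hz, hG₁.exp_eq z hz, hG₂.exp_eq z hz, ← Complex.exp_add,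
    ← Complex.exp_add, ← Complex.exp_add,
    hF₁.sub_eq hδ hF₂ (h₁.formula_F.logDeriv_eq h₂.formula_F t) hz,
    hG₁.sub_eq hδ hG₂ (h₁.formula_G.logDeriv_eq h₂.formula_G t) hz, ← e₁ t, ← e₂ t]
  constructor <;> congr 1 <;> ring

theorem IsPotentialPair.admissible (hδ : 0 < δ) (hu : RegularDecaying u) (hv : RegularDecaying v)
    (hs : IsSolution δ u v) {F G : ℂ → ℝ → ℂ} (h : IsPotentialPair δ u v F G) :
    ∃ F' G' : ℂ → ℝ → ℂ,
      (∀ z ∈ strip δ, ∀ t : ℝ, F' z t = F z t ∧ G' z t = G z t) ∧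
      Admissible δ F' G' ∧ Bilinear δ F' G' ∧
      (∀ x t : ℝ, u x t = uOf δ F' G' x t ∧ v x t = vOf δ F' G' x t) := by
  obtain ⟨L, M, q, c, p, _, r, _, hF, hG, e⟩ := h.logs
  have f1 := isRegularLog_density hδ hu hv hs (-Complex.I / 2) (differentiable_const 0)
  have f2 := isRegularLog_density hδ hu hv hs (Complex.I / 2) (differentiable_const 0)
  obtain ⟨α, dα, eα⟩ : ∃ α : ℝ → ℂ, Differentiable ℝ α ∧
      ∀ t, α t = p t - moment δ fun x => density δ u v (-Complex.I / 2) 0 x t :=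
    ⟨_, hF.asymp.diff_fp.sub f1.asymp.diff_fp, fun t => by simp⟩
  obtain ⟨β, dβ, eβ⟩ : ∃ β : ℝ → ℂ, Differentiable ℝ β ∧
      ∀ t, β t = r t - moment δ fun x => density δ u v (Complex.I / 2) 0 x t :=
    ⟨_, hG.asymp.diff_fp.sub f2.asymp.diff_fp, fun t => by simp⟩
  have g1 := isRegularLog_density hδ hu hv hs (-Complex.I / 2) dα
  have g2 := isRegularLog_density hδ hu hv hs (Complex.I / 2) dβ
  have tF := h.formula_F
  have tG := h.formula_G
  rw [uPlus_add_vPlus hδ hu hv] at tF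
  rw [uMinus_add_vMinus hδ hu hv] at tG
  have hA : Admissible δ _ _ := ⟨_, _, _, c, _, _, _, _, g1, g2, fun t => by simp [eα, eβ, e]⟩
  have hr := pot_recovers hδ hu hv α β
  refine ⟨_, _, fun z hz t => ⟨?_, ?_⟩, hA, (bilinear_iff_isSolution hδ hA).2 ?_, hr⟩
  · rw [hF.exp_eq z hz, f1.isLog.sub_eq hδ hF
      ((tanhFormula_pot hδ (hu.density hδ hv _) fun _ => 0).logDeriv_eq tF t) hz]
    simp [eα]
  · rw [hG.exp_eq z hz, f2.isLog.sub_eq hδ hG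
      ((tanhFormula_pot hδ (hu.density hδ hv _) fun _ => 0).logDeriv_eq tG t) hz]
    simp [eβ]
  · have eu := funext₂ fun x t => (hr x t).1
    have ev := funext₂ fun x t => (hr x t).2
    convert hs using 1
    · exact eu.symm
    · exact ev.symm

end

end NonchiralILW

end

theorem mainTheorem2 (δ : ℝ) (hδ : 0 < δ) :
    (∀ F G : ℂ → ℝ → ℂ, NonchiralILW.Admissible δ F G →
      (NonchiralILW.Bilinear δ F G ↔
        NonchiralILW.IsSolution δ (NonchiralILW.uOf δ F G) (NonchiralILW.vOf δ F G))) ∧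
    (∀ u v : ℝ → ℝ → ℂ, NonchiralILW.RegularDecaying u → NonchiralILW.RegularDecaying v →
      NonchiralILW.IsSolution δ u v →
      (∀ t : ℝ, NonchiralILW.TExists δ (fun x => u x t) ∧
        NonchiralILW.TExists δ (fun x => v x t) ∧
        NonchiralILW.TtExists δ (fun x => u x t) ∧
        NonchiralILW.TtExists δ (fun x => v x t)) →
      (∃ F G : ℂ → ℝ → ℂ, NonchiralILW.IsPotentialPair δ u v F G) ∧
      (∀ F₁ G₁ F₂ G₂ : ℂ → ℝ → ℂ, NonchiralILW.IsPotentialPair δ u v F₁ G₁ →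
        NonchiralILW.IsPotentialPair δ u v F₂ G₂ →
        ∃ (a : ℝ → ℂ) (b : ℂ), (∀ t : ℝ, a t ≠ 0) ∧ b ≠ 0 ∧
          ∀ z ∈ NonchiralILW.strip δ, ∀ t : ℝ,
            F₂ z t = a t * F₁ z t ∧ G₂ z t = b * a t * G₁ z t) ∧
      (∀ F G : ℂ → ℝ → ℂ, NonchiralILW.IsPotentialPair δ u v F G →
        ∃ F' G' : ℂ → ℝ → ℂ,
          (∀ z ∈ NonchiralILW.strip δ, ∀ t : ℝ, F' z t = F z t ∧ G' z t = G z t) ∧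
          NonchiralILW.Admissible δ F' G' ∧
          NonchiralILW.Bilinear δ F' G' ∧
          (∀ x t : ℝ, u x t = NonchiralILW.uOf δ F' G' x t ∧
            v x t = NonchiralILW.vOf δ F' G' x t))) :=
  ⟨fun _ _ hA => NonchiralILW.bilinear_iff_isSolution hδ hA, fun _ _ hu hv hs _ =>
    ⟨NonchiralILW.exists_isPotentialPair hδ hu hv hs,
      fun _ _ _ _ h₁ h₂ => h₁.unique hδ h₂,
      fun _ _ h => h.admissible hδ hu hv hs⟩⟩
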